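/- Let $d\ge 3$. For a vector $\vec r\in\mathbb Z_{\ge 0}^d$ let $\mathcal R_{\vec r}$ be the set of dyadic rectangles $R=R_1\times\cdots\times R_d\subset[0,1]^d$, where $R_k=[m_k2^{-r_k},(m_k+1)2^{-r_k})$ and $0\le m_k<2^{r_k}$. Let $h_R(x)=\prod_{k=1}^d h_{R_k}(x_k)$, where for a dyadic interval $J$ the Haar function is $h_J=-\mathbf 1_{J_{\mathrm{left}}}+\mathbf 1_{J_{\mathrm{right}}}$. Given real coefficients $\alpha(R)$, put $$f_{\vec r}=\sum_{R\in\mathcal R_{\vec r}}\operatorname{sgn}(\alpha(R))\,h_R ,$$ with $\operatorname{sgn}(0)=0$ (if all $\alpha(R)=\pm1$, this is an arbitrary sum $\sum_{R\in\mathcal R_{\vec r}}\pm h_R$). For an integer $n\ge 0$ let $\mathbb H_n$ be the set of $\vec r\in\mathbb Z_{\ge0}^d$ with $r_1+\cdots+r_d=n$. Let $I_1,\dots,I_q$ be a division of $\{1,\dots,n\}$ into $q$ disjoint intervals of integers, ordered from smallest to largest (for instance, of equal length), and let $\mathbb A_t=\{\vec r\in\mathbb H_n: r_1\in I_t\}$.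 For $1\le k\le d$ and $1\le t_1,t_2\le q$ set $$\Phi_{t_1,t_2,k}=\sum_{\substack{\vec r\in\mathbb A_{t_1},\ \vec s\in\mathbb A_{t_2}\\ \vec r\ne\vec s,\ r_k=s_k}} f_{\vec r}\cdot f_{\vec s}.$$ Then there is a constant $C>0$, depending only on the dimension $d$, such that for all $n$, all $q$, all such divisions, all coefficients $\alpha$, all $1\le k\le d$, all $1\le t_1,t_2\le q$ and all $2\le p<\infty$, $$\|\Phi_{t_1,t_2,k}\|_{L^p([0,1]^d)}\le C\,p^{\,d-1/2}\,n^{\,d-3/2}.$$ -/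

import Mathlib

open scoped BigOperators

noncomputable section

namespace BeckGain

/-- The dyadic interval `[m 2⁻ʳ, (m+1) 2⁻ʳ)`; it lies in `[0,1)` exactly when `m < 2 ^ r`. -/
def dyadicInterval (r m : ℕ) : Set ℝ :=
  Set.Ico ((m : ℝ) / 2 ^ r) (((m : ℝ) + 1) / 2 ^ r)

/-- The `L^∞` normalized Haar function of the dyadic interval `I = [m 2⁻ʳ, (m+1) 2⁻ʳ)`:
`-1` on the left half of `I`, `+1` on the right half, `0` elsewhere. -/
def haar (r m : ℕ) (x : ℝ) : ℝ :=
  -(dyadicInterval (r + 1) (2 * m)).indicator 1 x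
    + (dyadicInterval (r + 1) (2 * m + 1)).indicator 1 x

/-- The Haar function of the dyadic rectangle with sides
`[m k 2^(-r k), (m k + 1) 2^(-r k))`: the product of the one-dimensional Haar functions. -/
def haarRect {d : ℕ} (r m : Fin d → ℕ) (x : Fin d → ℝ) : ℝ :=
  ∏ k, haar (r k) (m k) (x k)

/-- Positions of the dyadic rectangles `R ⊆ [0,1]^d` with side lengths `|R k| = 2^(-r k)`. -/
def positions {d : ℕ} (r : Fin d → ℕ) : Finset (Fin d → ℕ) :=
  Fintype.piFinset fun k => Finset.range (2 ^ r k)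

/-- `f_r = ∑_R sgn (α R) h_R`, the sum over the dyadic rectangles `R ⊆ [0,1]^d` with
`|R k| = 2^(-r k)`. A rectangle is given by its side exponents `r` and its position `m`,
so the coefficient `α (R)` is `α r m`. -/
def rFun {d : ℕ} (α : (Fin d → ℕ) → (Fin d → ℕ) → ℝ) (r : Fin d → ℕ) (x : Fin d → ℝ) : ℝ :=
  ∑ m ∈ positions r, Real.sign (α r m) * haarRect r m x

/-- The hyperbolic vectors of length `n`: all `r : Fin d → ℕ` with `∑ k, r k = n`. -/
def hyperbolic (d n : ℕ) : Finset (Fin d → ℕ) :=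
  Finset.piAntidiag Finset.univ n

/-- `I 0, …, I (q-1)` divide `{1, …, n}` into disjoint intervals of integers, ordered from
smallest to largest. -/
structure IsDivision (n q : ℕ) (I : Fin q → Finset ℕ) : Prop where
  ordConnected : ∀ t, (I t : Set ℕ).OrdConnected
  ordered : ∀ s t, s < t → ∀ i ∈ I s, ∀ j ∈ I t, i < j
  union_eq : Finset.univ.biUnion I = Finset.Icc 1 n

/-- The hyperbolic vectors of length `n` whose first coordinate lies in `J`. -/
def slab {d : ℕ} (hd : 0 < d) (n : ℕ) (J : Finset ℕ) : Finset (Fin d → ℕ) :=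
  (hyperbolic d n).filter fun r => r ⟨0, hd⟩ ∈ J

/-- The pairs `(r, s)` with `r` and `s` hyperbolic of length `n`, first coordinates in `J₁` and
`J₂` respectively, `r ≠ s`, and the coincidence `r k = s k`. -/
def coincidencePairs {d : ℕ} (hd : 0 < d) (n : ℕ) (J₁ J₂ : Finset ℕ) (k : Fin d) :
    Finset ((Fin d → ℕ) × (Fin d → ℕ)) :=
  (slab hd n J₁ ×ˢ slab hd n J₂).filter fun rs => rs.1 ≠ rs.2 ∧ rs.1 k = rs.2 k

/-- The sum of the products `f_r f_s` over the pairs with a coincidence in coordinate `k`. -/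
def Phi {d : ℕ} (hd : 0 < d) (α : (Fin d → ℕ) → (Fin d → ℕ) → ℝ) (n : ℕ)
    (J₁ J₂ : Finset ℕ) (k : Fin d) (x : Fin d → ℝ) : ℝ :=
  ∑ rs ∈ coincidencePairs hd n J₁ J₂ k, rFun α rs.1 x * rFun α rs.2 x

end BeckGain

end

set_option linter.unusedSectionVars false

namespace BeckGain

/-! ### A potential for the square function inequality -/

/-! The exponent is a parameter count. A pair of hyperbolic vectors with one coincidence has 2d - 3
free coordinates, and square-root cancellation in each suggests the size (pn)^((2d-3)/2). This is
what the argument gives; the stated power of `p` is weaker because `p ≥ 1`.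

Cancellation comes from a square function inequality on a finite set with sign-flipping symmetries,
a model of martingale differences for the Haar filtration. Each coordinate costs a factor of order
`k` in the square of the L^(2k) norm (`square_function_one`). Iterating over coordinates gives
`square_function`, which applies to any sum of functions having pairwise different levels.

Fixing the coincident value `w`, one has to bound ∑_w ∑_{r ≠ s} f_{w,r} g_{w,s}, where `r`, `s`
range over the other coordinates `E` and the sum of all exponents is fixed. This is done by
induction on the size of `E`, in a form localized to dyadic blocks of side `2 ^ M l` (`FullBound`).
Equal coordinates are frozen (`StrictBound.full`), and the other pairs are sorted by the set `P` of
coordinates where `s < r`.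

If `P` is all of `E`, or empty, the larger vector is the level of every product, and the square
function applies at once (`ordered_bound`). Otherwise the level is the coordinatewise maximum, made
of a part `v` of `r` on `P` and a part `z` of `s` on `Q = E \ P`. A Whitney decomposition into pairs
of adjacent half blocks decouples the conditions `s < r` and `r < s`, so the sums over the lower
coordinates factor into a fiber of `f` times a fiber of `g`. The square function leaves ∑_{v,z} (∑_w
A_{w,v} B_{w,z})². Its diagonal in `w` is handled by counting (`diag_bound`). Its off-diagonal terms
factor as (∑_v A_{w,v} A_{w',v}) (∑_z B_{w,z} B_{w',z}); each factor is again a bilinear sum of the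
same kind over fewer coordinates, with one coordinate of `v` or `z` in the role of `w`
(`off_factor`), so induction applies. The bound at scale `μ` gains a power of ∏ 2^(μ l - M l), and
summing over scales is harmless (`scale_bound`, `mixed_bound`).

Finally `f_r` is constant on dyadic cells of side 2^(-(n+1)), and flipping binary digits of the cell
index supplies the symmetries (`cellFun_lvl`, `eLpNorm_le_mnorm`). -/

lemma pow_succ_sub_pow_succ_le (m : ℕ) {x y : ℝ} (hx : 0 ≤ x) (hy : 0 ≤ y) :
    x ^ (m + 1) - y ^ (m + 1) ≤ (m + 1) * (x - y) * x ^ m := by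
  rcases hx.eq_or_lt with rfl | hx'
  · have : 0 ≤ y ^ (m + 1) := by positivity
    rcases Nat.eq_zero_or_pos m with rfl | hm
    · simp
    · simp [hm.ne', this]
  · have h := one_add_mul_le_pow (a := (y - x) / x) (n := m + 1) (by
      rw [le_div_iff₀ hx']; linarith)
    have h2 : 1 + (y - x) / x = y / x := by field_simp; ring
    rw [h2, div_pow, le_div_iff₀ (by positivity)] at h
    have h3 : (1 + ((m + 1 : ℕ) : ℝ) * ((y - x) / x)) * x ^ (m + 1)
        = x ^ (m + 1) + (m + 1) * (y - x) * x ^ m := by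
      push_cast
      rw [pow_succ]
      field_simp
    rw [h3] at h
    linarith

lemma posPart_pow_sub_le (m : ℕ) {a b : ℝ} (hab : b ≤ a) :
    (max a 0) ^ (m + 1) - (max b 0) ^ (m + 1) ≤ (m + 1) * (a - b) * (max a 0) ^ m := by
  refine (pow_succ_sub_pow_succ_le m (le_max_right a 0) (le_max_right b 0)).trans ?_
  rcases le_total a 0 with ha | ha
  · have hb : b ≤ 0 := hab.trans ha
    rw [max_eq_right ha, max_eq_right hb]
    have : 0 ≤ (m + 1 : ℝ) * (a - b) * 0 ^ m := by
      have := sub_nonneg.2 hab; positivity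
    simpa using this
  · gcongr
    rw [max_eq_left ha]
    linarith [le_max_left b 0]

/-- Convexity of the truncated power at `b`. The case `m = 0` is excluded because `0 ^ 0 = 1` would
make it fail for `b < a ≤ 0`. -/
lemma le_posPart_pow_sub (m : ℕ) (hm : m ≠ 0) {a b : ℝ} (hab : b ≤ a) :
    (m + 1) * (a - b) * (max b 0) ^ m ≤ (max a 0) ^ (m + 1) - (max b 0) ^ (m + 1) := by
  rcases le_total b 0 with hb | hb
  · rw [max_eq_right hb]
    simp [hm]
  · have ha := hb.trans hab
    rw [max_eq_left hb, max_eq_left ha]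
    have := pow_succ_sub_pow_succ_le m hb ha
    linarith

/-- The forward step is bounded by the slope at `Z + s`, the backward step from below by the slope
at `Z - s`; the difference of these slopes is a first difference of the next lower power. -/
lemma posPart_second_difference (m : ℕ) (Z s : ℝ) (hs : 0 ≤ s) :
    ((max (Z + s) 0) ^ (m + 2) + (max (Z - s) 0) ^ (m + 2)) / 2 - (max Z 0) ^ (m + 2)
      ≤ (m + 2) * (m + 1) * s ^ 2 * (max (Z + s) 0) ^ m := by
  have h1 := posPart_pow_sub_le (m + 1) (a := Z + s) (b := Z) (by linarith)
  have h2 := le_posPart_pow_sub (m + 1) (by omega) (a := Z) (b := Z - s) (by linarith)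
  have h3 := posPart_pow_sub_le m (a := Z + s) (b := Z - s) (by linarith)
  push_cast at h1 h2
  have h4 : (m + 2 : ℝ) * s * ((max (Z + s) 0) ^ (m + 1) - (max (Z - s) 0) ^ (m + 1))
      ≤ (m + 2 : ℝ) * s * ((m + 1) * (Z + s - (Z - s)) * (max (Z + s) 0) ^ m) := by gcongr
  have e1 : (m + 1 + 1 : ℝ) * (Z + s - Z) * max (Z + s) 0 ^ (m + 1)
      = (m + 2) * s * max (Z + s) 0 ^ (m + 1) := by ring
  have e2 : (m + 1 + 1 : ℝ) * (Z - (Z - s)) * max (Z - s) 0 ^ (m + 1)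
      = (m + 2) * s * max (Z - s) 0 ^ (m + 1) := by ring
  rw [e1] at h1
  rw [e2] at h2
  have e3 : (m + 2 : ℝ) * s * ((m + 1) * (Z + s - (Z - s)) * (max (Z + s) 0) ^ m)
      = 2 * ((m + 2) * (m + 1) * s ^ 2 * (max (Z + s) 0) ^ m) := by ring
  linarith

lemma posPart_le_mul_exp {Z δ : ℝ} (hZ : 0 < Z) :
    max (Z + δ) 0 ≤ Z * Real.exp (δ / Z) := by
  apply max_le _ (by positivity)
  have := Real.add_one_le_exp (δ / Z)
  calc Z + δ = Z * (δ / Z + 1) := by field_simp; ring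
    _ ≤ _ := by gcongr

/-- Far above the threshold the potential is a supermartingale. With Z = u - 8ky, its argument moves
by the drift -(8k-1)α plus a symmetric jump ±2t. Bounding (Z + δ)₊ by Z exp(δ/Z), the average is
controlled by cosh(2kt/Z) ≤ exp(2k²t²/Z²). Since t² ≤ uα ≤ 2Zα, this exponent is at most 4k²α/Z,
which the drift k(8k-1)α/Z absorbs. -/
lemma potential_step_far (k : ℕ) (hk : 2 ≤ k) {u y α t : ℝ} (hu : 0 ≤ u) (hy : 0 ≤ y)
    (hα : 0 ≤ α) (ht : t ^ 2 ≤ u * α) (hfar : 2 * (8 * k * y) ≤ u) :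
    ((max (u + α + 2 * t - 8 * k * (y + α)) 0) ^ k
      + (max (u + α - 2 * t - 8 * k * (y + α)) 0) ^ k) / 2 ≤ (max (u - 8 * k * y) 0) ^ k := by
  have hk' : (2 : ℝ) ≤ k := by exact_mod_cast hk
  have hk0 : k ≠ 0 := by omega
  rcases hu.eq_or_lt with rfl | hu'
  · have ht0 : t = 0 := by
      have : t ^ 2 ≤ 0 := by simpa using ht
      nlinarith
    subst ht0
    have h1 : max (0 + α + 2 * 0 - 8 * k * (y + α)) 0 = 0 := by
      apply max_eq_right; nlinarith
    have h2 : max (0 + α - 2 * 0 - 8 * k * (y + α)) 0 = 0 := by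
      apply max_eq_right; nlinarith
    rw [h1, h2]; simp [hk0]
  set Z := u - 8 * k * y with hZdef
  have hZu : u ≤ 2 * Z := by rw [hZdef]; linarith
  have hZ : 0 < Z := by linarith
  set a := -(k * ((8 * k - 1) * α) / Z) with ha
  set b := k * (2 * t) / Z with hb
  have e1 : (max (u + α + 2 * t - 8 * k * (y + α)) 0) ^ k ≤ Z ^ k * Real.exp (a + b) := by
    have := posPart_le_mul_exp (δ := -((8 * k - 1) * α) + 2 * t) hZ
    have h2 := pow_le_pow_left₀ (le_max_right _ _) this k
    rw [mul_pow, ← Real.exp_nat_mul] at h2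
    have e3 : u + α + 2 * t - 8 * k * (y + α) = Z + (-((8 * k - 1) * α) + 2 * t) := by
      rw [hZdef]; ring
    have e4 : a + b = k * ((-((8 * k - 1) * α) + 2 * t) / Z) := by
      rw [ha, hb]; field_simp
    rw [e3, e4]
    exact h2
  have e2 : (max (u + α - 2 * t - 8 * k * (y + α)) 0) ^ k ≤ Z ^ k * Real.exp (a - b) := by
    have := posPart_le_mul_exp (δ := -((8 * k - 1) * α) - 2 * t) hZ
    have h2 := pow_le_pow_left₀ (le_max_right _ _) this k
    rw [mul_pow, ← Real.exp_nat_mul] at h2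
    have e3 : u + α - 2 * t - 8 * k * (y + α) = Z + (-((8 * k - 1) * α) - 2 * t) := by
      rw [hZdef]; ring
    have e4 : a - b = k * ((-((8 * k - 1) * α) - 2 * t) / Z) := by
      rw [ha, hb]; field_simp
    rw [e3, e4]
    exact h2
  have hmax : max Z 0 = Z := max_eq_left hZ.le
  rw [hmax]
  have hcosh : (Real.exp (a + b) + Real.exp (a - b)) / 2 ≤ 1 := by
    have h1 : (Real.exp (a + b) + Real.exp (a - b)) / 2 = Real.exp a * Real.cosh b := by
      rw [Real.cosh_eq, Real.exp_add, sub_eq_add_neg, Real.exp_add]; ring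
    rw [h1]
    have h2 := Real.cosh_le_exp_half_sq b
    have h3 : a + b ^ 2 / 2 ≤ 0 := by
      rw [ha, hb]
      have : -(k * ((8 * k - 1) * α) / Z) + (k * (2 * t) / Z) ^ 2 / 2
          = k / Z ^ 2 * (2 * k * t ^ 2 - (8 * k - 1) * α * Z) := by
        field_simp; ring
      rw [this]
      apply mul_nonpos_of_nonneg_of_nonpos (by positivity)
      have h5 : t ^ 2 ≤ 2 * Z * α := ht.trans (by gcongr)
      have h6 : 2 * k * t ^ 2 ≤ 2 * k * (2 * Z * α) := by gcongr
      have h7 : 0 ≤ Z * α := by positivity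
      nlinarith
    calc Real.exp a * Real.cosh b ≤ Real.exp a * Real.exp (b ^ 2 / 2) := by gcongr
      _ = Real.exp (a + b ^ 2 / 2) := by rw [Real.exp_add]
      _ ≤ 1 := Real.exp_le_one_iff.2 h3
  calc _ ≤ (Z ^ k * Real.exp (a + b) + Z ^ k * Real.exp (a - b)) / 2 := by gcongr
    _ = Z ^ k * ((Real.exp (a + b) + Real.exp (a - b)) / 2) := by ring
    _ ≤ Z ^ k * 1 := by gcongr
    _ = Z ^ k := mul_one _

/-- Here `u` is at most of order `k * y`, so whatever the potential gains can be charged to the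
growth of `y ^ k`. -/
lemma potential_step_near (k : ℕ) (hk : 2 ≤ k) {u y α t : ℝ} (hu : 0 ≤ u) (hy : 0 ≤ y)
    (hα : 0 ≤ α) (ht : t ^ 2 ≤ u * α) (ht0 : 0 ≤ t) (hnear : u < 2 * (8 * k * y)) :
    ((max (u + α + 2 * t - 8 * k * (y + α)) 0) ^ k
      + (max (u + α - 2 * t - 8 * k * (y + α)) 0) ^ k) / 2
      ≤ (max (u - 8 * k * y) 0) ^ k + (32 * k) ^ k * ((y + α) ^ k - y ^ k) := by
  have hk' : (2 : ℝ) ≤ k := by exact_mod_cast hk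
  have hk0 : k ≠ 0 := by omega
  obtain ⟨m, rfl⟩ : ∃ m, k = m + 2 := ⟨k - 2, by omega⟩
  set k := m + 2
  have hgrow : k * α * y ^ (m + 1) ≤ (y + α) ^ k - y ^ k := by
    have := pow_succ_sub_pow_succ_le (m + 1) hy (add_nonneg hy hα)
    have e : ((m + 1 : ℕ) + 1 : ℝ) = k := by simp [k]; ring
    rw [e] at this
    have h2 : (k : ℝ) * (y - (y + α)) * y ^ (m + 1) = - (k * α * y ^ (m + 1)) := by ring
    rw [h2] at this
    have : y ^ (m + 1 + 1) = y ^ k := rfl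
    linarith
  -- If `y ≤ kα`, then `y ^ k` is itself dominated by the growth and crude bounds suffice. Otherwise
  -- the jump `2t` is at most `8y`, and the first-order terms cancel in a second difference.
  rcases le_or_gt y (k * α) with hbig | hsmall
  · have htb : 2 * t ≤ u + α := by
      nlinarith [sq_nonneg (u - α)]
    have hm : ∀ x : ℝ, x ≤ 32 * k * y → (max x 0) ^ k ≤ (32 * k * y) ^ k := fun x hx =>
      pow_le_pow_left₀ (le_max_right _ _) (max_le hx (by positivity)) _
    have h1 := hm (u + α + 2 * t - 8 * k * (y + α)) (by nlinarith)
    have h2 := hm (u + α - 2 * t - 8 * k * (y + α)) (by nlinarith)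
    have h3 : (32 * k * y) ^ k ≤ (32 * k) ^ k * ((y + α) ^ k - y ^ k) := by
      rw [mul_pow]
      gcongr
      calc y ^ k = y * y ^ (m + 1) := by simp only [k]; ring
        _ ≤ k * α * y ^ (m + 1) := by gcongr
        _ ≤ _ := hgrow
    have h4 : 0 ≤ (max (u - 8 * k * y) 0) ^ k := by positivity
    linarith
  · have hypos : 0 < y := by nlinarith
    set s := 2 * t
    have hs2 : s ^ 2 ≤ 64 * k * y * α := by
      have : u * α ≤ 2 * (8 * k * y) * α := by gcongr
      simp only [s]; nlinarith
    have hs8 : s ≤ 8 * y := by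
      apply le_of_abs_le
      apply abs_le_of_sq_le_sq _ (by positivity)
      nlinarith
    have hmono : ∀ x x' : ℝ, x ≤ x' → (max x 0) ^ k ≤ (max x' 0) ^ k := fun x x' hx =>
      pow_le_pow_left₀ (le_max_right _ _) (max_le_max_right 0 hx) _
    have h1 := hmono (u + α + 2 * t - 8 * k * (y + α)) ((u - 8 * k * y) + s) (by
      simp only [s]; nlinarith)
    have h2 := hmono (u + α - 2 * t - 8 * k * (y + α)) ((u - 8 * k * y) - s) (by
      simp only [s]; nlinarith)
    have h3 := posPart_second_difference m (u - 8 * k * y) s (by positivity)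
    have h4 : (m + 2 : ℝ) * (m + 1) * s ^ 2 * (max (u - 8 * k * y + s) 0) ^ m
        ≤ (32 * k) ^ k * ((y + α) ^ k - y ^ k) := by
      have ha : max (u - 8 * k * y + s) 0 ≤ 32 * k * y := by
        apply max_le _ (by positivity)
        nlinarith
      have hkm : (k : ℝ) = m + 2 := by simp [k]
      calc (m + 2 : ℝ) * (m + 1) * s ^ 2 * (max (u - 8 * k * y + s) 0) ^ m
          ≤ k * k * (64 * k * y * α) * (32 * k * y) ^ m := by
            rw [hkm]
            rw [hkm] at hs2 ha
            gcongr
            linarith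
        _ = (32 * k) ^ m * (64 * k ^ 2) * (k * α * y ^ (m + 1)) := by
            rw [mul_pow]; ring
        _ ≤ (32 * k) ^ m * (32 * k) ^ 2 * (k * α * y ^ (m + 1)) := by
            gcongr
            nlinarith
        _ = (32 * k) ^ k * (k * α * y ^ (m + 1)) := by rw [← pow_add]
        _ ≤ _ := by gcongr
    have h5 : ((max (u + α + 2 * t - 8 * k * (y + α)) 0) ^ k
      + (max (u + α - 2 * t - 8 * k * (y + α)) 0) ^ k) / 2
      ≤ ((max (u - 8 * k * y + s) 0) ^ k + (max (u - 8 * k * y - s) 0) ^ k) / 2 := by linarith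
    linarith

/-- For a vector-valued partial sum `S` and its next difference `D`, the roles are u = |S|², t = ⟨S,
D⟩, α = |D|², while `y` is the square function so far; |S ± D|² = u + α ± 2t. -/
lemma potential_step (k : ℕ) (hk : 2 ≤ k) {u y α t : ℝ} (hu : 0 ≤ u) (hy : 0 ≤ y)
    (hα : 0 ≤ α) (ht : t ^ 2 ≤ u * α) :
    ((max (u + α + 2 * t - 8 * k * (y + α)) 0) ^ k
      + (max (u + α - 2 * t - 8 * k * (y + α)) 0) ^ k) / 2
      ≤ (max (u - 8 * k * y) 0) ^ k + (32 * k) ^ k * ((y + α) ^ k - y ^ k) := by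
  rcases le_or_gt (2 * (8 * k * y)) u with hfar | hnear
  · have h1 := potential_step_far k hk hu hy hα ht hfar
    have h2 : y ^ k ≤ (y + α) ^ k := by gcongr; linarith
    have h3 : 0 ≤ (32 * (k : ℝ)) ^ k * ((y + α) ^ k - y ^ k) :=
      mul_nonneg (by positivity) (by linarith)
    linarith
  · rcases le_total 0 t with ht0 | ht0
    · exact potential_step_near k hk hu hy hα ht ht0 hnear
    · have := potential_step_near k hk (t := -t) hu hy hα (by simpa using ht) (by linarith) hnear
      have e1 : u + α + 2 * -t - 8 * k * (y + α) = u + α - 2 * t - 8 * k * (y + α) := by ring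
      have e2 : u + α - 2 * -t - 8 * k * (y + α) = u + α + 2 * t - 8 * k * (y + α) := by ring
      rw [e1, e2] at this
      linarith

/-! ### Square functions along involution-like symmetries -/

variable {Ω : Type*} [Fintype Ω]

/-- Square function inequality in one parameter for `ℓ²`-valued functions: `d t` changes sign under
the symmetry `τ t`, which leaves `d u`, `u < t`, unchanged. -/
lemma square_function_one {β : Type*} (τ : ℕ → Equiv.Perm Ω) (V : Finset β)
    (d : ℕ → β → Ω → ℝ) (T k : ℕ) (hk : 2 ≤ k)
    (hodd : ∀ t, ∀ v ∈ V, ∀ x, d t v (τ t x) = -d t v x)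
    (hinv : ∀ u t, u < t → ∀ v ∈ V, ∀ x, d u v (τ t x) = d u v x) :
    ∑ x, (∑ v ∈ V, (∑ t ∈ Finset.range T, d t v x) ^ 2) ^ k
      ≤ (128 * (k : ℝ)) ^ k * ∑ x, (∑ v ∈ V, ∑ t ∈ Finset.range T, d t v x ^ 2) ^ k := by
  set S : ℕ → β → Ω → ℝ := fun T v x => ∑ t ∈ Finset.range T, d t v x with hS
  set u : ℕ → Ω → ℝ := fun T x => ∑ v ∈ V, S T v x ^ 2 with hu
  set y : ℕ → Ω → ℝ := fun T x => ∑ v ∈ V, ∑ t ∈ Finset.range T, d t v x ^ 2 with hy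
  have hu0 : ∀ T x, 0 ≤ u T x := fun T x => Finset.sum_nonneg fun _ _ => sq_nonneg _
  have hy0 : ∀ T x, 0 ≤ y T x := fun T x =>
    Finset.sum_nonneg fun _ _ => Finset.sum_nonneg fun _ _ => sq_nonneg _
  -- The potential starts at zero and its increments telescope to a multiple of `∑ y ^ k`.
  have main : ∀ T, ∑ x, (max (u T x - 8 * k * y T x) 0) ^ k
      ≤ (32 * (k : ℝ)) ^ k * ∑ x, (y T x) ^ k := by
    intro T
    induction T with
    | zero =>
      have : k ≠ 0 := by omega
      simp [hu, hy, hS, this]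
    | succ T ih =>
      set α : Ω → ℝ := fun x => ∑ v ∈ V, d T v x ^ 2 with hα
      set c : Ω → ℝ := fun x => ∑ v ∈ V, S T v x * d T v x with hc
      have hα0 : ∀ x, 0 ≤ α x := fun x => Finset.sum_nonneg fun _ _ => sq_nonneg _
      have hyS : ∀ x, y (T + 1) x = y T x + α x := by
        intro x
        simp only [hy, hα, Finset.sum_range_succ, Finset.sum_add_distrib]
      have huS : ∀ x, u (T + 1) x = u T x + α x + 2 * c x := by
        intro x
        simp only [hu, hα, hc, hS, Finset.sum_range_succ, Finset.mul_sum, ← Finset.sum_add_distrib]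
        exact Finset.sum_congr rfl fun v _ => by ring
      have hSτ : ∀ v ∈ V, ∀ x, S T v (τ T x) = S T v x := fun v hv x =>
        Finset.sum_congr rfl fun t ht => hinv t T (Finset.mem_range.1 ht) v hv x
      have huτ : ∀ x, u (T + 1) (τ T x) = u T x + α x - 2 * c x := by
        intro x
        rw [huS]
        simp only [hu, hα, hc, Finset.mul_sum, ← Finset.sum_add_distrib, ← Finset.sum_sub_distrib]
        refine Finset.sum_congr rfl fun v hv => ?_
        rw [hSτ v hv, hodd T v hv]; ring
      have hyτ : ∀ x, y (T + 1) (τ T x) = y T x + α x := by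
        intro x
        rw [hyS]
        simp only [hy, hα]
        congr 1
        · refine Finset.sum_congr rfl fun v hv => Finset.sum_congr rfl fun t ht => ?_
          rw [hinv t T (Finset.mem_range.1 ht) v hv x]
        · refine Finset.sum_congr rfl fun v hv => ?_
          rw [hodd T v hv]; ring
      have hcs : ∀ x, c x ^ 2 ≤ u T x * α x := fun x => Finset.sum_mul_sq_le_sq_mul_sq _ _ _
      -- Averaging with the permutation `τ T` replaces conditional expectation: it fixes `S T`, `y
      -- T` and `α` and changes the sign of `c`.
      have hsym : ∑ x, (max (u (T + 1) x - 8 * k * y (T + 1) x) 0) ^ k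
          = ∑ x, ((max (u T x + α x + 2 * c x - 8 * k * (y T x + α x)) 0) ^ k
            + (max (u T x + α x - 2 * c x - 8 * k * (y T x + α x)) 0) ^ k) / 2 := by
        have h1 := Equiv.sum_comp (τ T) fun x => (max (u (T + 1) x - 8 * k * y (T + 1) x) 0) ^ k
        simp only [huτ, hyτ] at h1
        rw [← Finset.sum_div, Finset.sum_add_distrib, h1]
        simp only [huS, hyS]
        ring
      rw [hsym]
      calc _ ≤ ∑ x, ((max (u T x - 8 * k * y T x) 0) ^ k
            + (32 * (k : ℝ)) ^ k * ((y T x + α x) ^ k - y T x ^ k)) :=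
            Finset.sum_le_sum fun x _ => potential_step k hk (hu0 T x) (hy0 T x) (hα0 x) (hcs x)
        _ = ∑ x, (max (u T x - 8 * k * y T x) 0) ^ k + (32 * (k : ℝ)) ^ k *
            (∑ x, (y (T + 1) x) ^ k - ∑ x, y T x ^ k) := by
            rw [Finset.sum_add_distrib, ← Finset.mul_sum, Finset.sum_sub_distrib]
            simp only [hyS]
        _ ≤ _ := by linarith
  have hfin : ∀ x, u T x ^ k ≤ 2 ^ k * ((max (u T x - 8 * k * y T x) 0) ^ k
      + (8 * k) ^ k * y T x ^ k) := by
    intro x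
    have h1 : u T x ≤ max (u T x - 8 * k * y T x) 0 + 8 * k * y T x := by
      linarith [le_max_left (u T x - 8 * k * y T x) 0]
    have h2 : 0 ≤ 8 * (k : ℝ) * y T x := by have := hy0 T x; positivity
    have h3 := add_pow_le (le_max_right (u T x - 8 * k * y T x) 0) h2 k
    have h4 : (2 : ℝ) ^ (k - 1) ≤ 2 ^ k := pow_le_pow_right₀ (by norm_num) (by omega)
    calc u T x ^ k ≤ _ := pow_le_pow_left₀ (hu0 T x) h1 k
      _ ≤ _ := h3
      _ ≤ 2 ^ k * ((max (u T x - 8 * k * y T x) 0) ^ k + (8 * k * y T x) ^ k) := by gcongr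
      _ = _ := by rw [mul_pow (8 * (k : ℝ))]
  have hY : 0 ≤ ∑ x, y T x ^ k := Finset.sum_nonneg fun x _ => pow_nonneg (hy0 T x) k
  calc ∑ x, u T x ^ k ≤ ∑ x, 2 ^ k * ((max (u T x - 8 * k * y T x) 0) ^ k
      + (8 * k) ^ k * y T x ^ k) := Finset.sum_le_sum fun x _ => hfin x
    _ = 2 ^ k * (∑ x, (max (u T x - 8 * k * y T x) 0) ^ k + (8 * k) ^ k * ∑ x, y T x ^ k) := by
      rw [← Finset.mul_sum, Finset.sum_add_distrib, ← Finset.mul_sum]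
    _ ≤ 2 ^ k * ((32 * (k : ℝ)) ^ k * ∑ x, (y T x) ^ k + (32 * k) ^ k * ∑ x, y T x ^ k) := by
      gcongr
      · exact main T
      · norm_num
    -- The constant 128 is 32 · 2 · 2: one factor 2 from splitting `u` into two summands, the other
    -- from the stray 2, which is at most `2 ^ k`.
    _ = (2 * (2 ^ k * (32 * k) ^ k)) * ∑ x, y T x ^ k := by ring
    _ ≤ (2 ^ k * (2 ^ k * (32 * k) ^ k)) * ∑ x, y T x ^ k := by
      gcongr
      calc (2 : ℝ) = 2 ^ 1 := by norm_num
        _ ≤ 2 ^ k := pow_le_pow_right₀ (by norm_num) (by omega)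
    _ = _ := by rw [← mul_pow, ← mul_pow]; congr 2; ring

end BeckGain

namespace BeckGain

variable {Ω : Type*} {ι : Type*}

/-! ### Levels -/

/-- In every coordinate `l ∈ E`, the function `F` changes sign under the symmetry of level `r l` and
is invariant under the symmetries of higher level. -/
def Lvl (τ : ι → ℕ → Equiv.Perm Ω) (E : Finset ι) (r : ι → ℕ) (F : Ω → ℝ) : Prop :=
  ∀ l ∈ E, (∀ x, F (τ l (r l) x) = -F x) ∧ ∀ t, r l < t → ∀ x, F (τ l t x) = F x

lemma Lvl.mono {τ : ι → ℕ → Equiv.Perm Ω} {E E' : Finset ι} (h : E' ⊆ E) {r : ι → ℕ} {F : Ω → ℝ}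
    (hF : Lvl τ E r F) : Lvl τ E' r F := fun l hl => hF l (h hl)

lemma Lvl.congr {τ : ι → ℕ → Equiv.Perm Ω} {E : Finset ι} {r r' : ι → ℕ} {F : Ω → ℝ}
    (hF : Lvl τ E r F) (h : ∀ l ∈ E, r l = r' l) : Lvl τ E r' F := fun l hl => by
  rw [← h l hl]; exact hF l hl

variable [Fintype Ω]

/-! ### Normalized `L^q` norms on a finite set -/

/-- The `L^q` norm with respect to the uniform probability measure on `Ω`. -/
noncomputable def mnorm (q : ℕ) (F : Ω → ℝ) : ℝ :=
  ((∑ x, |F x| ^ q) / Fintype.card Ω) ^ ((1 : ℝ) / q)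

lemma avg_nonneg (q : ℕ) (F : Ω → ℝ) : 0 ≤ (∑ x, |F x| ^ q) / Fintype.card Ω :=
  div_nonneg (Finset.sum_nonneg fun _ _ => by positivity) (Nat.cast_nonneg _)

lemma mnorm_nonneg (q : ℕ) (F : Ω → ℝ) : 0 ≤ mnorm q F :=
  Real.rpow_nonneg (avg_nonneg q F) _

lemma mnorm_pow {q : ℕ} (hq : q ≠ 0) (F : Ω → ℝ) :
    mnorm q F ^ q = (∑ x, |F x| ^ q) / Fintype.card Ω := by
  rw [mnorm, one_div, Real.rpow_inv_natCast_pow (avg_nonneg q F) hq]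

lemma mnorm_le_iff {q : ℕ} (hq : q ≠ 0) (F : Ω → ℝ) {B : ℝ} (hB : 0 ≤ B) :
    mnorm q F ≤ B ↔ (∑ x, |F x| ^ q) / Fintype.card Ω ≤ B ^ q := by
  rw [← mnorm_pow hq, pow_le_pow_iff_left₀ (mnorm_nonneg q F) hB hq]

lemma mnorm_mono {q : ℕ} {F G : Ω → ℝ} (h : ∀ x, |F x| ≤ |G x|) : mnorm q F ≤ mnorm q G := by
  refine Real.rpow_le_rpow (avg_nonneg q F) ?_ (by positivity)
  refine div_le_div_of_nonneg_right (Finset.sum_le_sum fun x _ => ?_) (Nat.cast_nonneg _)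
  exact pow_le_pow_left₀ (abs_nonneg _) (h x) q

lemma mnorm_le_of_abs_le {q : ℕ} (hq : q ≠ 0) {F : Ω → ℝ} {B : ℝ} (hB : 0 ≤ B)
    (h : ∀ x, |F x| ≤ B) : mnorm q F ≤ B := by
  rw [mnorm_le_iff hq F hB]
  apply div_le_of_le_mul₀ (Nat.cast_nonneg _) (by positivity)
  calc ∑ x, |F x| ^ q ≤ ∑ _x : Ω, B ^ q := by gcongr with x; exact h x
    _ = _ := by simp [mul_comm]

lemma mnorm_zero {q : ℕ} (hq : q ≠ 0) : mnorm q (fun _ : Ω => (0 : ℝ)) = 0 :=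
  le_antisymm (mnorm_le_of_abs_le hq le_rfl fun _ => by simp) (mnorm_nonneg _ _)

lemma mnorm_add_le {q : ℕ} (hq : q ≠ 0) (F G : Ω → ℝ) :
    mnorm q (fun x => F x + G x) ≤ mnorm q F + mnorm q G := by
  have h1 : (1 : ℝ) ≤ q := by exact_mod_cast Nat.one_le_iff_ne_zero.2 hq
  have := Real.Lp_add_le Finset.univ F G h1
  simp only [Real.rpow_natCast] at this
  simp only [mnorm]
  have hs : ∀ H : Ω → ℝ, 0 ≤ ∑ x, |H x| ^ q := fun H =>
    Finset.sum_nonneg fun _ _ => by positivity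
  rw [Real.div_rpow (hs _) (Nat.cast_nonneg _), Real.div_rpow (hs _) (Nat.cast_nonneg _),
    Real.div_rpow (hs _) (Nat.cast_nonneg _), ← add_div]
  gcongr

lemma mnorm_sum_le {γ : Type*} {q : ℕ} (hq : q ≠ 0) (J : Finset γ) (F : γ → Ω → ℝ) :
    mnorm q (fun x => ∑ j ∈ J, F j x) ≤ ∑ j ∈ J, mnorm q (F j) := by
  classical
  induction J using Finset.induction_on with
  | empty => simp [mnorm_zero hq]
  | insert a J ha ih =>
    simp only [Finset.sum_insert ha]
    exact (mnorm_add_le hq _ _).trans (by gcongr)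

lemma mnorm_mul_le {k : ℕ} (hk : k ≠ 0) (F G : Ω → ℝ) :
    mnorm k (fun x => F x * G x) ≤ mnorm (2 * k) F * mnorm (2 * k) G := by
  have h0 : 0 ≤ mnorm (2 * k) F * mnorm (2 * k) G :=
    mul_nonneg (mnorm_nonneg _ _) (mnorm_nonneg _ _)
  rw [mnorm_le_iff hk _ h0]
  refine le_of_abs_le (abs_le_of_sq_le_sq ?_ (by positivity))
  have h2 : ((mnorm (2 * k) F * mnorm (2 * k) G) ^ k) ^ 2
      = mnorm (2 * k) F ^ (2 * k) * mnorm (2 * k) G ^ (2 * k) := by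
    rw [← pow_mul, mul_comm k 2, mul_pow]
  rw [h2, mnorm_pow (by omega), mnorm_pow (by omega), div_pow, div_mul_div_comm, ← pow_two]
  gcongr
  have := Finset.sum_mul_sq_le_sq_mul_sq Finset.univ (fun x => |F x| ^ k) (fun x => |G x| ^ k)
  simp only [← pow_mul, mul_comm k 2] at this
  simpa only [abs_mul, mul_pow] using this

lemma mnorm_sq {k : ℕ} (hk : k ≠ 0) (F : Ω → ℝ) :
    mnorm k (fun x => F x ^ 2) = mnorm (2 * k) F ^ 2 := by
  rw [← pow_left_inj₀ (mnorm_nonneg _ _) (sq_nonneg _) hk, mnorm_pow hk, ← pow_mul,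
    mnorm_pow (by omega)]
  simp only [abs_pow, ← pow_mul]

/-! ### The multi-parameter square function inequality -/

/-- One coordinate of the iteration: apply the one-parameter inequality in ℓ² indexed by the keys.
The sum over the levels in this coordinate leaves the inner square and joins the key. -/
lemma square_function_refine {γ K : Type*} [DecidableEq K] (τ : ℕ → Equiv.Perm Ω) (J : Finset γ)
    (key : γ → K) (lev : γ → ℕ) (φ : γ → Ω → ℝ) {k : ℕ} (hk : 2 ≤ k)
    (hodd : ∀ j ∈ J, ∀ x, φ j (τ (lev j) x) = -φ j x)
    (hinv : ∀ j ∈ J, ∀ t, lev j < t → ∀ x, φ j (τ t x) = φ j x) :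
    ∑ x, (∑ v ∈ J.image key, (∑ j ∈ J with key j = v, φ j x) ^ 2) ^ k
      ≤ (128 * (k : ℝ)) ^ k * ∑ x, (∑ v ∈ J.image fun j => (key j, lev j),
          (∑ j ∈ J with (key j, lev j) = v, φ j x) ^ 2) ^ k := by
  set T := J.sup lev + 1
  have hT : ∀ j ∈ J, lev j ∈ Finset.range T := fun j hj =>
    Finset.mem_range.2 (Nat.lt_succ_of_le (Finset.le_sup (f := lev) hj))
  have h := square_function_one τ (J.image key)
    (fun t v x => ∑ j ∈ J with key j = v ∧ lev j = t, φ j x) T k hk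
    (fun t v _ x => by
      rw [← Finset.sum_neg_distrib]
      refine Finset.sum_congr rfl fun j hj => ?_
      obtain ⟨hj', -, rfl⟩ := Finset.mem_filter.1 hj
      exact hodd j hj' x)
    (fun u t hut v _ x => by
      refine Finset.sum_congr rfl fun j hj => ?_
      obtain ⟨hj', -, rfl⟩ := Finset.mem_filter.1 hj
      exact hinv j hj' t hut x)
  have e1 : ∀ x, ∀ v, ∑ t ∈ Finset.range T, ∑ j ∈ J with key j = v ∧ lev j = t, φ j x
      = ∑ j ∈ J with key j = v, φ j x := by
    intro x v
    rw [← Finset.sum_fiberwise_of_maps_to (s := J.filter fun j => key j = v)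
      (t := Finset.range T) (g := lev) (fun j hj => hT j (Finset.mem_filter.1 hj).1)]
    simp only [Finset.filter_filter]
  have e2 : ∀ x, ∑ v ∈ J.image key, ∑ t ∈ Finset.range T,
        (∑ j ∈ J with key j = v ∧ lev j = t, φ j x) ^ 2
      = ∑ v ∈ J.image fun j => (key j, lev j), (∑ j ∈ J with (key j, lev j) = v, φ j x) ^ 2 := by
    intro x
    rw [← Finset.sum_product']
    symm
    have : ∀ v : K × ℕ, (J.filter fun j => (key j, lev j) = v)
        = J.filter fun j => key j = v.1 ∧ lev j = v.2 := fun v => by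
      ext j; simp [Prod.ext_iff]
    simp only [this]
    refine Finset.sum_subset ?_ ?_
    · intro v hv
      obtain ⟨j, hj, rfl⟩ := Finset.mem_image.1 hv
      exact Finset.mem_product.2 ⟨Finset.mem_image_of_mem _ hj, hT j hj⟩
    · intro v _ hv
      rw [Finset.filter_false_of_mem]
      · simp
      · rintro j hj ⟨h1, h2⟩
        exact hv (Finset.mem_image.2 ⟨j, hj, Prod.ext h1 h2⟩)
  simp only [e1, e2] at h
  exact h

/-- The key grows by one coordinate at a time. When every coordinate of `E` has been used, key and
levels identify `j`, so each inner sum has a single term. -/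
lemma square_function_key {γ : Type*} (τ : ι → ℕ → Equiv.Perm Ω)
    (E : Finset ι) (J : Finset γ) (ρ : γ → ι → ℕ) (φ : γ → Ω → ℝ) {k : ℕ} (hk : 2 ≤ k)
    (hlvl : ∀ j ∈ J, Lvl τ E (ρ j) (φ j)) {K : Type} [DecidableEq K] (key : γ → K)
    (hinj : ∀ i ∈ J, ∀ j ∈ J, key i = key j → (∀ l ∈ E, ρ i l = ρ j l) → i = j) :
    ∑ x, (∑ v ∈ J.image key, (∑ j ∈ J with key j = v, φ j x) ^ 2) ^ k
      ≤ ((128 * (k : ℝ)) ^ E.card) ^ k * ∑ x, (∑ j ∈ J, φ j x ^ 2) ^ k := by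
  classical
  induction E using Finset.induction_on generalizing K with
  | empty =>
    have hinj' : Set.InjOn key J := fun i hi j hj h => hinj i hi j hj h (by simp)
    simp only [Finset.card_empty, pow_zero, one_pow, one_mul]
    refine le_of_eq (Finset.sum_congr rfl fun x _ => ?_)
    rw [Finset.sum_image hinj']
    congr 1
    refine Finset.sum_congr rfl fun i hi => ?_
    have : (J.filter fun j => key j = key i) = {i} := by
      ext j
      simp only [Finset.mem_filter, Finset.mem_singleton]
      exact ⟨fun h => hinj' h.1 hi h.2, by rintro rfl; exact ⟨hi, rfl⟩⟩
    rw [this, Finset.sum_singleton]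
  | insert a E ha ih =>
    have h1 := square_function_refine (τ a) J key (fun j => ρ j a) φ hk
      (fun j hj => (hlvl j hj a (Finset.mem_insert_self a E)).1)
      (fun j hj => (hlvl j hj a (Finset.mem_insert_self a E)).2)
    have h2 := ih (fun j hj l hl => hlvl j hj l (Finset.mem_insert_of_mem hl))
      (K := K × ℕ) (fun j => (key j, ρ j a)) (fun i hi j hj hij hE => by
        simp only [Prod.mk.injEq] at hij
        refine hinj i hi j hj hij.1 fun l hl => ?_
        rcases Finset.mem_insert.1 hl with rfl | hl
        · exact hij.2
        · exact hE l hl)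
    refine h1.trans ((mul_le_mul_of_nonneg_left h2 (by positivity)).trans (le_of_eq ?_))
    rw [← mul_assoc, Finset.card_insert_of_notMem ha, ← mul_pow, pow_succ, mul_comm (128 * (k : ℝ))]

/-- Square function inequality: the functions `φ j` have level `ρ j` in the coordinates in `E`, and
different `j` have different levels. -/
lemma square_function {γ : Type*} (τ : ι → ℕ → Equiv.Perm Ω)
    (E : Finset ι) (J : Finset γ) (ρ : γ → ι → ℕ) (φ : γ → Ω → ℝ) {k : ℕ} (hk : 2 ≤ k)
    (hlvl : ∀ j ∈ J, Lvl τ E (ρ j) (φ j))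
    (hinj : ∀ i ∈ J, ∀ j ∈ J, (∀ l ∈ E, ρ i l = ρ j l) → i = j) :
    mnorm (2 * k) (fun x => ∑ j ∈ J, φ j x) ^ 2
      ≤ (128 * (k : ℝ)) ^ E.card * mnorm k (fun x => ∑ j ∈ J, φ j x ^ 2) := by
  have hk0 : k ≠ 0 := by omega
  have hm := mnorm_nonneg k (fun x => ∑ j ∈ J, φ j x ^ 2)
  rw [← mnorm_sq hk0, mnorm_le_iff hk0 _ (by positivity), mul_pow, mnorm_pow hk0, mul_div_assoc']
  gcongr
  -- A constant key makes the outer ℓ² norm one-dimensional, which is the scalar inequality.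
  have h := square_function_key τ E J ρ φ hk hlvl (fun _ => ()) (fun i hi j hj _ => hinj i hi j hj)
  have e1 : ∀ x, |∑ j ∈ J, φ j x ^ 2| = ∑ j ∈ J, φ j x ^ 2 := fun x =>
    abs_of_nonneg (Finset.sum_nonneg fun _ _ => sq_nonneg _)
  simp only [e1]
  refine le_trans (le_of_eq ?_) h
  refine Finset.sum_congr rfl fun x _ => ?_
  rcases J.eq_empty_or_nonempty with rfl | hJ
  · simp
  · simp [Finset.image_const hJ]

lemma square_function_sum {γ : Type*} (τ : ι → ℕ → Equiv.Perm Ω)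
    (E : Finset ι) (J : Finset γ) (ρ : γ → ι → ℕ) (φ : γ → Ω → ℝ) {k : ℕ} (hk : 2 ≤ k)
    (hlvl : ∀ j ∈ J, Lvl τ E (ρ j) (φ j))
    (hinj : ∀ i ∈ J, ∀ j ∈ J, (∀ l ∈ E, ρ i l = ρ j l) → i = j) :
    mnorm (2 * k) (fun x => ∑ j ∈ J, φ j x) ^ 2
      ≤ (128 * (k : ℝ)) ^ E.card * ∑ j ∈ J, mnorm (2 * k) (φ j) ^ 2 := by
  have hk0 : k ≠ 0 := by omega
  refine (square_function τ E J ρ φ hk hlvl hinj).trans ?_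
  gcongr
  refine (mnorm_sum_le hk0 J fun j x => φ j x ^ 2).trans (le_of_eq ?_)
  exact Finset.sum_congr rfl fun j _ => mnorm_sq hk0 _

lemma mnorm_sum_sq_le_card {γ : Type*} (τ : ι → ℕ → Equiv.Perm Ω)
    (E : Finset ι) (J : Finset γ) (ρ : γ → ι → ℕ) (φ : γ → Ω → ℝ) {k : ℕ} (hk : 2 ≤ k)
    (hlvl : ∀ j ∈ J, Lvl τ E (ρ j) (φ j)) (hφ : ∀ j ∈ J, ∀ x, |φ j x| ≤ 1)
    (hinj : ∀ i ∈ J, ∀ j ∈ J, (∀ l ∈ E, ρ i l = ρ j l) → i = j) :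
    mnorm (2 * k) (fun x => ∑ j ∈ J, φ j x) ^ 2 ≤ (128 * (k : ℝ)) ^ E.card * J.card := by
  refine (square_function_sum τ E J ρ φ hk hlvl hinj).trans ?_
  gcongr
  calc ∑ j ∈ J, mnorm (2 * k) (φ j) ^ 2 ≤ ∑ j ∈ J, (1 : ℝ) := by
        gcongr with j hj
        exact pow_le_one₀ (mnorm_nonneg _ _)
          (mnorm_le_of_abs_le (by omega) zero_le_one (hφ j hj))
    _ = J.card := by simp

end BeckGain

namespace BeckGain

variable {ι : Type} [Fintype ι] [DecidableEq ι]

/-! ### Boxes of exponent vectors -/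

/-- Vectors supported in `S` with `l`-th coordinate in `t l` for `l ∈ S`. -/
def boxOn (S : Finset ι) (t : ι → Finset ℕ) : Finset (ι → ℕ) :=
  Fintype.piFinset fun l => if l ∈ S then t l else {0}

lemma mem_boxOn {S : Finset ι} {t : ι → Finset ℕ} {x : ι → ℕ} :
    x ∈ boxOn S t ↔ (∀ l ∈ S, x l ∈ t l) ∧ ∀ l ∉ S, x l = 0 := by
  simp only [boxOn, Fintype.mem_piFinset]
  constructor
  · intro h
    exact ⟨fun l hl => by simpa [hl] using h l, fun l hl => by simpa [hl] using h l⟩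
  · rintro ⟨h1, h2⟩ l
    by_cases hl : l ∈ S
    · simpa [hl] using h1 l hl
    · simpa [hl] using h2 l hl

lemma card_boxOn (S : Finset ι) (t : ι → Finset ℕ) : (boxOn S t).card = ∏ l ∈ S, (t l).card := by
  rw [boxOn, Fintype.card_piFinset]
  simp only [apply_ite Finset.card, Finset.card_singleton]
  rw [Finset.prod_ite_mem, Finset.univ_inter]

lemma boxOn_ext {S : Finset ι} {t t' : ι → Finset ℕ} {x y : ι → ℕ} (hx : x ∈ boxOn S t)
    (hy : y ∈ boxOn S t') (h : ∀ l ∈ S, x l = y l) : x = y := by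
  funext l
  by_cases hl : l ∈ S
  · exact h l hl
  · rw [(mem_boxOn.1 hx).2 l hl, (mem_boxOn.1 hy).2 l hl]

lemma boxOn_mono {S : Finset ι} {t t' : ι → Finset ℕ} (h : ∀ l ∈ S, t l ⊆ t' l) :
    boxOn S t ⊆ boxOn S t' := fun _ hx =>
  mem_boxOn.2 ⟨fun l hl => h l hl ((mem_boxOn.1 hx).1 l hl), (mem_boxOn.1 hx).2⟩

lemma add_mem_boxOn {P Q : Finset ι} (hPQ : Disjoint P Q) {t : ι → Finset ℕ} {v z : ι → ℕ}
    (hv : v ∈ boxOn P t) (hz : z ∈ boxOn Q t) : v + z ∈ boxOn (P ∪ Q) t := by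
  rw [mem_boxOn] at *
  constructor
  · intro l hl
    rcases Finset.mem_union.1 hl with h | h
    · rw [Pi.add_apply, hz.2 l (Finset.disjoint_left.1 hPQ h), add_zero]; exact hv.1 l h
    · rw [Pi.add_apply, hv.2 l (Finset.disjoint_right.1 hPQ h), zero_add]; exact hz.1 l h
  · intro l hl
    rw [Finset.mem_union, not_or] at hl
    rw [Pi.add_apply, hv.2 l hl.1, hz.2 l hl.2]

lemma sum_boxOn_union {P Q : Finset ι} (hPQ : Disjoint P Q) (t : ι → Finset ℕ)
    {A : Type*} [AddCommMonoid A] (F : (ι → ℕ) → A) :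
    ∑ x ∈ boxOn (P ∪ Q) t, F x = ∑ v ∈ boxOn P t, ∑ z ∈ boxOn Q t, F (v + z) := by
  rw [← Finset.sum_product']
  symm
  refine Finset.sum_bij' (fun p _ => p.1 + p.2)
    (fun x _ => (fun l => if l ∈ P then x l else 0, fun l => if l ∈ Q then x l else 0))
    ?_ ?_ ?_ ?_ ?_
  · intro p hp
    exact add_mem_boxOn hPQ (Finset.mem_product.1 hp).1 (Finset.mem_product.1 hp).2
  · intro x hx
    have hx := (mem_boxOn.1 hx).1
    refine Finset.mem_product.2 ⟨mem_boxOn.2 ⟨fun l hl => ?_, fun l hl => ?_⟩,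
      mem_boxOn.2 ⟨fun l hl => ?_, fun l hl => ?_⟩⟩ <;> simp only [hl, if_true, if_false]
    · exact hx l (Finset.mem_union_left _ hl)
    · exact hx l (Finset.mem_union_right _ hl)
  · intro p hp
    obtain ⟨h1, h2⟩ := Finset.mem_product.1 hp
    rw [mem_boxOn] at h1 h2
    refine Prod.ext (funext fun l => ?_) (funext fun l => ?_)
    · by_cases hl : l ∈ P
      · simp [hl, h2.2 l (Finset.disjoint_left.1 hPQ hl)]
      · simp [hl, h1.2 l hl]
    · by_cases hl : l ∈ Q
      · simp [hl, h1.2 l (Finset.disjoint_right.1 hPQ hl)]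
      · simp [hl, h2.2 l hl]
  · intro x hx
    funext l
    have h2 := (mem_boxOn.1 hx).2 l
    by_cases hl : l ∈ P
    · simp [hl, Finset.disjoint_left.1 hPQ hl]
    · by_cases hl' : l ∈ Q
      · simp [hl, hl']
      · simp [hl, hl', h2 (by simp [hl, hl'])]
  · intro p hp
    rfl

/-! ### Counting vectors in boxes and dyadic blocks -/

lemma sum_add_left {P Q : Finset ι} (hPQ : Disjoint P Q) {t t' : ι → Finset ℕ} {v z : ι → ℕ}
    (hv : v ∈ boxOn P t) (hz : z ∈ boxOn Q t') :
    ∑ l ∈ P ∪ Q, (v + z) l = ∑ l ∈ P, v l + ∑ l ∈ Q, z l := by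
  rw [Finset.sum_union hPQ]
  congr 1
  · exact Finset.sum_congr rfl fun l hl => by
      rw [Pi.add_apply, (mem_boxOn.1 hz).2 l (Finset.disjoint_left.1 hPQ hl), add_zero]
  · exact Finset.sum_congr rfl fun l hl => by
      rw [Pi.add_apply, (mem_boxOn.1 hv).2 l (Finset.disjoint_right.1 hPQ hl), zero_add]

/-- Project along the coordinate `i`: every fiber of the projection lies in an interval of `L + 1`
integers. Exact linear relations use `L = 0`; approximate ones use the width of a block. -/
lemma card_le_of_window {S : Finset ι} {t : ι → Finset ℕ} {i : ι} (hi : i ∈ S) {L : ℕ}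
    {A : Finset (ι → ℕ)} (hA : A ⊆ boxOn S t)
    (h : ∀ x ∈ A, ∀ y ∈ A, (∀ l ∈ S, l ≠ i → x l = y l) → x i ≤ y i + L) :
    A.card ≤ (L + 1) * ∏ l ∈ S.erase i, (t l).card := by
  have h1 : ∀ b ∈ A.image (fun x => Function.update x i 0),
      (A.filter fun x => Function.update x i 0 = b).card ≤ L + 1 := by
    intro b hb
    set D := A.filter fun x => Function.update x i 0 = b with hD
    have hne : D.Nonempty := by
      obtain ⟨x, hx, rfl⟩ := Finset.mem_image.1 hb
      exact ⟨x, Finset.mem_filter.2 ⟨hx, rfl⟩⟩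
    obtain ⟨y, hy, hmin⟩ := D.exists_min_image (fun x => x i) hne
    have hagree : ∀ x ∈ D, ∀ x' ∈ D, ∀ l, l ≠ i → x l = x' l := by
      intro x hx x' hx' l hl
      have e : Function.update x i 0 = Function.update x' i 0 :=
        (Finset.mem_filter.1 hx).2.trans (Finset.mem_filter.1 hx').2.symm
      simpa [hl] using congrFun e l
    have : D.card ≤ (Finset.Icc (y i) (y i + L)).card := by
      refine Finset.card_le_card_of_injOn (fun x => x i) ?_ ?_
      · intro x hx
        exact Finset.mem_Icc.2 ⟨hmin x hx, h x (Finset.mem_filter.1 hx).1 y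
          (Finset.mem_filter.1 hy).1 fun l _ hl => hagree x hx y hy l hl⟩
      · intro x hx x' hx' e
        funext l
        by_cases hl : l = i
        · rw [hl]; exact e
        · exact hagree x hx x' hx' l hl
    simpa [Nat.add_sub_cancel_left, add_assoc] using this
  refine (Finset.card_le_mul_card_image A (L + 1) h1).trans ?_
  rw [← card_boxOn]
  gcongr
  intro z hz
  obtain ⟨x, hx, rfl⟩ := Finset.mem_image.1 hz
  have hx := mem_boxOn.1 (hA hx)
  refine mem_boxOn.2 ⟨fun l hl => ?_, fun l hl => ?_⟩
  · rw [Finset.mem_erase] at hl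
    simpa [hl.1] using hx.1 l hl.2
  · by_cases hli : l = i
    · subst hli; simp
    · simpa [hli] using hx.2 l fun h => hl (Finset.mem_erase.2 ⟨hli, h⟩)

/-- The integers below `n` in the dyadic block of length `2 ^ m` and index `b`. -/
def block (n m b : ℕ) : Finset ℕ := (Finset.range n).filter fun x => x / 2 ^ m = b

lemma mem_block {n m b x : ℕ} : x ∈ block n m b ↔ x < n ∧ x / 2 ^ m = b := by
  simp [block]

lemma card_block_le (n m b : ℕ) : (block n m b).card ≤ 2 ^ m := by
  have h : block n m b ⊆ Finset.Ico (b * 2 ^ m) (b * 2 ^ m + 2 ^ m) := by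
    intro x hx
    have hx := (mem_block.1 hx).2
    have h1 := Nat.div_add_mod x (2 ^ m)
    have h2 := Nat.mod_lt x (show 0 < 2 ^ m by positivity)
    rw [hx] at h1
    rw [mul_comm] at h1
    rw [Finset.mem_Ico]
    omega
  simpa using Finset.card_le_card h

lemma block_close {n m b x y : ℕ} (hx : x ∈ block n m b) (hy : y ∈ block n m b) :
    x ≤ y + 2 ^ m := by
  have h1 := Nat.div_add_mod x (2 ^ m)
  have h2 := Nat.mod_lt x (show 0 < 2 ^ m by positivity)
  have h3 := Nat.div_add_mod y (2 ^ m)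
  rw [(mem_block.1 hx).2] at h1
  rw [(mem_block.1 hy).2] at h3
  omega

lemma card_hyperbolic_le {S : Finset ι} {t : ι → Finset ℕ} {i : ι} (hi : i ∈ S) (N : ℕ)
    {A : Finset (ι → ℕ)} (hA : A ⊆ boxOn S t) (h : ∀ x ∈ A, ∑ l ∈ S, x l = N) :
    A.card ≤ ∏ l ∈ S.erase i, (t l).card := by
  have := card_le_of_window hi (L := 0) hA fun x hx y hy hxy => by
    have h1 := h x hx
    have h2 := h y hy
    rw [← Finset.add_sum_erase _ _ hi] at h1 h2
    have h3 : ∑ l ∈ S.erase i, x l = ∑ l ∈ S.erase i, y l := Finset.sum_congr rfl fun l hl =>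
      hxy l (Finset.mem_of_mem_erase hl) (Finset.ne_of_mem_erase hl)
    omega
  simpa using this

/-! ### Whitney decomposition of the pairs of distinct integers -/

lemma whitney_exists {a b M : ℕ} (hab : a < b) (hM : a / 2 ^ M = b / 2 ^ M) :
    ∃ μ < M, ∃ c, a / 2 ^ μ = 2 * c ∧ b / 2 ^ μ = 2 * c + 1 := by
  induction M with
  | zero => simp at hM; omega
  | succ M ih =>
    by_cases h : a / 2 ^ M = b / 2 ^ M
    · obtain ⟨μ, hμ, c, hc⟩ := ih h
      exact ⟨μ, by omega, c, hc⟩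
    · have h1 : a / 2 ^ M ≤ b / 2 ^ M := Nat.div_le_div_right hab.le
      rw [pow_succ, ← Nat.div_div_eq_div_mul, ← Nat.div_div_eq_div_mul] at hM
      exact ⟨M, by omega, a / 2 ^ M / 2, by omega, by omega⟩

lemma whitney_lt {a b μ c : ℕ} (ha : a / 2 ^ μ = 2 * c) (hb : b / 2 ^ μ = 2 * c + 1) : a < b := by
  by_contra h
  have := Nat.div_le_div_right (c := 2 ^ μ) (not_lt.1 h)
  omega

/-- Once `a` and `b` share a block of length `2 ^ (μ + 1)`, they share all coarser dyadic blocks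
containing it, so no larger scale can separate them. -/
lemma whitney_level_le {a b μ c μ' c' : ℕ} (ha : a / 2 ^ μ = 2 * c) (hb : b / 2 ^ μ = 2 * c + 1)
    (ha' : a / 2 ^ μ' = 2 * c') (hb' : b / 2 ^ μ' = 2 * c' + 1) : μ' ≤ μ := by
  by_contra h
  obtain ⟨j, rfl⟩ : ∃ j, μ' = μ + 1 + j := ⟨μ' - (μ + 1), by omega⟩
  rw [pow_add, pow_succ, ← Nat.div_div_eq_div_mul, ← Nat.div_div_eq_div_mul] at ha' hb'
  have h1 : a / 2 ^ μ / 2 = b / 2 ^ μ / 2 := by omega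
  rw [h1] at ha'
  omega

lemma whitney_unique {a b μ c μ' c' : ℕ} (ha : a / 2 ^ μ = 2 * c) (hb : b / 2 ^ μ = 2 * c + 1)
    (ha' : a / 2 ^ μ' = 2 * c') (hb' : b / 2 ^ μ' = 2 * c' + 1) : μ = μ' ∧ c = c' := by
  have h : μ = μ' := le_antisymm (whitney_level_le ha' hb' ha hb) (whitney_level_le ha hb ha' hb')
  subst h
  exact ⟨rfl, by omega⟩

/-- The indices of the half blocks: upper half in the coordinates in `P`, lower half elsewhere. -/
def halfIndex (P : Finset ι) (c : ι → ℕ) (l : ι) : ℕ := 2 * c l + if l ∈ P then 1 else 0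

/-- Exponent vectors supported in `S` lying in given dyadic blocks. -/
def cell (n : ℕ) (S : Finset ι) (μ b : ι → ℕ) : Finset (ι → ℕ) :=
  boxOn S fun l => block n (μ l) (b l)

/-- All exponent vectors supported in `S` with entries below `n`. -/
def cube (n : ℕ) (S : Finset ι) : Finset (ι → ℕ) := boxOn S fun _ => Finset.range n

lemma cell_subset_cube (n : ℕ) (S : Finset ι) (μ b : ι → ℕ) : cell n S μ b ⊆ cube n S :=
  boxOn_mono fun _ _ => Finset.filter_subset _ _

lemma mem_cell {n : ℕ} {S : Finset ι} {μ b x : ι → ℕ} :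
    x ∈ cell n S μ b ↔ x ∈ cube n S ∧ ∀ l ∈ S, x l / 2 ^ μ l = b l := by
  simp only [cell, cube, mem_boxOn, mem_block, Finset.mem_range]
  constructor
  · rintro ⟨h1, h2⟩
    exact ⟨⟨fun l hl => (h1 l hl).1, h2⟩, fun l hl => (h1 l hl).2⟩
  · rintro ⟨⟨h1, h2⟩, h3⟩
    exact ⟨fun l hl => ⟨h1 l hl, h3 l hl⟩, h2⟩

lemma cell_eq_filter (n : ℕ) (S : Finset ι) (μ b : ι → ℕ) :
    cell n S μ b = (cube n S).filter fun x => ∀ l ∈ S, x l / 2 ^ μ l = b l := by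
  ext x
  rw [mem_cell, Finset.mem_filter]

/-- Indices `c` of the blocks of length `2 ^ (μ l + 1)` inside the block of length `2 ^ M l` with
index `c₀ l`. -/
def subBlocks (n : ℕ) (E : Finset ι) (M c₀ μ : ι → ℕ) : Finset (ι → ℕ) :=
  boxOn E fun l => block n (M l - μ l - 1) (c₀ l)

lemma card_subBlocks_le (n : ℕ) (E : Finset ι) (M c₀ μ : ι → ℕ) :
    (subBlocks n E M c₀ μ).card ≤ ∏ l ∈ E, 2 ^ (M l - μ l - 1) := by
  rw [subBlocks, card_boxOn]
  exact Finset.prod_le_prod' fun l _ => card_block_le _ _ _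

lemma sum_rotate {α β γ δ : Type*} (A : Finset α) (B : Finset β) (C : Finset γ) (D : γ → Finset δ)
    (G : α → β → γ → δ → ℝ) :
    ∑ a ∈ A, ∑ b ∈ B, ∑ c ∈ C, ∑ e ∈ D c, G a b c e
      = ∑ c ∈ C, ∑ e ∈ D c, ∑ a ∈ A, ∑ b ∈ B, G a b c e := by
  calc _ = ∑ p ∈ A ×ˢ B, ∑ x ∈ C.sigma D, G p.1 p.2 x.1 x.2 := by
        simp only [Finset.sum_product, Finset.sum_sigma]
    _ = ∑ x ∈ C.sigma D, ∑ p ∈ A ×ˢ B, G p.1 p.2 x.1 x.2 := Finset.sum_comm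
    _ = _ := by simp only [Finset.sum_product, Finset.sum_sigma]

/-- In each coordinate two distinct integers of one block have a unique scale and parent block at
which they fall into different halves, the larger one in the upper half. The order conditions thus
turn into separate block conditions on `r` and on `s`. -/
lemma whitney_indicator {n : ℕ} {E P : Finset ι} (hP : P ⊆ E) (M c₀ : ι → ℕ)
    (F : (ι → ℕ) → (ι → ℕ) → ℝ) {r s : ι → ℕ} (hr : r ∈ cube n E)
    (hb : F r s ≠ 0 → ∀ l ∈ E, r l / 2 ^ M l = c₀ l ∧ s l / 2 ^ M l = c₀ l) :
    (if (∀ l ∈ P, s l < r l) ∧ ∀ l ∈ E \ P, r l < s l then F r s else 0)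
      = ∑ μ ∈ boxOn E fun l => Finset.range (M l), ∑ c ∈ subBlocks n E M c₀ μ,
        if (∀ l ∈ E, r l / 2 ^ μ l = halfIndex P c l) ∧
          (∀ l ∈ E, s l / 2 ^ μ l = halfIndex (E \ P) c l) then F r s else 0 := by
  by_cases h0 : F r s = 0
  · simp [h0]
  have hb := hb h0
  have hPl : ∀ μ c : ι → ℕ, (∀ l ∈ E, r l / 2 ^ μ l = halfIndex P c l) →
      (∀ l ∈ E, s l / 2 ^ μ l = halfIndex (E \ P) c l) →
      (∀ l ∈ P, s l / 2 ^ μ l = 2 * c l ∧ r l / 2 ^ μ l = 2 * c l + 1) ∧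
      (∀ l ∈ E \ P, r l / 2 ^ μ l = 2 * c l ∧ s l / 2 ^ μ l = 2 * c l + 1) := by
    intro μ c h1 h2
    refine ⟨fun l hl => ?_, fun l hl => ?_⟩
    · have e1 := h1 l (hP hl)
      have e2 := h2 l (hP hl)
      simp only [halfIndex, hl, Finset.mem_sdiff, not_true, and_false, if_true, if_false] at e1 e2
      omega
    · have hl' := Finset.mem_sdiff.1 hl
      have e1 := h1 l hl'.1
      have e2 := h2 l hl'.1
      simp only [halfIndex, hl, hl'.2, if_true, if_false] at e1 e2
      omega
  by_cases hsign : (∀ l ∈ P, s l < r l) ∧ ∀ l ∈ E \ P, r l < s l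
  · rw [if_pos hsign]
    have hex : ∀ l, ∃ p : ℕ × ℕ, (l ∉ E → p = (0, 0)) ∧ (l ∈ P → p.1 < M l ∧
        s l / 2 ^ p.1 = 2 * p.2 ∧ r l / 2 ^ p.1 = 2 * p.2 + 1) ∧ (l ∈ E \ P → p.1 < M l ∧
        r l / 2 ^ p.1 = 2 * p.2 ∧ s l / 2 ^ p.1 = 2 * p.2 + 1) := by
      intro l
      by_cases hl : l ∈ E
      · have hbl := hb l hl
        by_cases hlP : l ∈ P
        · obtain ⟨μ, hμ, c, hc⟩ := whitney_exists (hsign.1 l hlP) (hbl.2.trans hbl.1.symm)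
          exact ⟨(μ, c), fun h => absurd hl h, fun _ => ⟨hμ, hc⟩,
            fun h => absurd hlP (Finset.mem_sdiff.1 h).2⟩
        · obtain ⟨μ, hμ, c, hc⟩ := whitney_exists
            (hsign.2 l (Finset.mem_sdiff.2 ⟨hl, hlP⟩)) (hbl.1.trans hbl.2.symm)
          exact ⟨(μ, c), fun h => absurd hl h, fun h => absurd h hlP, fun _ => ⟨hμ, hc⟩⟩
      · exact ⟨(0, 0), fun _ => rfl, fun h => absurd (hP h) hl,
          fun h => absurd (Finset.mem_sdiff.1 h).1 hl⟩
    choose p hp0 hpP hpQ using hex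
    have hpμ : (fun l => (p l).1) ∈ boxOn E fun l => Finset.range (M l) := by
      refine mem_boxOn.2 ⟨fun l hl => Finset.mem_range.2 ?_, fun l hl => by simp [hp0 l hl]⟩
      by_cases hlP : l ∈ P
      · exact (hpP l hlP).1
      · exact (hpQ l (Finset.mem_sdiff.2 ⟨hl, hlP⟩)).1
    -- The parent block of scale `μ + 1` lies in the given block of scale `m`, which puts its index
    -- into `subBlocks`.
    have hdiv : ∀ {a μ m c : ℕ}, μ < m → a / 2 ^ μ / 2 = c → c / 2 ^ (m - μ - 1) = a / 2 ^ m := by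
      rintro a μ m c hμ rfl
      rw [Nat.div_div_eq_div_mul, Nat.div_div_eq_div_mul, ← pow_succ', ← pow_add]
      congr 2; omega
    have hpc : (fun l => (p l).2) ∈ subBlocks n E M c₀ (fun l => (p l).1) := by
      refine mem_boxOn.2 ⟨fun l hl => mem_block.2 ?_, fun l hl => by simp [hp0 l hl]⟩
      have hrl : r l < n := Finset.mem_range.1 ((mem_boxOn.1 hr).1 l hl)
      have hle : r l / 2 ^ (p l).1 ≤ r l := Nat.div_le_self _ _
      by_cases hlP : l ∈ P
      · have h := hpP l hlP
        exact ⟨by omega, by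
          rw [hdiv h.1 (a := r l) (by omega)]; exact (hb l hl).1⟩
      · have h := hpQ l (Finset.mem_sdiff.2 ⟨hl, hlP⟩)
        exact ⟨by omega, by
          rw [hdiv h.1 (a := r l) (by omega)]; exact (hb l hl).1⟩
    have huniq : ∀ μ c : ι → ℕ, (∀ l ∈ E, r l / 2 ^ μ l = halfIndex P c l) →
        (∀ l ∈ E, s l / 2 ^ μ l = halfIndex (E \ P) c l) →
        ∀ l ∈ E, μ l = (p l).1 ∧ c l = (p l).2 := by
      intro μ c h1 h2 l hl
      obtain ⟨hA, hB⟩ := hPl μ c h1 h2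
      by_cases hlP : l ∈ P
      · exact whitney_unique (hA l hlP).1 (hA l hlP).2 (hpP l hlP).2.1 (hpP l hlP).2.2
      · have hlQ := Finset.mem_sdiff.2 ⟨hl, hlP⟩
        exact whitney_unique (hB l hlQ).1 (hB l hlQ).2 (hpQ l hlQ).2.1 (hpQ l hlQ).2.2
    rw [Finset.sum_eq_single_of_mem _ hpμ, Finset.sum_eq_single_of_mem _ hpc, if_pos]
    · constructor
      · intro l hl
        by_cases hlP : l ∈ P
        · simp only [halfIndex, hlP, if_true]; exact (hpP l hlP).2.2
        · simp only [halfIndex, hlP, if_false]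
          exact (hpQ l (Finset.mem_sdiff.2 ⟨hl, hlP⟩)).2.1
      · intro l hl
        by_cases hlP : l ∈ P
        · simp only [halfIndex, hlP, Finset.mem_sdiff, not_true, and_false, if_false]
          exact (hpP l hlP).2.1
        · simp only [halfIndex, hlP, Finset.mem_sdiff, not_false_iff, and_true, hl, if_true]
          exact (hpQ l (Finset.mem_sdiff.2 ⟨hl, hlP⟩)).2.2
    · intro c hc hne
      refine if_neg fun h => hne ?_
      exact boxOn_ext hc hpc fun l hl => (huniq _ c h.1 h.2 l hl).2
    · intro μ hμ hne
      refine Finset.sum_eq_zero fun c _ => if_neg fun h => hne ?_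
      exact boxOn_ext hμ hpμ fun l hl => (huniq μ c h.1 h.2 l hl).1
  · rw [if_neg hsign]
    symm
    refine Finset.sum_eq_zero fun μ _ => Finset.sum_eq_zero fun c _ => if_neg fun h => hsign ?_
    obtain ⟨hA, hB⟩ := hPl μ c h.1 h.2
    exact ⟨fun l hl => whitney_lt (hA l hl).1 (hA l hl).2,
      fun l hl => whitney_lt (hB l hl).1 (hB l hl).2⟩

lemma whitney_sum {n : ℕ} {E P : Finset ι} (hP : P ⊆ E) (M c₀ : ι → ℕ)
    (F : (ι → ℕ) → (ι → ℕ) → ℝ)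
    (hF : ∀ r ∈ cube n E, ∀ s ∈ cube n E, F r s ≠ 0 →
      ∀ l ∈ E, r l / 2 ^ M l = c₀ l ∧ s l / 2 ^ M l = c₀ l) :
    ∑ r ∈ cube n E, ∑ s ∈ cube n E,
        (if (∀ l ∈ P, s l < r l) ∧ ∀ l ∈ E \ P, r l < s l then F r s else 0)
      = ∑ μ ∈ boxOn E fun l => Finset.range (M l), ∑ c ∈ subBlocks n E M c₀ μ,
          ∑ r ∈ cell n E μ (halfIndex P c), ∑ s ∈ cell n E μ (halfIndex (E \ P) c), F r s := by
  rw [Finset.sum_congr rfl fun r hr => Finset.sum_congr rfl fun s hs =>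
    whitney_indicator hP M c₀ F hr (hF r hr s hs)]
  have e1 : ∀ μ c : ι → ℕ, ∑ r ∈ cell n E μ (halfIndex P c),
      ∑ s ∈ cell n E μ (halfIndex (E \ P) c), F r s
      = ∑ r ∈ cube n E, ∑ s ∈ cube n E, if (∀ l ∈ E, r l / 2 ^ μ l = halfIndex P c l) ∧
          (∀ l ∈ E, s l / 2 ^ μ l = halfIndex (E \ P) c l) then F r s else 0 := by
    intro μ c
    rw [cell_eq_filter, cell_eq_filter, Finset.sum_filter]
    refine Finset.sum_congr rfl fun r _ => ?_
    rw [Finset.sum_filter]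
    by_cases h : ∀ l ∈ E, r l / 2 ^ μ l = halfIndex P c l
    · simp only [if_pos h, and_iff_right h]
    · simp only [h, false_and, if_false, Finset.sum_const_zero]
  simp only [e1]
  exact sum_rotate _ _ _ _ _

end BeckGain

namespace BeckGain

variable {ι : Type} [Fintype ι] [DecidableEq ι]

/-! ### Families of functions of prescribed dyadic levels -/

/-- Functions `f w r` on `Ω`, bounded by one, of level `r` in the coordinates in `E`, which vanish
unless `h w + ∑ r = N` and `r` lies in the dyadic box with side lengths `2 ^ M l` and
index `c₀`. -/
structure Fam {Ω : Type} (τ : ι → ℕ → Equiv.Perm Ω) (E : Finset ι) (n : ℕ) (W : Finset (ι → ℕ))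
    (h : (ι → ℕ) → ℕ) (M c₀ : ι → ℕ) (N : ℕ) (f : (ι → ℕ) → (ι → ℕ) → Ω → ℝ) : Prop where
  lvl : ∀ w ∈ W, ∀ r ∈ cube n E, Lvl τ E r (f w r)
  bdd : ∀ w ∈ W, ∀ r ∈ cube n E, ∀ x, |f w r x| ≤ 1
  supp : ∀ w ∈ W, ∀ r ∈ cube n E, f w r ≠ 0 →
    h w + ∑ l ∈ E, r l = N ∧ ∀ l ∈ E, r l / 2 ^ M l = c₀ l

/-- The standing assumptions on the index set `W` and the scales `M`. -/
structure Setting (E : Finset ι) (n : ℕ) (W : Finset (ι → ℕ)) (h : (ι → ℕ) → ℕ) (M : ι → ℕ)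
    (a k : ℕ) : Prop where
  two_le : 2 ≤ k
  inj : Set.InjOn h W
  card_le : W.card ≤ a
  a_le : a ≤ n
  pow_le : ∀ l ∈ E, 2 ^ M l ≤ n

/-- The fourth power of the bound for a bilinear sum over `E`, up to constants. -/
noncomputable def bnd (k n a : ℕ) (E : Finset ι) (M : ι → ℕ) : ℝ :=
  (k : ℝ) ^ (4 * E.card - 2) * (n : ℝ) ^ (3 * E.card - 3) * a * ∏ l ∈ E, (2 : ℝ) ^ M l

lemma bnd_nonneg (k n a : ℕ) (E : Finset ι) (M : ι → ℕ) : 0 ≤ bnd k n a E M := by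
  unfold bnd; positivity

/-- The estimate for bilinear sums over pairs `r ≠ s`, for coordinate sets of size at most `e`. -/
def FullBound (ι : Type) [Fintype ι] [DecidableEq ι] (e : ℕ) (C : ℝ) : Prop :=
  ∀ (Ω : Type) [Fintype Ω] (τ : ι → ℕ → Equiv.Perm Ω) (E : Finset ι) (n : ℕ)
    (W : Finset (ι → ℕ)) (h : (ι → ℕ) → ℕ) (M c₀ : ι → ℕ) (N N' a k : ℕ)
    (f g : (ι → ℕ) → (ι → ℕ) → Ω → ℝ), E.Nonempty → E.card ≤ e → Setting E n W h M a k →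
    Fam τ E n W h M c₀ N f → Fam τ E n W h M c₀ N' g →
    mnorm (2 * k) (fun x => ∑ w ∈ W, ∑ r ∈ cube n E, ∑ s ∈ cube n E,
      if r ≠ s then f w r x * g w s x else 0) ^ 4 ≤ C * bnd k n a E M

/-- The estimate for bilinear sums over pairs `r, s` that differ in all coordinates. -/
def StrictBound (ι : Type) [Fintype ι] [DecidableEq ι] (e : ℕ) (C : ℝ) : Prop :=
  ∀ (Ω : Type) [Fintype Ω] (τ : ι → ℕ → Equiv.Perm Ω) (E : Finset ι) (n : ℕ)
    (W : Finset (ι → ℕ)) (h : (ι → ℕ) → ℕ) (M c₀ : ι → ℕ) (N N' a k : ℕ)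
    (f g : (ι → ℕ) → (ι → ℕ) → Ω → ℝ), E.Nonempty → E.card ≤ e → Setting E n W h M a k →
    Fam τ E n W h M c₀ N f → Fam τ E n W h M c₀ N' g →
    mnorm (2 * k) (fun x => ∑ w ∈ W, ∑ r ∈ cube n E, ∑ s ∈ cube n E,
      if ∀ l ∈ E, r l ≠ s l then f w r x * g w s x else 0) ^ 4 ≤ C * bnd k n a E M

lemma sum_pow_four_le {γ : Type*} (J : Finset γ) {x : γ → ℝ} (hx : ∀ j ∈ J, 0 ≤ x j) {T : ℝ}
    (hT : ∀ j ∈ J, x j ^ 4 ≤ T) : (∑ j ∈ J, x j) ^ 4 ≤ (J.card : ℝ) ^ 4 * T := by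
  rcases J.eq_empty_or_nonempty with rfl | hJ
  · simp
  have hc : (0 : ℝ) < J.card := by exact_mod_cast hJ.card_pos
  have h2 := pow_sum_div_card_le_sum_pow hx 3
  rw [div_le_iff₀ (by positivity)] at h2
  have h3 : ∑ j ∈ J, x j ^ 4 ≤ J.card * T := by simpa using Finset.sum_le_sum hT
  calc _ ≤ _ := h2
    _ ≤ J.card * T * (J.card : ℝ) ^ 3 := by gcongr
    _ = _ := by ring

lemma mnorm_sum_pow_le {Ω γ : Type*} [Fintype Ω] {q : ℕ} (hq : q ≠ 0) (J : Finset γ)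
    (F : γ → Ω → ℝ) {T : ℝ} (hF : ∀ j ∈ J, mnorm q (F j) ^ 4 ≤ T) :
    mnorm q (fun x => ∑ j ∈ J, F j x) ^ 4 ≤ (J.card : ℝ) ^ 4 * T :=
  (pow_le_pow_left₀ (mnorm_nonneg _ _) (mnorm_sum_le hq J F) 4).trans
    (sum_pow_four_le J (fun _ _ => mnorm_nonneg _ _) hF)

/-! ### Removing coincidences -/

/-- Sort the pairs by the exact set `D` of coordinates where they agree; `r ≠ s` says that `D` is a
proper subset. The common part `b` on `D` is then a parameter. -/
lemma coincidence_sum {n : ℕ} (E : Finset ι) (M c₀ : ι → ℕ) (F : (ι → ℕ) → (ι → ℕ) → ℝ)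
    (hF : ∀ r ∈ cube n E, ∀ s ∈ cube n E, F r s ≠ 0 → ∀ l ∈ E, r l / 2 ^ M l = c₀ l) :
    ∑ r ∈ cube n E, ∑ s ∈ cube n E, (if r ≠ s then F r s else 0)
      = ∑ D ∈ E.ssubsets, ∑ b ∈ cell n D M c₀, ∑ r ∈ cube n (E \ D), ∑ s ∈ cube n (E \ D),
          if ∀ l ∈ E \ D, r l ≠ s l then F (b + r) (b + s) else 0 := by
  have h1 : ∀ r ∈ cube n E, ∀ s ∈ cube n E, (if r ≠ s then F r s else 0)
      = ∑ D ∈ E.ssubsets, if (E.filter fun l => r l = s l) = D then F r s else 0 := by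
    intro r hr s hs
    rw [Finset.sum_ite_eq]
    refine if_congr ?_ rfl rfl
    rw [Finset.mem_ssubsets, Finset.ssubset_iff_subset_ne, ne_eq, ne_eq, Finset.filter_eq_self]
    exact ⟨fun h => ⟨Finset.filter_subset _ _, fun h' => h (boxOn_ext hr hs h')⟩,
      fun h h' => h.2 fun l _ => congrFun h' l⟩
  rw [Finset.sum_congr rfl fun r hr => Finset.sum_congr rfl fun s hs => h1 r hr s hs]
  rw [Finset.sum_congr rfl fun r _ => Finset.sum_comm, Finset.sum_comm]
  refine Finset.sum_congr rfl fun D hD => ?_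
  have hDE : D ⊆ E := (Finset.mem_ssubsets.1 hD).1
  have hd : Disjoint D (E \ D) := Finset.disjoint_sdiff
  have hu : cube n E = boxOn (D ∪ (E \ D)) fun _ => Finset.range n := by
    rw [Finset.union_sdiff_of_subset hDE, cube]
  have hiff : ∀ b ∈ cube n D, ∀ r ∈ cube n (E \ D), ∀ b' ∈ cube n D, ∀ s ∈ cube n (E \ D),
      ((E.filter fun l => (b + r) l = (b' + s) l) = D ↔ b' = b ∧ ∀ l ∈ E \ D, r l ≠ s l) := by
    intro b hb r hr b' hb' s hs
    have hb0 := (mem_boxOn.1 hb).2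
    have hr0 := (mem_boxOn.1 hr).2
    have hb0' := (mem_boxOn.1 hb').2
    have hs0 := (mem_boxOn.1 hs).2
    have hD1 : ∀ l ∈ D, ((b + r) l = (b' + s) l ↔ b l = b' l) := fun l hl => by
      have hl' : l ∉ E \ D := Finset.disjoint_left.1 hd hl
      rw [Pi.add_apply, Pi.add_apply, hr0 l hl', hs0 l hl', add_zero, add_zero]
    have hD2 : ∀ l ∈ E \ D, ((b + r) l = (b' + s) l ↔ r l = s l) := fun l hl => by
      have hl' : l ∉ D := (Finset.mem_sdiff.1 hl).2
      rw [Pi.add_apply, Pi.add_apply, hb0 l hl', hb0' l hl', zero_add, zero_add]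
    constructor
    · intro h
      refine ⟨boxOn_ext hb' hb fun l hl => ?_, fun l hl e => ?_⟩
      · have := hl
        rw [← h, Finset.mem_filter] at this
        exact ((hD1 l hl).1 this.2).symm
      · refine (Finset.mem_sdiff.1 hl).2 ?_
        rw [← h, Finset.mem_filter]
        exact ⟨(Finset.mem_sdiff.1 hl).1, (hD2 l hl).2 e⟩
    · rintro ⟨rfl, h⟩
      ext l
      rw [Finset.mem_filter]
      constructor
      · rintro ⟨hl, e⟩
        by_contra hlD
        have hl' := Finset.mem_sdiff.2 ⟨hl, hlD⟩
        exact h l hl' ((hD2 l hl').1 e)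
      · intro hl
        exact ⟨hDE hl, (hD1 l hl).2 rfl⟩
  calc _ = ∑ b ∈ cube n D, ∑ r ∈ cube n (E \ D), ∑ b' ∈ cube n D, ∑ s ∈ cube n (E \ D),
        if (E.filter fun l => (b + r) l = (b' + s) l) = D then F (b + r) (b' + s) else 0 := by
        rw [hu]
        simp only [sum_boxOn_union hd]
        rfl
    _ = ∑ b ∈ cube n D, ∑ r ∈ cube n (E \ D), ∑ s ∈ cube n (E \ D),
        if ∀ l ∈ E \ D, r l ≠ s l then F (b + r) (b + s) else 0 := by
        refine Finset.sum_congr rfl fun b hb => Finset.sum_congr rfl fun r hr => ?_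
        rw [Finset.sum_eq_single_of_mem b hb]
        · refine Finset.sum_congr rfl fun s hs => if_congr ?_ rfl rfl
          rw [hiff b hb r hr b hb s hs]
          simp
        · intro b' hb' hne
          refine Finset.sum_eq_zero fun s hs => if_neg fun h => hne ?_
          exact ((hiff b hb r hr b' hb' s hs).1 h).1
    _ = _ := by
        symm
        refine Finset.sum_subset (cell_subset_cube _ _ _ _) fun b hb hb' => ?_
        refine Finset.sum_eq_zero fun r hr => Finset.sum_eq_zero fun s hs => ?_
        refine ite_eq_right_iff.2 fun _ => ?_
        by_contra h0
        have hbr : b + r ∈ cube n E := by rw [hu]; exact add_mem_boxOn hd hb hr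
        have hbs : b + s ∈ cube n E := by rw [hu]; exact add_mem_boxOn hd hb hs
        refine hb' (mem_cell.2 ⟨hb, fun l hl => ?_⟩)
        have := hF _ hbr _ hbs h0 l (hDE hl)
        rwa [Pi.add_apply, (mem_boxOn.1 hr).2 l (Finset.disjoint_left.1 hd hl), add_zero] at this

lemma Fam.freeze {Ω : Type} {τ : ι → ℕ → Equiv.Perm Ω} {E : Finset ι} {n : ℕ}
    {W : Finset (ι → ℕ)} {h : (ι → ℕ) → ℕ} {M c₀ : ι → ℕ} {N : ℕ}
    {f : (ι → ℕ) → (ι → ℕ) → Ω → ℝ} (hf : Fam τ E n W h M c₀ N f) {D : Finset ι} (hD : D ⊆ E)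
    {b : ι → ℕ} (hb : b ∈ cube n D) :
    Fam τ (E \ D) n W h M c₀ (N - ∑ l ∈ D, b l) fun w r => f w (b + r) := by
  have hd : Disjoint D (E \ D) := Finset.disjoint_sdiff
  have hu : D ∪ (E \ D) = E := Finset.union_sdiff_of_subset hD
  have hmem : ∀ r ∈ cube n (E \ D), b + r ∈ cube n E := fun r hr => by
    have := add_mem_boxOn hd hb hr
    rwa [hu] at this
  have happ : ∀ r : ι → ℕ, ∀ l ∈ E \ D, (b + r) l = r l := fun r l hl => by
    rw [Pi.add_apply, (mem_boxOn.1 hb).2 l (Finset.mem_sdiff.1 hl).2, zero_add]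
  refine ⟨fun w hw r hr => ?_, fun w hw r hr => hf.bdd w hw _ (hmem r hr), fun w hw r hr h0 => ?_⟩
  · exact ((hf.lvl w hw _ (hmem r hr)).mono Finset.sdiff_subset).congr (happ r)
  · obtain ⟨h1, h2⟩ := hf.supp w hw _ (hmem r hr) h0
    have h3 := sum_add_left hd hb hr
    rw [hu] at h3
    refine ⟨by omega, fun l hl => ?_⟩
    rw [← happ r l hl]
    exact h2 l (Finset.mem_sdiff.1 hl).1

lemma card_cell_le (n : ℕ) (S : Finset ι) (μ b : ι → ℕ) :
    (cell n S μ b).card ≤ ∏ l ∈ S, 2 ^ μ l := by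
  rw [cell, card_boxOn]
  exact Finset.prod_le_prod' fun l _ => card_block_le _ _ _

/-- The triangle inequality over the frozen values costs the fourth power of ∏_D 2^M. One factor
restores the product over `E`, the other three are paid by `n ^ (3 * D.card)`. -/
lemma bnd_freeze {E D : Finset ι} (hD : D ⊂ E) {k n : ℕ} (a : ℕ) {M : ι → ℕ} (hk : 1 ≤ k)
    (hM : ∀ l ∈ E, 2 ^ M l ≤ n) :
    (∏ l ∈ D, (2 : ℝ) ^ M l) ^ 4 * bnd k n a (E \ D) M ≤ bnd k n a E M := by
  have hk' : (1 : ℝ) ≤ k := by exact_mod_cast hk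
  have hc : (E \ D).card + D.card = E.card := Finset.card_sdiff_add_card_eq_card hD.1
  have hpos : 0 < (E \ D).card := Finset.card_pos.2 (Finset.sdiff_nonempty.2 hD.2)
  have h1 : (∏ l ∈ D, (2 : ℝ) ^ M l) ≤ (n : ℝ) ^ D.card := by
    rw [← Finset.prod_const]
    exact Finset.prod_le_prod (fun _ _ => by positivity) fun l hl => by
      exact_mod_cast hM l (hD.1 hl)
  have h2 : ∏ l ∈ E, (2 : ℝ) ^ M l = (∏ l ∈ E \ D, (2 : ℝ) ^ M l) * ∏ l ∈ D, (2 : ℝ) ^ M l :=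
    (Finset.prod_sdiff hD.1).symm
  unfold bnd
  rw [h2]
  set Z := ∏ l ∈ D, (2 : ℝ) ^ M l with hZ
  have hZ0 : 0 ≤ Z := by positivity
  set Z' := ∏ l ∈ E \ D, (2 : ℝ) ^ M l
  have hZ0' : 0 ≤ Z' := by positivity
  have e1 : 3 * E.card - 3 = 3 * D.card + (3 * (E \ D).card - 3) := by omega
  calc Z ^ 4 * ((k : ℝ) ^ (4 * (E \ D).card - 2) * (n : ℝ) ^ (3 * (E \ D).card - 3) * a * Z')
      = (k : ℝ) ^ (4 * (E \ D).card - 2) * (Z ^ 3 * (n : ℝ) ^ (3 * (E \ D).card - 3)) * a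
        * (Z' * Z) := by ring
    _ ≤ (k : ℝ) ^ (4 * E.card - 2) *
        (((n : ℝ) ^ D.card) ^ 3 * (n : ℝ) ^ (3 * (E \ D).card - 3)) * a * (Z' * Z) := by
        have : 4 * (E \ D).card - 2 ≤ 4 * E.card - 2 := by omega
        gcongr
    _ = _ := by rw [e1, pow_add, ← pow_mul, mul_comm D.card 3]

lemma StrictBound.full {e : ℕ} {C : ℝ} (hC : 0 ≤ C) (hS : StrictBound ι e C) :
    FullBound ι e (((2 : ℝ) ^ e) ^ 4 * C) := by
  intro Ω _ τ E n W h M c₀ N N' a k f g hE hEe hset hf hg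
  have hq : 2 * k ≠ 0 := by have := hset.two_le; omega
  have hsum : ∀ x, ∑ w ∈ W, ∑ r ∈ cube n E, ∑ s ∈ cube n E,
      (if r ≠ s then f w r x * g w s x else 0)
      = ∑ D ∈ E.ssubsets, ∑ b ∈ cell n D M c₀, ∑ w ∈ W, ∑ r ∈ cube n (E \ D),
        ∑ s ∈ cube n (E \ D), if ∀ l ∈ E \ D, r l ≠ s l then f w (b + r) x * g w (b + s) x
          else 0 := by
    intro x
    rw [Finset.sum_congr rfl fun w hw => coincidence_sum E M c₀ (fun r s => f w r x * g w s x) ?_]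
    · rw [Finset.sum_comm]
      exact Finset.sum_congr rfl fun D _ => Finset.sum_comm
    · intro r hr s _ h0
      refine (hf.supp w hw r hr fun h => h0 ?_).2
      rw [h]; simp
  simp only [hsum]
  refine (mnorm_sum_pow_le hq _ _ (T := C * bnd k n a E M) fun D hD => ?_).trans ?_
  · have hDE := Finset.mem_ssubsets.1 hD
    refine (mnorm_sum_pow_le hq _ _ (T := C * bnd k n a (E \ D) M) fun b hb => ?_).trans ?_
    · have hb' := cell_subset_cube _ _ _ _ hb
      refine hS Ω τ (E \ D) n W h M c₀ _ _ a k (fun w r => f w (b + r)) (fun w r => g w (b + r))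
        (Finset.sdiff_nonempty.2 hDE.2) ((Finset.card_le_card Finset.sdiff_subset).trans hEe)
        ⟨hset.two_le, hset.inj, hset.card_le, hset.a_le,
          fun l hl => hset.pow_le l (Finset.mem_sdiff.1 hl).1⟩
        (hf.freeze hDE.1 hb') (hg.freeze hDE.1 hb')
    · have h1 : ((cell n D M c₀).card : ℝ) ≤ ∏ l ∈ D, (2 : ℝ) ^ M l := by
        exact_mod_cast card_cell_le n D M c₀
      have h2 := bnd_freeze hDE a (by have := hset.two_le; omega : 1 ≤ k) hset.pow_le
      have h3 := bnd_nonneg k n a (E \ D) M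
      calc _ ≤ (∏ l ∈ D, (2 : ℝ) ^ M l) ^ 4 * (C * bnd k n a (E \ D) M) := by gcongr
        _ = C * ((∏ l ∈ D, (2 : ℝ) ^ M l) ^ 4 * bnd k n a (E \ D) M) := by ring
        _ ≤ _ := by gcongr
  · have h3 := bnd_nonneg k n a E M
    rw [← mul_assoc]
    gcongr
    have h4 : E.ssubsets.card ≤ 2 ^ E.card := by
      rw [← Finset.card_powerset]
      exact Finset.card_le_card (Finset.erase_subset _ _)
    calc (E.ssubsets.card : ℝ) ≤ (2 : ℝ) ^ E.card := by exact_mod_cast h4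
      _ ≤ _ := pow_le_pow_right₀ (by norm_num) hEe

end BeckGain

namespace BeckGain

variable {ι : Type} [Fintype ι] [DecidableEq ι]

/-! ### Level and size of simple combinations -/

lemma Lvl.mul_inv {Ω : Type} {τ : ι → ℕ → Equiv.Perm Ω} {E : Finset ι} {r : ι → ℕ}
    {F G : Ω → ℝ} (hF : Lvl τ E r F) (hG : ∀ l ∈ E, ∀ t, r l ≤ t → ∀ x, G (τ l t x) = G x) :
    Lvl τ E r fun x => F x * G x := fun l hl =>
  ⟨fun x => by simp only [(hF l hl).1 x, hG l hl _ le_rfl x, neg_mul],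
    fun t ht x => by simp only [(hF l hl).2 t ht x, hG l hl t ht.le x]⟩

lemma Lvl.sum {Ω γ : Type} {τ : ι → ℕ → Equiv.Perm Ω} {E : Finset ι} {r : ι → ℕ}
    (J : Finset γ) {F : γ → Ω → ℝ} (hF : ∀ j ∈ J, Lvl τ E r (F j)) :
    Lvl τ E r fun x => ∑ j ∈ J, F j x := fun l hl =>
  ⟨fun x => by
    rw [← Finset.sum_neg_distrib]
    exact Finset.sum_congr rfl fun j hj => (hF j hj l hl).1 x,
    fun t ht x => Finset.sum_congr rfl fun j hj => (hF j hj l hl).2 t ht x⟩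

/-- The fixed sum of exponents determines the coordinate `i` from the others, so `S.card - 1`
applications of the square function already separate all terms. -/
lemma mnorm_hyperbolic_sum_le {Ω : Type} [Fintype Ω] {τ : ι → ℕ → Equiv.Perm Ω} {S : Finset ι}
    {k : ℕ} (hk : 2 ≤ k) {i : ι} (hi : i ∈ S) {t : ι → Finset ℕ} (N : ℕ) {A : Finset (ι → ℕ)}
    (hA : A ⊆ boxOn S t) (F : (ι → ℕ) → Ω → ℝ)
    (hl : ∀ r ∈ A, Lvl τ S r (F r)) (hb : ∀ r ∈ A, ∀ x, |F r x| ≤ 1)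
    (hs : ∀ r ∈ A, F r ≠ 0 → ∑ l ∈ S, r l = N) :
    mnorm (2 * k) (fun x => ∑ r ∈ A, F r x) ^ 2
      ≤ (128 * (k : ℝ)) ^ (S.card - 1) * ∏ l ∈ S.erase i, ((t l).card : ℝ) := by
  classical
  set A' := A.filter fun r => F r ≠ 0 with hA'
  have hsum : ∀ x, ∑ r ∈ A, F r x = ∑ r ∈ A', F r x := fun x => by
    symm
    refine Finset.sum_subset (Finset.filter_subset _ _) fun r hr hr' => ?_
    have : F r = 0 := by
      by_contra h
      exact hr' (Finset.mem_filter.2 ⟨hr, h⟩)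
    rw [this]; rfl
  simp only [hsum]
  have hmem : ∀ r ∈ A', r ∈ A ∧ ∑ l ∈ S, r l = N := fun r hr =>
    ⟨(Finset.mem_filter.1 hr).1, hs r (Finset.mem_filter.1 hr).1 (Finset.mem_filter.1 hr).2⟩
  refine (mnorm_sum_sq_le_card τ (S.erase i) A' (fun r => r) F hk
    (fun r hr => (hl r (hmem r hr).1).mono (Finset.erase_subset _ _))
    (fun r hr => hb r (hmem r hr).1) ?_).trans ?_
  · intro r hr s hs' hrs
    have h1 := (hmem r hr).2
    have h2 := (hmem s hs').2
    rw [← Finset.add_sum_erase _ _ hi] at h1 h2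
    have h3 : ∑ l ∈ S.erase i, r l = ∑ l ∈ S.erase i, s l := Finset.sum_congr rfl hrs
    refine boxOn_ext (hA (hmem r hr).1) (hA (hmem s hs').1) fun l hl' => ?_
    by_cases hli : l = i
    · rw [hli]; omega
    · exact hrs l (Finset.mem_erase.2 ⟨hli, hl'⟩)
  · rw [Finset.card_erase_of_mem hi]
    gcongr
    have := card_hyperbolic_le hi N ((Finset.filter_subset _ _).trans hA) fun r hr => (hmem r hr).2
    exact_mod_cast this

/-- Two counts of the same set: `w` and all but one coordinate of `r` are free, or else `r` is free
in its block and determines `w`, because the height is injective. -/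
lemma card_support_le {Ω : Type} {τ : ι → ℕ → Equiv.Perm Ω} {E : Finset ι} {n : ℕ}
    {W : Finset (ι → ℕ)} {h : (ι → ℕ) → ℕ} {M c₀ : ι → ℕ} {N a k : ℕ}
    {f : (ι → ℕ) → (ι → ℕ) → Ω → ℝ} (hE : E.Nonempty) (hset : Setting E n W h M a k)
    (hf : Fam τ E n W h M c₀ N f) {J : Finset ((ι → ℕ) × (ι → ℕ))} (hJ : J ⊆ W ×ˢ cube n E)
    (hJ0 : ∀ j ∈ J, f j.1 j.2 ≠ 0) :
    J.card ≤ a * n ^ (E.card - 1) ∧ J.card ≤ ∏ l ∈ E, 2 ^ M l := by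
  classical
  have hmem : ∀ j ∈ J, j.1 ∈ W ∧ j.2 ∈ cube n E ∧ h j.1 + ∑ l ∈ E, j.2 l = N ∧
      ∀ l ∈ E, j.2 l / 2 ^ M l = c₀ l := fun j hj => by
    have := Finset.mem_product.1 (hJ hj)
    exact ⟨this.1, this.2, hf.supp _ this.1 _ this.2 (hJ0 j hj)⟩
  constructor
  · obtain ⟨i, hi⟩ := hE
    have : J.card ≤ n ^ (E.card - 1) * W.card := by
      refine Finset.card_le_mul_card_image_of_maps_to (f := Prod.fst)
        (fun j hj => (hmem j hj).1) _ fun w _ => ?_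
      rw [← Finset.card_image_of_injOn (f := Prod.snd)]
      · refine (card_hyperbolic_le hi (N - h w) (t := fun _ => Finset.range n) ?_ ?_).trans ?_
        · intro r hr
          obtain ⟨j, hj, rfl⟩ := Finset.mem_image.1 hr
          exact (hmem j (Finset.mem_filter.1 hj).1).2.1
        · intro r hr
          obtain ⟨j, hj, rfl⟩ := Finset.mem_image.1 hr
          obtain ⟨hj', hw⟩ := Finset.mem_filter.1 hj
          have := (hmem j hj').2.2.1
          rw [hw] at this
          omega
        · simp [Finset.card_erase_of_mem hi]
      · intro j hj j' hj' e
        exact Prod.ext ((Finset.mem_filter.1 hj).2.trans (Finset.mem_filter.1 hj').2.symm) e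
    calc J.card ≤ _ := this
      _ ≤ n ^ (E.card - 1) * a := by gcongr; exact hset.card_le
      _ = _ := mul_comm _ _
  · refine le_trans ?_ (card_cell_le n E M c₀)
    refine Finset.card_le_card_of_injOn Prod.snd ?_ ?_
    · intro j hj
      exact mem_cell.2 ⟨(hmem j hj).2.1, (hmem j hj).2.2.2⟩
    · intro j hj j' hj' e
      refine Prod.ext (hset.inj (hmem j hj).1 (hmem j' hj').1 ?_) e
      have h1 := (hmem j hj).2.2.1
      have h2 := (hmem j' hj').2.2.1
      rw [show j.2 = j'.2 from e] at h1
      omega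

/-! ### The contribution of the pairs with `s < r` in all coordinates -/

/-- Since all `s` are below `r`, the inner sum `G` is invariant under the symmetries of level at
least `r`, and `f * G` has level `r` in every coordinate of `E`. The vector `r` determines `w`, so
the square function applies to all terms together; each `G` is then a hyperbolic sum. -/
lemma ordered_bound {Ω : Type} [Fintype Ω] {τ : ι → ℕ → Equiv.Perm Ω} {E : Finset ι} {n : ℕ}
    {W : Finset (ι → ℕ)} {h : (ι → ℕ) → ℕ} {M c₀ : ι → ℕ} {N N' a k : ℕ}
    {f g : (ι → ℕ) → (ι → ℕ) → Ω → ℝ} (hE : E.Nonempty) (hset : Setting E n W h M a k)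
    (hf : Fam τ E n W h M c₀ N f) (hg : Fam τ E n W h M c₀ N' g) :
    mnorm (2 * k) (fun x => ∑ w ∈ W, ∑ r ∈ cube n E, ∑ s ∈ cube n E,
      if ∀ l ∈ E, s l < r l then f w r x * g w s x else 0) ^ 4
      ≤ 128 ^ (4 * E.card - 2) * bnd k n a E M := by
  classical
  have hk := hset.two_le
  set G : (ι → ℕ) → (ι → ℕ) → Ω → ℝ := fun w r x =>
    ∑ s ∈ (cube n E).filter fun s => ∀ l ∈ E, s l < r l, g w s x with hG
  set J := (W ×ˢ cube n E).filter fun j => f j.1 j.2 ≠ 0 with hJ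
  have hsum : ∀ x, ∑ w ∈ W, ∑ r ∈ cube n E, ∑ s ∈ cube n E,
      (if ∀ l ∈ E, s l < r l then f w r x * g w s x else 0)
      = ∑ j ∈ J, f j.1 j.2 x * G j.1 j.2 x := fun x => by
    have e1 : ∀ w r, ∑ s ∈ cube n E, (if ∀ l ∈ E, s l < r l then f w r x * g w s x else 0)
        = f w r x * G w r x := fun w r => by
      rw [hG, Finset.mul_sum, Finset.sum_filter]
    simp only [e1]
    rw [← Finset.sum_product' W (cube n E) fun w r => f w r x * G w r x]
    symm
    refine Finset.sum_subset (Finset.filter_subset _ _) fun j hj hj' => ?_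
    have : f j.1 j.2 = 0 := by
      by_contra h0
      exact hj' (Finset.mem_filter.2 ⟨hj, h0⟩)
    rw [this]; simp
  simp only [hsum]
  have hmem : ∀ j ∈ J, j.1 ∈ W ∧ j.2 ∈ cube n E ∧ f j.1 j.2 ≠ 0 := fun j hj => by
    have h1 := Finset.mem_filter.1 hj
    exact ⟨(Finset.mem_product.1 h1.1).1, (Finset.mem_product.1 h1.1).2, h1.2⟩
  have hcard := card_support_le hE hset hf (Finset.filter_subset _ _ : J ⊆ _)
    fun j hj => (hmem j hj).2.2
  obtain ⟨i, hi⟩ := hE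
  have hterm : ∀ j ∈ J, mnorm (2 * k) (fun x => f j.1 j.2 x * G j.1 j.2 x) ^ 2
      ≤ (128 * (k : ℝ)) ^ (E.card - 1) * (n : ℝ) ^ (E.card - 1) := by
    intro j hj
    obtain ⟨hw, hr, -⟩ := hmem j hj
    have h1 : mnorm (2 * k) (fun x => f j.1 j.2 x * G j.1 j.2 x) ≤ mnorm (2 * k) (G j.1 j.2) := by
      refine mnorm_mono fun x => ?_
      rw [abs_mul]
      exact mul_le_of_le_one_left (abs_nonneg _) (hf.bdd _ hw _ hr x)
    refine (pow_le_pow_left₀ (mnorm_nonneg _ _) h1 2).trans ?_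
    refine (mnorm_hyperbolic_sum_le hk hi (t := fun _ => Finset.range n) (N' - h j.1)
      (Finset.filter_subset _ _) (g j.1) (fun s hs => hg.lvl _ hw _ (Finset.mem_filter.1 hs).1)
      (fun s hs => hg.bdd _ hw _ (Finset.mem_filter.1 hs).1) fun s hs h0 => ?_).trans ?_
    · have := (hg.supp _ hw _ (Finset.mem_filter.1 hs).1 h0).1
      omega
    · simp [Finset.card_erase_of_mem hi]
  have hsq : mnorm (2 * k) (fun x => ∑ j ∈ J, f j.1 j.2 x * G j.1 j.2 x) ^ 2
      ≤ (128 * (k : ℝ)) ^ E.card *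
        (J.card * ((128 * (k : ℝ)) ^ (E.card - 1) * (n : ℝ) ^ (E.card - 1))) := by
    refine (square_function_sum τ E J (fun j => j.2) _ hk ?_ ?_).trans ?_
    · intro j hj
      obtain ⟨hw, hr, -⟩ := hmem j hj
      refine (hf.lvl _ hw _ hr).mul_inv fun l hl t ht x => ?_
      refine Finset.sum_congr rfl fun s hs => ?_
      have hs := Finset.mem_filter.1 hs
      exact (hg.lvl _ hw _ hs.1 l hl).2 t ((hs.2 l hl).trans_le ht) x
    · intro j hj j' hj' e
      obtain ⟨hw, hr, h0⟩ := hmem j hj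
      obtain ⟨hw', hr', h0'⟩ := hmem j' hj'
      have e2 := boxOn_ext hr hr' e
      refine Prod.ext (hset.inj hw hw' ?_) e2
      have h1 := (hf.supp _ hw _ hr h0).1
      have h2 := (hf.supp _ hw' _ hr' h0').1
      rw [e2] at h1
      omega
    · gcongr
      simpa using Finset.sum_le_sum hterm
  have hc : 1 ≤ E.card := Finset.card_pos.2 ⟨i, hi⟩
  obtain ⟨e, he⟩ : ∃ e, E.card = e + 1 := ⟨E.card - 1, by omega⟩
  -- Multiplying the two counts is what produces both `a` and the block volume in `bnd`.
  have hJ2 : (J.card : ℝ) ^ 2 ≤ a * (n : ℝ) ^ e * ∏ l ∈ E, (2 : ℝ) ^ M l := by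
    rw [sq]
    rw [he, Nat.add_sub_cancel] at hcard
    gcongr
    · exact_mod_cast hcard.1
    · exact_mod_cast hcard.2
  unfold bnd
  rw [he] at hsq ⊢
  rw [Nat.add_sub_cancel] at hsq
  rw [show 4 * (e + 1) - 2 = 4 * e + 2 by omega, show 3 * (e + 1) - 3 = 3 * e by omega]
  calc _ = (mnorm (2 * k) (fun x => ∑ j ∈ J, f j.1 j.2 x * G j.1 j.2 x) ^ 2) ^ 2 := by ring
    _ ≤ ((128 * (k : ℝ)) ^ (e + 1) * (J.card * ((128 * (k : ℝ)) ^ e * (n : ℝ) ^ e))) ^ 2 := by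
        gcongr
    _ = (128 * (k : ℝ)) ^ (4 * e + 2) * (n : ℝ) ^ (2 * e) * (J.card : ℝ) ^ 2 := by ring
    _ ≤ (128 * (k : ℝ)) ^ (4 * e + 2) * (n : ℝ) ^ (2 * e) *
          (a * (n : ℝ) ^ e * ∏ l ∈ E, (2 : ℝ) ^ M l) := by gcongr
    _ = _ := by rw [mul_pow]; ring

end BeckGain

namespace BeckGain

variable {ι : Type} [Fintype ι] [DecidableEq ι]

/-! ### Fibers over a splitting of the coordinates -/

/-- `E` is the disjoint union of `P` and `Q`. -/
structure Split (E P Q : Finset ι) : Prop where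
  disj : Disjoint P Q
  union : P ∪ Q = E

lemma Split.symm {E P Q : Finset ι} (h : Split E P Q) : Split E Q P :=
  ⟨h.disj.symm, by rw [Finset.union_comm, h.union]⟩

lemma Split.card {E P Q : Finset ι} (h : Split E P Q) : E.card = P.card + Q.card := by
  rw [← h.union, Finset.card_union_of_disjoint h.disj]

lemma Split.add_mem {E P Q : Finset ι} (h : Split E P Q) {n : ℕ} {v z : ι → ℕ}
    (hv : v ∈ cube n P) (hz : z ∈ cube n Q) : v + z ∈ cube n E := by
  have := add_mem_boxOn h.disj hv hz
  rwa [h.union] at this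

lemma Split.sum_add {E P Q : Finset ι} (h : Split E P Q) {n : ℕ} {v z : ι → ℕ}
    (hv : v ∈ cube n P) (hz : z ∈ cube n Q) :
    ∑ l ∈ E, (v + z) l = ∑ l ∈ P, v l + ∑ l ∈ Q, z l := by
  rw [← h.union]
  exact sum_add_left h.disj hv hz

lemma Split.add_left {E P Q : Finset ι} (h : Split E P Q) {n : ℕ} (v : ι → ℕ) {z : ι → ℕ}
    (hz : z ∈ cube n Q) {l : ι} (hl : l ∈ P) : (v + z) l = v l := by
  rw [Pi.add_apply, (mem_boxOn.1 hz).2 l (Finset.disjoint_left.1 h.disj hl), add_zero]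

lemma Split.add_right {E P Q : Finset ι} (h : Split E P Q) {n : ℕ} {v : ι → ℕ} (z : ι → ℕ)
    (hv : v ∈ cube n P) {l : ι} (hl : l ∈ Q) : (v + z) l = z l := by
  rw [add_comm]; exact h.symm.add_left z hv hl

lemma Split.left_subset {E P Q : Finset ι} (h : Split E P Q) : P ⊆ E := by
  rw [← h.union]; exact Finset.subset_union_left

lemma Split.right_subset {E P Q : Finset ι} (h : Split E P Q) : Q ⊆ E := h.symm.left_subset

/-- The sum of `f w (v + ρ)` over the `ρ` in a dyadic box in the coordinates in `S`. -/
noncomputable def fiber {Ω : Type} (n : ℕ) (S : Finset ι) (μ b : ι → ℕ)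
    (f : (ι → ℕ) → (ι → ℕ) → Ω → ℝ) (w v : ι → ℕ) (x : Ω) : ℝ :=
  ∑ ρ ∈ cell n S μ b, f w (v + ρ) x

lemma exists_of_fiber_ne_zero {Ω : Type} {n : ℕ} {S : Finset ι} {μ b : ι → ℕ}
    {f : (ι → ℕ) → (ι → ℕ) → Ω → ℝ} {w v : ι → ℕ} (h : fiber n S μ b f w v ≠ 0) :
    ∃ ρ ∈ cell n S μ b, f w (v + ρ) ≠ 0 := by
  by_contra! hc
  refine h (funext fun x => Finset.sum_eq_zero fun ρ hρ => ?_)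
  rw [hc ρ hρ]; rfl

section Fibers

variable {Ω : Type} {τ : ι → ℕ → Equiv.Perm Ω} {E P Q : Finset ι} {n : ℕ}
  {W : Finset (ι → ℕ)} {h : (ι → ℕ) → ℕ} {M c₀ μ : ι → ℕ} {N N' a k : ℕ}
  {f g : (ι → ℕ) → (ι → ℕ) → Ω → ℝ}

lemma cell_lt {c z ρ : ι → ℕ} (hS : Split E P Q) (hz : z ∈ cell n Q μ (halfIndex Q c))
    (hρ : ρ ∈ cell n Q μ (halfIndex P c)) {l : ι} (hl : l ∈ Q) :
    ρ l < z l ∧ z l ≤ ρ l + 2 * 2 ^ μ l := by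
  have h1 := (mem_cell.1 hz).2 l hl
  have h2 := (mem_cell.1 hρ).2 l hl
  have hlP : l ∉ P := Finset.disjoint_right.1 hS.disj hl
  simp only [halfIndex, hl, hlP, if_true, if_false] at h1 h2
  refine ⟨whitney_lt h2 h1, ?_⟩
  have h3 := Nat.div_add_mod (z l) (2 ^ μ l)
  have h4 := Nat.mod_lt (z l) (show 0 < 2 ^ μ l by positivity)
  have h5 := Nat.div_add_mod (ρ l) (2 ^ μ l)
  rw [h1] at h3
  rw [h2] at h5
  have e : 2 ^ μ l * (2 * c l + 1) = 2 ^ μ l * (2 * c l + 0) + 2 ^ μ l := by ring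
  omega

lemma fiber_lvl (hS : Split E P Q) (hf : Fam τ E n W h M c₀ N f) {w v b : ι → ℕ} (hw : w ∈ W)
    (hv : v ∈ cube n P) : Lvl τ P v (fiber n Q μ b f w v) := by
  refine Lvl.sum _ fun ρ hρ => ?_
  have hρ := cell_subset_cube _ _ _ _ hρ
  exact ((hf.lvl w hw _ (hS.add_mem hv hρ)).mono hS.left_subset).congr fun l hl =>
    hS.add_left v hρ hl

lemma fiber_inv (hS : Split E P Q) (hf : Fam τ E n W h M c₀ N f) {w v z c : ι → ℕ} (hw : w ∈ W)
    (hv : v ∈ cube n P) (hz : z ∈ cell n Q μ (halfIndex Q c)) {l : ι} (hl : l ∈ Q) {t : ℕ}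
    (ht : z l ≤ t) (x : Ω) :
    fiber n Q μ (halfIndex P c) f w v (τ l t x) = fiber n Q μ (halfIndex P c) f w v x := by
  refine Finset.sum_congr rfl fun ρ hρ => ?_
  have hρ' := cell_subset_cube _ _ _ _ hρ
  refine (hf.lvl w hw _ (hS.add_mem hv hρ') l (hS.right_subset hl)).2 t ?_ x
  rw [hS.add_right ρ hv hl]
  exact (cell_lt hS hz hρ hl).1.trans_le ht

/-- On `P` the fiber of `f` has level `v`, while the fiber of `g` only involves vectors in the lower
halves, strictly below `v`, and is invariant there. On `Q` the roles are exchanged. -/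
lemma fiber_mul_lvl (hS : Split E P Q) (hf : Fam τ E n W h M c₀ N f)
    (hg : Fam τ E n W h M c₀ N' g) {w v z c : ι → ℕ} (hw : w ∈ W)
    (hv : v ∈ cell n P μ (halfIndex P c)) (hz : z ∈ cell n Q μ (halfIndex Q c)) :
    Lvl τ E (v + z) fun x =>
      fiber n Q μ (halfIndex P c) f w v x * fiber n P μ (halfIndex Q c) g w z x := by
  have hv' := cell_subset_cube _ _ _ _ hv
  have hz' := cell_subset_cube _ _ _ _ hz
  have h1 := (fiber_lvl (μ := μ) (b := halfIndex P c) hS hf hw hv').mul_inv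
    (G := fiber n P μ (halfIndex Q c) g w z)
    fun l hl t ht x => fiber_inv hS.symm hg hw hz' hv hl ht x
  have h2 := (fiber_lvl (μ := μ) (b := halfIndex Q c) hS.symm hg hw hz').mul_inv
    (G := fiber n Q μ (halfIndex P c) f w v)
    fun l hl t ht x => fiber_inv hS hf hw hv' hz hl ht x
  intro l hl
  rw [← hS.union, Finset.mem_union] at hl
  rcases hl with hl | hl
  · exact h1.congr (fun l hl => (hS.add_left v hz' hl).symm) l hl
  · have := h2.congr (fun l hl => (hS.add_right z hv' hl).symm) l hl
    simpa only [mul_comm] using this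

lemma fiber_norm [Fintype Ω] (hS : Split E P Q) (hf : Fam τ E n W h M c₀ N f) {w v b : ι → ℕ}
    (hw : w ∈ W) (hv : v ∈ cube n P) {i : ι} (hi : i ∈ Q) {q : ℕ} (hq : 2 ≤ q) :
    mnorm (2 * q) (fiber n Q μ b f w v) ^ 2
      ≤ (128 * (q : ℝ)) ^ (Q.card - 1) * ∏ l ∈ Q.erase i, (2 : ℝ) ^ μ l := by
  have hρ : ∀ ρ ∈ cell n Q μ b, ρ ∈ cube n Q := fun ρ hρ => cell_subset_cube _ _ _ _ hρ
  refine (mnorm_hyperbolic_sum_le hq hi (τ := τ) (N - h w - ∑ l ∈ P, v l)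
    (Finset.Subset.refl (cell n Q μ b)) (fun ρ => f w (v + ρ)) ?_ ?_ ?_).trans ?_
  · intro ρ h1
    exact ((hf.lvl w hw _ (hS.add_mem hv (hρ ρ h1))).mono hS.right_subset).congr fun l hl =>
      hS.add_right ρ hv hl
  · exact fun ρ h1 => hf.bdd w hw _ (hS.add_mem hv (hρ ρ h1))
  · intro ρ h1 h0
    have h2 := (hf.supp w hw _ (hS.add_mem hv (hρ ρ h1)) h0).1
    rw [hS.sum_add hv (hρ ρ h1)] at h2
    omega
  · gcongr with l
    exact_mod_cast card_block_le _ _ _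

lemma sum_le_of_cell {S : Finset ι} {b ρ ρ' : ι → ℕ} (hρ : ρ ∈ cell n S μ b)
    (hρ' : ρ' ∈ cell n S μ b) : ∑ l ∈ S, ρ l ≤ ∑ l ∈ S, ρ' l + ∑ l ∈ S, 2 ^ μ l := by
  rw [← Finset.sum_add_distrib]
  exact Finset.sum_le_sum fun l hl =>
    block_close ((mem_boxOn.1 hρ).1 l hl) ((mem_boxOn.1 hρ').1 l hl)

/-- Fix all coordinates of `v + z` except `i`. Then `v` and the blocks in the other coordinates of
`Q` are known, and a nonvanishing term `ρ` of the fiber has a prescribed coordinate sum. This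
confines `ρ i` to a window of order `2 ^ μ i`, the largest block length in `Q`, and `z i` lies in
the half block adjacent to that of `ρ i`. -/
lemma fiber_count (hS : Split E P Q) (hf : Fam τ E n W h M c₀ N f) {w : ι → ℕ} (hw : w ∈ W)
    {γ : Type*} (J : Finset γ) (c v z : γ → ι → ℕ)
    (hinj : ∀ i ∈ J, ∀ j ∈ J, (∀ l ∈ E, (v i + z i) l = (v j + z j) l) → i = j)
    (hv : ∀ j ∈ J, v j ∈ cell n P μ (halfIndex P (c j)))
    (hz : ∀ j ∈ J, z j ∈ cell n Q μ (halfIndex Q (c j)))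
    (hne : ∀ j ∈ J, fiber n Q μ (halfIndex P (c j)) f w (v j) ≠ 0)
    {i : ι} (hi : i ∈ Q) (hmax : ∀ l ∈ Q, μ l ≤ μ i) :
    J.card ≤ (E.card + 2) * 2 ^ μ i * n ^ (E.card - 1) := by
  classical
  have hv' := fun j hj => cell_subset_cube _ _ _ _ (hv j hj)
  have hz' := fun j hj => cell_subset_cube _ _ _ _ (hz j hj)
  rw [← Finset.card_image_of_injOn (f := fun j => v j + z j) fun j hj j' hj' e =>
    hinj j hj j' hj' fun l _ => congrFun e l]
  refine (card_le_of_window (hS.right_subset hi) (t := fun _ => Finset.range n)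
    (L := (E.card + 1) * 2 ^ μ i) ?_ ?_).trans ?_
  · intro u hu
    obtain ⟨j, hj, rfl⟩ := Finset.mem_image.1 hu
    exact hS.add_mem (hv' j hj) (hz' j hj)
  · intro u hu u' hu' huu
    obtain ⟨j, hj, rfl⟩ := Finset.mem_image.1 hu
    obtain ⟨j', hj', rfl⟩ := Finset.mem_image.1 hu'
    obtain ⟨ρ, hρ, h0⟩ := exists_of_fiber_ne_zero (hne j hj)
    obtain ⟨ρ', hρ', h0'⟩ := exists_of_fiber_ne_zero (hne j' hj')
    have hρc := cell_subset_cube _ _ _ _ hρ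
    have hρc' := cell_subset_cube _ _ _ _ hρ'
    have hvv : v j = v j' := by
      refine boxOn_ext (hv' j hj) (hv' j' hj') fun l hl => ?_
      have hli : l ≠ i := fun e => Finset.disjoint_left.1 hS.disj hl (e ▸ hi)
      have := huu l (hS.left_subset hl) hli
      rwa [hS.add_left _ (hz' j hj) hl, hS.add_left _ (hz' j' hj') hl] at this
    have hs := (hf.supp w hw _ (hS.add_mem (hv' j hj) hρc) h0).1
    have hs' := (hf.supp w hw _ (hS.add_mem (hv' j' hj') hρc') h0').1
    rw [hS.sum_add (hv' j hj) hρc, ← Finset.add_sum_erase _ _ hi] at hs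
    rw [hS.sum_add (hv' j' hj') hρc', ← Finset.add_sum_erase _ _ hi, ← hvv] at hs'
    have hclose : ∑ l ∈ Q.erase i, ρ' l ≤ ∑ l ∈ Q.erase i, ρ l + ∑ l ∈ Q.erase i, 2 ^ μ l := by
      rw [← Finset.sum_add_distrib]
      refine Finset.sum_le_sum fun l hl => ?_
      have hlQ := Finset.mem_of_mem_erase hl
      have e := huu l (hS.right_subset hlQ) (Finset.ne_of_mem_erase hl)
      rw [hS.add_right _ (hv' j hj) hlQ, hS.add_right _ (hv' j' hj') hlQ] at e
      have h1 := (mem_cell.1 (hz j hj)).2 l hlQ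
      have h2 := (mem_cell.1 (hz j' hj')).2 l hlQ
      rw [e, h2] at h1
      have hcl : halfIndex P (c j) l = halfIndex P (c j') l := by
        simp only [halfIndex, hlQ, if_true] at h1 ⊢
        omega
      have hb := (mem_boxOn.1 hρ).1 l hlQ
      rw [hcl] at hb
      exact block_close ((mem_boxOn.1 hρ').1 l hlQ) hb
    have hsum : ∑ l ∈ Q.erase i, 2 ^ μ l ≤ (Q.card - 1) * 2 ^ μ i := by
      rw [← Finset.card_erase_of_mem hi, ← smul_eq_mul]
      exact Finset.sum_le_card_nsmul _ _ _ fun l hl =>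
        Nat.pow_le_pow_right (by norm_num) (hmax l (Finset.mem_of_mem_erase hl))
    have h3 := (cell_lt hS (hz j hj) hρ hi).2
    have h4 := (cell_lt hS (hz j' hj') hρ' hi).1
    have h5 : (Q.card - 1 + 2) * 2 ^ μ i ≤ (E.card + 1) * 2 ^ μ i := by
      have := Finset.card_le_card hS.right_subset
      have : 0 < Q.card := Finset.card_pos.2 ⟨i, hi⟩
      exact Nat.mul_le_mul_right _ (by omega)
    rw [add_mul] at h5
    rw [hS.add_right _ (hv' j hj) hi, hS.add_right _ (hv' j' hj') hi]
    omega
  · have h1 : 1 ≤ 2 ^ μ i := Nat.one_le_two_pow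
    simp only [Finset.card_range, Finset.prod_const]
    rw [Finset.card_erase_of_mem (hS.right_subset hi)]
    gcongr
    nlinarith

end Fibers

lemma card_le_of_height {α : Type*} {h : α → ℕ} {A : Finset α} (hinj : Set.InjOn h A) {L : ℕ}
    (hL : ∀ w ∈ A, ∀ w' ∈ A, h w ≤ h w' + L) : A.card ≤ L + 1 := by
  rcases A.eq_empty_or_nonempty with rfl | hA
  · simp
  obtain ⟨y, hy, hmin⟩ := A.exists_min_image h hA
  have : A.card ≤ (Finset.Icc (h y) (h y + L)).card :=
    Finset.card_le_card_of_injOn h (fun x hx => Finset.mem_Icc.2 ⟨hmin x hx, hL x hx y hy⟩) hinj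
  simpa [add_assoc] using this

/-- Given the first member, the height of the second is known up to an error `L` on either side, and
heights are injective. -/
lemma card_pairs_le {α : Type*} [DecidableEq α] {h : α → ℕ} {W : Finset α}
    (hinj : Set.InjOn h W) {R : Finset (α × α)} (hR : R ⊆ W ×ˢ W) {L : ℕ}
    (hL : ∀ p ∈ R, h p.1 ≤ h p.2 + L ∧ h p.2 ≤ h p.1 + L) :
    R.card ≤ (2 * L + 1) * (R.image Prod.fst).card := by
  refine Finset.card_le_mul_card_image R _ fun w _ => ?_
  rw [← Finset.card_image_of_injOn (f := Prod.snd)]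
  · have hmem : ∀ w' ∈ ((R.filter fun p => p.1 = w).image Prod.snd), (w, w') ∈ R := by
      intro w' hw'
      obtain ⟨p, hp, rfl⟩ := Finset.mem_image.1 hw'
      obtain ⟨hpR, rfl⟩ := Finset.mem_filter.1 hp
      exact hpR
    refine card_le_of_height (h := h) (hinj.mono fun w' hw' => ?_) fun w₁ h₁ w₂ h₂ => ?_
    · exact (Finset.mem_product.1 (hR (hmem w' hw'))).2
    · have e1 := hL _ (hmem w₁ h₁)
      have e2 := hL _ (hmem w₂ h₂)
      simp only at e1 e2
      omega
  · intro p hp p' hp' e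
    exact Prod.ext ((Finset.mem_filter.1 hp).2.trans (Finset.mem_filter.1 hp').2.symm) e

end BeckGain

namespace BeckGain

variable {ι : Type} [Fintype ι] [DecidableEq ι]

lemma Split.sum_cell {E P Q : Finset ι} (hS : Split E P Q) {A : Type*} [AddCommMonoid A] {n : ℕ}
    (μ b : ι → ℕ) (F : (ι → ℕ) → A) :
    ∑ r ∈ cell n E μ b, F r = ∑ v ∈ cell n P μ b, ∑ z ∈ cell n Q μ b, F (v + z) := by
  rw [cell, ← hS.union, sum_boxOn_union hS.disj]
  rfl

lemma Split.erase {P : Finset ι} {j : ι} (hj : j ∈ P) : Split P (P.erase j) {j} :=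
  ⟨by simp, by rw [Finset.union_comm, ← Finset.insert_eq, Finset.insert_erase hj]⟩

section Scale

variable {Ω : Type} {τ : ι → ℕ → Equiv.Perm Ω} {E P Q : Finset ι} {n : ℕ}
  {W : Finset (ι → ℕ)} {h : (ι → ℕ) → ℕ} {M c₀ μ : ι → ℕ} {N N' a k : ℕ}
  {f g : (ι → ℕ) → (ι → ℕ) → Ω → ℝ}

/-! ### The off-diagonal terms -/

/-- Prepares the induction: with `w` and all of `v` except its coordinate `j` frozen, that
coordinate becomes the new index, being its own height, and the blocks become those of scale `μ`. -/
lemma Fam.slice (hS : Split E P Q) (hf : Fam τ E n W h M c₀ N f) {w b β : ι → ℕ} (hw : w ∈ W)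
    {j : ι} (hj : j ∈ P) (hβ : β ∈ cube n (P.erase j)) :
    Fam τ Q n (cell n {j} μ b) (fun t => t j) μ b (N - h w - ∑ l ∈ P.erase j, β l)
      fun t ρ x => if ρ ∈ cell n Q μ b then f w (β + t + ρ) x else 0 := by
  have hP := Split.erase hj
  have hβt : ∀ t ∈ cell n {j} μ b, β + t ∈ cube n P := fun t ht =>
    hP.add_mem hβ (cell_subset_cube _ _ _ _ ht)
  refine ⟨fun t ht ρ hρ => ?_, fun t ht ρ hρ x => ?_, fun t ht ρ hρ h0 => ?_⟩
  · by_cases hρc : ρ ∈ cell n Q μ b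
    · simp only [hρc, if_true]
      exact ((hf.lvl w hw _ (hS.add_mem (hβt t ht) hρ)).mono hS.right_subset).congr fun l hl =>
        hS.add_right ρ (hβt t ht) hl
    · simp only [hρc, if_false]
      exact fun l _ => ⟨fun x => by simp, fun t _ x => rfl⟩
  · by_cases hρc : ρ ∈ cell n Q μ b
    · simpa only [hρc, if_true] using hf.bdd w hw _ (hS.add_mem (hβt t ht) hρ) x
    · simp [hρc]
  · by_cases hρc : ρ ∈ cell n Q μ b
    · simp only [hρc, if_true] at h0
      have h1 := (hf.supp w hw _ (hS.add_mem (hβt t ht) hρ) h0).1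
      rw [hS.sum_add (hβt t ht) hρ, hP.sum_add hβ (cell_subset_cube _ _ _ _ ht),
        Finset.sum_singleton] at h1
      exact ⟨by omega, (mem_cell.1 hρc).2⟩
    · simp only [hρc, if_false] at h0
      exact absurd rfl h0

/-- Here the induction hypothesis enters. Expanding the two fibers gives a bilinear sum over `Q`,
indexed by the coordinate `j` of `v`; the remaining coordinates of `v` are summed by the triangle
inequality. -/
lemma off_factor [Fintype Ω] {e : ℕ} {C : ℝ} (hFull : FullBound ι e C) (hk : 2 ≤ k)
    (hS : Split E P Q) (hQ : Q.Nonempty) (hQe : Q.card ≤ e) (hf : Fam τ E n W h M c₀ N f)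
    (hμ : ∀ l ∈ E, 2 ^ μ l ≤ n) (hinj : Set.InjOn h W) {w w' : ι → ℕ} (hw : w ∈ W) (hw' : w' ∈ W)
    (hne : w ≠ w') (b : ι → ℕ) {j : ι} (hj : j ∈ P) (hC : 0 ≤ C) :
    mnorm (2 * k) (fun x => ∑ v ∈ cell n P μ b, fiber n Q μ b f w v x * fiber n Q μ b f w' v x) ^ 4
      ≤ (∏ l ∈ P.erase j, (2 : ℝ) ^ μ l) ^ 4 * (C * bnd k n (2 ^ μ j) Q μ) := by
  have hP := Split.erase hj
  simp only [hP.sum_cell]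
  have h3 := bnd_nonneg k n (2 ^ μ j) Q μ
  refine (mnorm_sum_pow_le (by omega) _ _ (T := C * bnd k n (2 ^ μ j) Q μ) fun β hβ => ?_).trans ?_
  swap
  · gcongr
    exact_mod_cast card_cell_le n (P.erase j) μ b
  have hβ' := cell_subset_cube _ _ _ _ hβ
  have hset : Setting Q n (cell n {j} μ b) (fun t => t j) μ (2 ^ μ j) k := by
    refine ⟨hk, fun t ht t' ht' e => ?_, ?_, hμ j (hS.left_subset hj),
      fun l hl => hμ l (hS.right_subset hl)⟩
    · exact boxOn_ext ht ht' fun l hl => by rw [Finset.mem_singleton.1 hl]; exact e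
    · simpa using card_cell_le n {j} μ b
  refine le_of_eq_of_le ?_ (hFull Ω τ Q n (cell n {j} μ b) (fun t => t j) μ b _ _ (2 ^ μ j) k
    _ _ hQ hQe hset (hf.slice hS hw hj hβ') (hf.slice hS hw' hj hβ'))
  congr 2
  funext x
  refine Finset.sum_congr rfl fun t ht => ?_
  have hβt : β + t ∈ cube n P := hP.add_mem hβ' (cell_subset_cube _ _ _ _ ht)
  have hfib : ∀ w, fiber n Q μ b f w (β + t) x
      = ∑ ρ ∈ cube n Q, if ρ ∈ cell n Q μ b then f w (β + t + ρ) x else 0 := fun w => by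
    rw [← Finset.sum_filter, Finset.filter_mem_eq_inter,
      Finset.inter_eq_right.2 (cell_subset_cube _ _ _ _)]
    rfl
  rw [hfib, hfib, Finset.sum_mul_sum]
  refine Finset.sum_congr rfl fun ρ hρ => Finset.sum_congr rfl fun ρ' _ => ?_
  -- Pairs with `ρ = ρ'` do not contribute: two nonzero factors would force `h w = h w'`, contrary
  -- to `w ≠ w'`. So only the pairs admitted in `FullBound` remain.
  by_cases hρρ : ρ = ρ'
  · subst hρρ
    rw [if_neg (show ¬ρ ≠ ρ from fun h => h rfl)]
    by_cases hρc : ρ ∈ cell n Q μ b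
    · simp only [hρc, if_true]
      by_contra h0
      have hr := hS.add_mem hβt hρ
      have h1 := (hf.supp w hw _ hr fun e => h0 (by rw [e]; simp)).1
      have h2 := (hf.supp w' hw' _ hr fun e => h0 (by rw [e]; simp)).1
      exact hne (hinj hw hw' (by omega))
    · simp [hρc]
  · rw [if_pos hρρ]

/-- The total exponent is the same for both fibers, and their `Q` parts lie in one common cell. -/
lemma fiber_height (hS : Split E P Q) (hf : Fam τ E n W h M c₀ N f) {w w' v v' b : ι → ℕ}
    (hw : w ∈ W) (hw' : w' ∈ W) (hv : v ∈ cube n P) (hv' : v' ∈ cube n P)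
    (h0 : fiber n Q μ b f w v ≠ 0) (h0' : fiber n Q μ b f w' v' ≠ 0) :
    h w + ∑ l ∈ P, v l ≤ h w' + ∑ l ∈ P, v' l + ∑ l ∈ Q, 2 ^ μ l := by
  obtain ⟨ρ, hρ, h1⟩ := exists_of_fiber_ne_zero h0
  obtain ⟨ρ', hρ', h1'⟩ := exists_of_fiber_ne_zero h0'
  have hρc := cell_subset_cube _ _ _ _ hρ
  have hρc' := cell_subset_cube _ _ _ _ hρ'
  have h2 := (hf.supp w hw _ (hS.add_mem hv hρc) h1).1
  have h2' := (hf.supp w' hw' _ (hS.add_mem hv' hρc') h1').1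
  rw [hS.sum_add hv hρc] at h2
  rw [hS.sum_add hv' hρc'] at h2'
  have := sum_le_of_cell hρ' hρ
  omega

lemma sum_two_pow_le {S : Finset ι} {i : ι} (hmax : ∀ l ∈ S, μ l ≤ μ i) :
    ∑ l ∈ S, 2 ^ μ l ≤ S.card * 2 ^ μ i := by
  rw [← smul_eq_mul]
  exact Finset.sum_le_card_nsmul _ _ _ fun l hl => Nat.pow_le_pow_right (by norm_num) (hmax l hl)

/-- Nonvanishing fibers of `f` force `h w` and `h w'` to be within order `2 ^ μ i`, those of `g`
within order `2 ^ μ j`. Moreover, as `c` is fixed, all first members have heights in one window of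
the order of the larger of the two lengths. -/
lemma off_count (hS : Split E P Q) (hf : Fam τ E n W h M c₀ N f) (hg : Fam τ E n W h M c₀ N' g)
    (hset : Setting E n W h M a k) (c : ι → ℕ) {R : Finset ((ι → ℕ) × (ι → ℕ))}
    (hR : R ⊆ W ×ˢ W)
    (hRf : ∀ p ∈ R, ∃ v ∈ cell n P μ (halfIndex P c),
      fiber n Q μ (halfIndex P c) f p.1 v ≠ 0 ∧ fiber n Q μ (halfIndex P c) f p.2 v ≠ 0)
    (hRg : ∀ p ∈ R, ∃ z ∈ cell n Q μ (halfIndex Q c),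
      fiber n P μ (halfIndex Q c) g p.1 z ≠ 0 ∧ fiber n P μ (halfIndex Q c) g p.2 z ≠ 0)
    {i j : ι} (hi : ∀ l ∈ Q, μ l ≤ μ i) (hj : ∀ l ∈ P, μ l ≤ μ j) :
    (R.card : ℝ) ^ 4 ≤ (2 * (E.card : ℝ) + 1) ^ 6 * (a : ℝ) ^ 2
      * ((2 : ℝ) ^ μ i * 2 ^ μ j) ^ 3 := by
  have hmem : ∀ p ∈ R, p.1 ∈ W ∧ p.2 ∈ W := fun p hp => Finset.mem_product.1 (hR hp)
  have hcard := hS.card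
  have hsQ := sum_two_pow_le hi
  have hsP := sum_two_pow_le hj
  have hf1 : ∀ p ∈ R, h p.1 ≤ h p.2 + Q.card * 2 ^ μ i ∧ h p.2 ≤ h p.1 + Q.card * 2 ^ μ i := by
    intro p hp
    obtain ⟨v, hv, h0, h0'⟩ := hRf p hp
    have hv := cell_subset_cube _ _ _ _ hv
    have h1 := fiber_height hS hf (hmem p hp).1 (hmem p hp).2 hv hv h0 h0'
    have h2 := fiber_height hS hf (hmem p hp).2 (hmem p hp).1 hv hv h0' h0
    omega
  have hg1 : ∀ p ∈ R, h p.1 ≤ h p.2 + P.card * 2 ^ μ j ∧ h p.2 ≤ h p.1 + P.card * 2 ^ μ j := by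
    intro p hp
    obtain ⟨v, hv, h0, h0'⟩ := hRg p hp
    have hv := cell_subset_cube _ _ _ _ hv
    have h1 := fiber_height hS.symm hg (hmem p hp).1 (hmem p hp).2 hv hv h0 h0'
    have h2 := fiber_height hS.symm hg (hmem p hp).2 (hmem p hp).1 hv hv h0' h0
    omega
  have himg : R.image Prod.fst ⊆ W := fun w hw => by
    obtain ⟨p, hp, rfl⟩ := Finset.mem_image.1 hw
    exact (hmem p hp).1
  have hfst : (R.image Prod.fst).card ≤ (P.card * 2 ^ μ j + Q.card * 2 ^ μ i) + 1 := by
    refine card_le_of_height (hset.inj.mono himg) fun w hw w' hw' => ?_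
    obtain ⟨p, hp, rfl⟩ := Finset.mem_image.1 hw
    obtain ⟨p', hp', rfl⟩ := Finset.mem_image.1 hw'
    obtain ⟨v, hv, h0, -⟩ := hRf p hp
    obtain ⟨v', hv', h0', -⟩ := hRf p' hp'
    have h1 := fiber_height hS hf (hmem p hp).1 (hmem p' hp').1 (cell_subset_cube _ _ _ _ hv)
      (cell_subset_cube _ _ _ _ hv') h0 h0'
    have h2 := sum_le_of_cell hv' hv
    omega
  have hfst' : (R.image Prod.fst).card ≤ a := (Finset.card_le_card himg).trans hset.card_le
  have hc1 := card_pairs_le hset.inj hR hf1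
  have hc2 := card_pairs_le hset.inj hR hg1
  set κ := 2 * E.card + 1 with hκ
  set yi := 2 ^ μ i with hyi
  set yj := 2 ^ μ j with hyj
  have hyi1 : 1 ≤ yi := Nat.one_le_two_pow
  have hyj1 : 1 ≤ yj := Nat.one_le_two_pow
  have hb1 : 2 * (Q.card * yi) + 1 ≤ κ * yi := by
    rw [hκ, hcard]; nlinarith [Nat.zero_le (P.card * yi)]
  have hb2 : 2 * (P.card * yj) + 1 ≤ κ * yj := by
    rw [hκ, hcard]; nlinarith [Nat.zero_le (Q.card * yj)]
  have hb3 : P.card * yj + Q.card * yi + 1 ≤ κ * max yi yj := by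
    have e1 := Nat.mul_le_mul_left P.card (le_max_right yi yj)
    have e2 := Nat.mul_le_mul_left Q.card (le_max_left yi yj)
    have e3 : 1 ≤ max yi yj := hyi1.trans (le_max_left _ _)
    rw [hκ, hcard]
    nlinarith [Nat.zero_le (P.card * max yi yj), Nat.zero_le (Q.card * max yi yj)]
  have hr1 : R.card ≤ κ * yi * a := hc1.trans (Nat.mul_le_mul hb1 hfst')
  have hr2 : R.card ≤ κ * yj * a := hc2.trans (Nat.mul_le_mul hb2 hfst')
  have hr3 : R.card ≤ κ ^ 2 * (yi * yj) := by
    rcases le_total yi yj with hle | hle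
    · rw [max_eq_right hle] at hb3
      calc R.card ≤ (κ * yi) * (κ * yj) := hc1.trans (Nat.mul_le_mul hb1 (hfst.trans hb3))
        _ = _ := by ring
    · rw [max_eq_left hle] at hb3
      calc R.card ≤ (κ * yj) * (κ * yi) := hc2.trans (Nat.mul_le_mul hb2 (hfst.trans hb3))
        _ = _ := by ring
  -- The fourth power uses each of the bounds `hr1`, `hr2` once and `hr3` twice.
  have hN : R.card ^ 4 ≤ κ ^ 6 * a ^ 2 * (yi * yj) ^ 3 := by
    calc R.card ^ 4 = R.card * R.card * (R.card * R.card) := by ring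
      _ ≤ (κ * yi * a) * (κ * yj * a) * ((κ ^ 2 * (yi * yj)) * (κ ^ 2 * (yi * yj))) := by gcongr
      _ = _ := by ring
  exact_mod_cast hN

/-! ### The diagonal terms -/

/-- For fixed `w`, the number of nonzero terms is bounded through either fiber; the product of the
two counts yields `2 ^ μ i * 2 ^ μ j`. Each term is estimated by Cauchy–Schwarz and hyperbolic sums
in L^(4k), whence the constant 256 = 2 · 128. -/
lemma diag_bound [Fintype Ω] (hS : Split E P Q) (hf : Fam τ E n W h M c₀ N f)
    (hg : Fam τ E n W h M c₀ N' g) (hset : Setting E n W h M a k)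
    {γ : Type*} (J : Finset γ) (c v z : γ → ι → ℕ)
    (hinj : ∀ i ∈ J, ∀ j ∈ J, (∀ l ∈ E, (v i + z i) l = (v j + z j) l) → i = j)
    (hv : ∀ j ∈ J, v j ∈ cell n P μ (halfIndex P (c j)))
    (hz : ∀ j ∈ J, z j ∈ cell n Q μ (halfIndex Q (c j)))
    {i j : ι} (hi : i ∈ Q) (hmi : ∀ l ∈ Q, μ l ≤ μ i) (hj : j ∈ P) (hmj : ∀ l ∈ P, μ l ≤ μ j) :
    (∑ w ∈ W, ∑ m ∈ J, mnorm k (fun x => (fiber n Q μ (halfIndex P (c m)) f w (v m) x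
        * fiber n P μ (halfIndex Q (c m)) g w (z m) x) ^ 2)) ^ 2
      ≤ ((a : ℝ) * (E.card + 2) * (n : ℝ) ^ (E.card - 1)) ^ 2 * ((2 : ℝ) ^ μ i * 2 ^ μ j)
        * ((256 * (k : ℝ)) ^ (E.card - 2)
          * ((∏ l ∈ P.erase j, (2 : ℝ) ^ μ l) * ∏ l ∈ Q.erase i, (2 : ℝ) ^ μ l)) ^ 2 := by
  classical
  have hk := hset.two_le
  set Z : ℝ := (256 * (k : ℝ)) ^ (E.card - 2)
    * ((∏ l ∈ P.erase j, (2 : ℝ) ^ μ l) * ∏ l ∈ Q.erase i, (2 : ℝ) ^ μ l) with hZ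
  have hZ0 : 0 ≤ Z := by positivity
  set A : (ι → ℕ) → γ → Ω → ℝ := fun w m => fiber n Q μ (halfIndex P (c m)) f w (v m) with hA
  set B : (ι → ℕ) → γ → Ω → ℝ := fun w m => fiber n P μ (halfIndex Q (c m)) g w (z m) with hB
  have hterm : ∀ w ∈ W, ∀ m ∈ J, mnorm k (fun x => (A w m x * B w m x) ^ 2) ≤ Z := by
    intro w hw m hm
    have h1 := fiber_norm (μ := μ) (b := halfIndex P (c m)) hS hf hw
      (cell_subset_cube _ _ _ _ (hv m hm)) hi (q := 2 * k) (by omega)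
    have h2 := fiber_norm (μ := μ) (b := halfIndex Q (c m)) hS.symm hg hw
      (cell_subset_cube _ _ _ _ (hz m hm)) hj (q := 2 * k) (by omega)
    simp only [mul_pow]
    refine (mnorm_mul_le (by omega) _ _).trans ?_
    rw [mnorm_sq (by omega), mnorm_sq (by omega)]
    calc _ ≤ _ := mul_le_mul h1 h2 (sq_nonneg _) (by positivity)
      _ = Z := by
        have e1 : E.card - 2 = (Q.card - 1) + (P.card - 1) := by
          have := hS.card
          have : 0 < P.card := Finset.card_pos.2 ⟨j, hj⟩
          have : 0 < Q.card := Finset.card_pos.2 ⟨i, hi⟩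
          omega
        rw [hZ, e1, pow_add]
        push_cast
        ring
  have hw2 : ∀ w ∈ W, (∑ m ∈ J, mnorm k (fun x => (A w m x * B w m x) ^ 2)) ^ 2
      ≤ ((E.card + 2 : ℝ) * (n : ℝ) ^ (E.card - 1)) ^ 2 * ((2 : ℝ) ^ μ i * 2 ^ μ j) * Z ^ 2 := by
    intro w hw
    set J' := J.filter fun m => A w m ≠ 0 ∧ B w m ≠ 0 with hJ'
    have hsub : ∑ m ∈ J, mnorm k (fun x => (A w m x * B w m x) ^ 2)
        = ∑ m ∈ J', mnorm k (fun x => (A w m x * B w m x) ^ 2) := by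
      symm
      refine Finset.sum_subset (Finset.filter_subset _ _) fun m hm hm' => ?_
      have h0 : A w m = 0 ∨ B w m = 0 := by
        by_contra! h0
        exact hm' (Finset.mem_filter.2 ⟨hm, h0⟩)
      have : (fun x => (A w m x * B w m x) ^ 2) = fun _ => 0 := by
        funext x
        rcases h0 with h0 | h0 <;> simp [h0]
      rw [this, mnorm_zero (by omega)]
    have hJm : ∀ m ∈ J', m ∈ J := fun m hm => (Finset.mem_filter.1 hm).1
    have hc1 := fiber_count hS hf hw J' c v z
      (fun i hi j hj => hinj i (hJm i hi) j (hJm j hj)) (fun m hm => hv m (hJm m hm))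
      (fun m hm => hz m (hJm m hm)) (fun m hm => (Finset.mem_filter.1 hm).2.1) hi hmi
    have hc2 := fiber_count hS.symm hg hw J' c z v
      (fun i hi j hj e => hinj i (hJm i hi) j (hJm j hj) (by simpa only [add_comm] using e))
      (fun m hm => hz m (hJm m hm))
      (fun m hm => hv m (hJm m hm)) (fun m hm => (Finset.mem_filter.1 hm).2.2) hj hmj
    have hc1' : (J'.card : ℝ) ≤ (E.card + 2) * 2 ^ μ i * (n : ℝ) ^ (E.card - 1) := by
      exact_mod_cast hc1
    have hc2' : (J'.card : ℝ) ≤ (E.card + 2) * 2 ^ μ j * (n : ℝ) ^ (E.card - 1) := by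
      exact_mod_cast hc2
    have hle : ∑ m ∈ J', mnorm k (fun x => (A w m x * B w m x) ^ 2) ≤ J'.card * Z := by
      simpa using Finset.sum_le_sum fun m hm => hterm w hw m (hJm m hm)
    have h0 : 0 ≤ ∑ m ∈ J', mnorm k (fun x => (A w m x * B w m x) ^ 2) :=
      Finset.sum_nonneg fun _ _ => mnorm_nonneg _ _
    rw [hsub]
    calc _ ≤ (J'.card * Z) ^ 2 := by gcongr
      _ = (J'.card * J'.card : ℝ) * Z ^ 2 := by ring
      _ ≤ (((E.card + 2) * 2 ^ μ i * (n : ℝ) ^ (E.card - 1))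
          * ((E.card + 2) * 2 ^ μ j * (n : ℝ) ^ (E.card - 1))) * Z ^ 2 := by gcongr
      _ = _ := by ring
  have hcW : (W.card : ℝ) ≤ a := by exact_mod_cast hset.card_le
  have hs : ∑ w ∈ W, (∑ m ∈ J, mnorm k (fun x => (A w m x * B w m x) ^ 2)) ^ 2
      ≤ W.card * (((E.card + 2 : ℝ) * (n : ℝ) ^ (E.card - 1)) ^ 2
        * ((2 : ℝ) ^ μ i * 2 ^ μ j) * Z ^ 2) := by
    simpa using Finset.sum_le_sum hw2
  calc _ ≤ (W.card : ℝ) * ∑ w ∈ W, (∑ m ∈ J, mnorm k (fun x => (A w m x * B w m x) ^ 2)) ^ 2 :=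
        sq_sum_le_card_mul_sum_sq
    _ ≤ (a : ℝ) * (a * (((E.card + 2 : ℝ) * (n : ℝ) ^ (E.card - 1)) ^ 2
        * ((2 : ℝ) ^ μ i * 2 ^ μ j) * Z ^ 2)) := by
        have h0 : 0 ≤ ∑ w ∈ W, (∑ m ∈ J, mnorm k (fun x => (A w m x * B w m x) ^ 2)) ^ 2 :=
          Finset.sum_nonneg fun _ _ => sq_nonneg _
        refine mul_le_mul hcW (hs.trans ?_) h0 (by positivity)
        gcongr
    _ = _ := by ring

end Scale

end BeckGain

namespace BeckGain

variable {ι : Type} [Fintype ι] [DecidableEq ι]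

/-! ### The contribution of a fixed scale -/

/-- Real-number bookkeeping for `scale_bound`. `Φ` stands for the squared norm, `S₁` and `S₂` for
the diagonal and off-diagonal parts, `cb` for the number of blocks; `Y` and `X` are the block
volumes at scales `μ` and `M`. The point is to keep one factor `Y` unspent: it is the gain over `X`.
-/
lemma scale_arith {k n a e κ C cb X yi yj R₁ R₂ S₁ S₂ Φ : ℝ} (p q : ℕ) (hk : 1 ≤ k) (hn : 0 ≤ n)
    (ha : 0 ≤ a) (han : a ≤ n) (he : 0 ≤ e) (hcb : 0 ≤ cb)
    (hyi : 0 ≤ yi) (hyj : 0 ≤ yj) (hR₁ : 0 ≤ R₁) (hR₂ : 0 ≤ R₂) (hS₁ : 0 ≤ S₁) (hS₂ : 0 ≤ S₂)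
    (hΦ : 0 ≤ Φ)
    (h₁ : S₁ ^ 2 ≤ (a * (e + 2) * n ^ (p + q + 1)) ^ 2 * (yi * yj)
      * ((256 * k) ^ (p + q) * (R₁ * R₂)) ^ 2)
    (h₂ : S₂ ^ 4 ≤ cb ^ 4 * (κ ^ 6 * a ^ 2 * (yi * yj) ^ 3
      * ((R₁ ^ 4 * (C * (k ^ (4 * q + 2) * n ^ (3 * q) * yj * (yi * R₂))))
        * (R₂ ^ 4 * (C * (k ^ (4 * p + 2) * n ^ (3 * p) * yi * (yj * R₁)))))))
    (hcX : cb * (yi * yj * R₁ * R₂) ≤ X) (hYX : yi * yj * R₁ * R₂ ≤ X)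
    (hX : X ≤ n ^ (p + q + 2)) (hR : R₁ * R₂ ≤ n ^ (p + q))
    (h : Φ ≤ (128 * k) ^ (p + q + 2) * (S₁ + S₂)) :
    Φ ^ 4 ≤ 128 ^ (4 * (p + q + 2)) * (8 * ((e + 2) ^ 4 * 256 ^ (4 * (p + q)) + κ ^ 6 * C ^ 2))
      * (k ^ (8 * (p + q) + 12) * n ^ (6 * (p + q) + 6) * a ^ 2 * X * (yi * yj * R₁ * R₂)) := by
  set Y := yi * yj * R₁ * R₂ with hY
  have hY0 : 0 ≤ Y := by positivity
  have hX0 : 0 ≤ X := hY0.trans hYX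
  have hk0 : 0 ≤ k := by linarith
  have e1 : S₁ ^ 4 ≤ (e + 2) ^ 4 * 256 ^ (4 * (p + q))
      * (k ^ (4 * (p + q) + 4) * n ^ (6 * (p + q) + 6) * a ^ 2 * X * Y) := by
    calc S₁ ^ 4 = (S₁ ^ 2) ^ 2 := by ring
      _ ≤ ((a * (e + 2) * n ^ (p + q + 1)) ^ 2 * (yi * yj)
          * ((256 * k) ^ (p + q) * (R₁ * R₂)) ^ 2) ^ 2 := by gcongr
      _ = (e + 2) ^ 4 * 256 ^ (4 * (p + q)) * (k ^ (4 * (p + q)) * n ^ (4 * (p + q) + 4)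
          * (a ^ 2 * a ^ 2) * (Y * Y) * (R₁ * R₂) ^ 2) := by
          rw [hY, mul_pow 256 k]; ring
      _ ≤ (e + 2) ^ 4 * 256 ^ (4 * (p + q)) * (k ^ (4 * (p + q) + 4) * n ^ (4 * (p + q) + 4)
          * (a ^ 2 * n ^ 2) * (X * Y) * (n ^ (p + q)) ^ 2) := by
          have : k ^ (4 * (p + q)) ≤ k ^ (4 * (p + q) + 4) := pow_le_pow_right₀ hk (by omega)
          gcongr
      _ = _ := by ring
  have e2 : S₂ ^ 4 ≤ κ ^ 6 * C ^ 2
      * (k ^ (4 * (p + q) + 4) * n ^ (6 * (p + q) + 6) * a ^ 2 * X * Y) := by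
    refine h₂.trans ?_
    -- The block count enters only through `cb * Y ≤ X`: one of four such factors is kept as `X`,
    -- three are spent as powers of `n`, and a separate `Y` survives.
    calc _ = κ ^ 6 * C ^ 2 * (k ^ (4 * (p + q) + 4) * n ^ (3 * (p + q)) * a ^ 2
          * ((cb * Y) * (cb * Y) ^ 3) * Y) := by rw [hY]; ring
      _ ≤ κ ^ 6 * C ^ 2 * (k ^ (4 * (p + q) + 4) * n ^ (3 * (p + q)) * a ^ 2
          * (X * (n ^ (p + q + 2)) ^ 3) * Y) := by
          have := hcX.trans hX
          gcongr
      _ = _ := by ring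
  have e3 : (S₁ + S₂) ^ 4 ≤ 8 * (S₁ ^ 4 + S₂ ^ 4) := by
    have := add_pow_le hS₁ hS₂ 4
    norm_num at this ⊢
    exact this
  calc Φ ^ 4 ≤ ((128 * k) ^ (p + q + 2) * (S₁ + S₂)) ^ 4 := by gcongr
    _ = 128 ^ (4 * (p + q + 2)) * k ^ (4 * (p + q) + 8) * (S₁ + S₂) ^ 4 := by
        rw [mul_pow 128 k]; ring
    _ ≤ 128 ^ (4 * (p + q + 2)) * k ^ (4 * (p + q) + 8) * (8 * ((e + 2) ^ 4 * 256 ^ (4 * (p + q))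
      * (k ^ (4 * (p + q) + 4) * n ^ (6 * (p + q) + 6) * a ^ 2 * X * Y) + κ ^ 6 * C ^ 2
      * (k ^ (4 * (p + q) + 4) * n ^ (6 * (p + q) + 6) * a ^ 2 * X * Y))) := by
        refine mul_le_mul_of_nonneg_left (e3.trans ?_) (by positivity)
        gcongr
    _ = _ := by ring

section Scale

variable {Ω : Type} [Fintype Ω] {τ : ι → ℕ → Equiv.Perm Ω} {E P Q : Finset ι} {n : ℕ}
  {W : Finset (ι → ℕ)} {h : (ι → ℕ) → ℕ} {M c₀ μ : ι → ℕ} {N N' a k : ℕ}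
  {f g : (ι → ℕ) → (ι → ℕ) → Ω → ℝ}

/-- Both factors are treated by induction, one over `Q` and one over `P`; only pairs where both are
nonzero are counted. -/
lemma off_bound {e : ℕ} {C : ℝ} (hFull : FullBound ι e C) (hC : 0 ≤ C) (hS : Split E P Q)
    (hPe : P.card ≤ e) (hQe : Q.card ≤ e)
    (hf : Fam τ E n W h M c₀ N f) (hg : Fam τ E n W h M c₀ N' g) (hset : Setting E n W h M a k)
    (hμ : ∀ l ∈ E, 2 ^ μ l ≤ n)
    {i j : ι} (hi : i ∈ Q) (hmi : ∀ l ∈ Q, μ l ≤ μ i) (hj : j ∈ P) (hmj : ∀ l ∈ P, μ l ≤ μ j)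
    (S : Finset (ι → ℕ)) :
    (∑ c ∈ S, ∑ p ∈ W.offDiag, mnorm k (fun x =>
      (∑ v ∈ cell n P μ (halfIndex P c), fiber n Q μ (halfIndex P c) f p.1 v x
        * fiber n Q μ (halfIndex P c) f p.2 v x)
      * ∑ z ∈ cell n Q μ (halfIndex Q c), fiber n P μ (halfIndex Q c) g p.1 z x
        * fiber n P μ (halfIndex Q c) g p.2 z x)) ^ 4
      ≤ (S.card : ℝ) ^ 4 * ((2 * (E.card : ℝ) + 1) ^ 6 * (a : ℝ) ^ 2
        * ((2 : ℝ) ^ μ i * 2 ^ μ j) ^ 3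
        * (((∏ l ∈ P.erase j, (2 : ℝ) ^ μ l) ^ 4 * (C * bnd k n (2 ^ μ j) Q μ))
          * ((∏ l ∈ Q.erase i, (2 : ℝ) ^ μ l) ^ 4 * (C * bnd k n (2 ^ μ i) P μ)))) := by
  classical
  have hk := hset.two_le
  have hb1 := bnd_nonneg k n (2 ^ μ j) Q μ
  have hb2 := bnd_nonneg k n (2 ^ μ i) P μ
  refine sum_pow_four_le S (fun _ _ => Finset.sum_nonneg fun _ _ => mnorm_nonneg _ _) fun c _ => ?_
  set U : (ι → ℕ) × (ι → ℕ) → Ω → ℝ := fun p x => ∑ v ∈ cell n P μ (halfIndex P c),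
    fiber n Q μ (halfIndex P c) f p.1 v x * fiber n Q μ (halfIndex P c) f p.2 v x with hU
  set V : (ι → ℕ) × (ι → ℕ) → Ω → ℝ := fun p x => ∑ z ∈ cell n Q μ (halfIndex Q c),
    fiber n P μ (halfIndex Q c) g p.1 z x * fiber n P μ (halfIndex Q c) g p.2 z x with hV
  set R := W.offDiag.filter fun p => U p ≠ 0 ∧ V p ≠ 0 with hR
  have hsub : ∑ p ∈ W.offDiag, mnorm k (fun x => U p x * V p x)
      = ∑ p ∈ R, mnorm k (fun x => U p x * V p x) := by
    symm
    refine Finset.sum_subset (Finset.filter_subset _ _) fun p hp hp' => ?_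
    have h0 : U p = 0 ∨ V p = 0 := by
      by_contra! h0
      exact hp' (Finset.mem_filter.2 ⟨hp, h0⟩)
    have : (fun x => U p x * V p x) = fun _ => 0 := by
      funext x
      rcases h0 with h0 | h0 <;> simp [h0]
    rw [this, mnorm_zero (by omega)]
  have hmem : ∀ p ∈ R, p.1 ∈ W ∧ p.2 ∈ W ∧ p.1 ≠ p.2 := fun p hp =>
    Finset.mem_offDiag.1 (Finset.mem_filter.1 hp).1
  have hterm : ∀ p ∈ R, mnorm k (fun x => U p x * V p x) ^ 4
      ≤ ((∏ l ∈ P.erase j, (2 : ℝ) ^ μ l) ^ 4 * (C * bnd k n (2 ^ μ j) Q μ))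
          * ((∏ l ∈ Q.erase i, (2 : ℝ) ^ μ l) ^ 4 * (C * bnd k n (2 ^ μ i) P μ)) := by
    intro p hp
    obtain ⟨h1, h2, h3⟩ := hmem p hp
    have hU4 := off_factor (μ := μ) hFull hk hS ⟨i, hi⟩ hQe hf hμ hset.inj h1 h2 h3
      (halfIndex P c) hj hC
    have hV4 := off_factor (μ := μ) hFull hk hS.symm ⟨j, hj⟩ hPe hg hμ hset.inj h1 h2 h3
      (halfIndex Q c) hi hC
    calc _ ≤ (mnorm (2 * k) (U p) * mnorm (2 * k) (V p)) ^ 4 :=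
          pow_le_pow_left₀ (mnorm_nonneg _ _) (mnorm_mul_le (by omega) _ _) 4
      _ = mnorm (2 * k) (U p) ^ 4 * mnorm (2 * k) (V p) ^ 4 := mul_pow _ _ _
      _ ≤ _ := mul_le_mul hU4 hV4 (pow_nonneg (mnorm_nonneg _ _) _) (by positivity)
  rw [hsub]
  refine (sum_pow_four_le R (fun _ _ => mnorm_nonneg _ _) hterm).trans ?_
  refine mul_le_mul_of_nonneg_right ?_ (by positivity)
  refine off_count hS hf hg hset c (fun p hp => Finset.mem_product.2
    ⟨(hmem p hp).1, (hmem p hp).2.1⟩) (fun p hp => ?_) (fun p hp => ?_) hmi hmj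
  · by_contra! h0
    refine (Finset.mem_filter.1 hp).2.1 (funext fun x => Finset.sum_eq_zero fun v hv => ?_)
    by_cases h1 : fiber n Q μ (halfIndex P c) f p.1 v = 0
    · simp [h1]
    · simp [h0 v hv h1]
  · by_contra! h0
    refine (Finset.mem_filter.1 hp).2.2 (funext fun x => Finset.sum_eq_zero fun v hv => ?_)
    by_cases h1 : fiber n P μ (halfIndex Q c) g p.1 v = 0
    · simp [h1]
    · simp [h0 v hv h1]

lemma sq_sum_eq_diag_add_offDiag {α : Type*} [DecidableEq α] (W : Finset α) (t : α → ℝ) :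
    (∑ w ∈ W, t w) ^ 2 = ∑ w ∈ W, t w ^ 2 + ∑ p ∈ W.offDiag, t p.1 * t p.2 := by
  rw [sq, Finset.sum_mul_sum, ← Finset.sum_product', ← Finset.diag_union_offDiag,
    Finset.sum_union (Finset.disjoint_diag_offDiag W), Finset.sum_diag]
  simp only [sq]

/-- The constant of `scale_bound`. -/
def scaleConst (e : ℕ) (C : ℝ) : ℝ :=
  128 ^ (4 * e) * (8 * (((e : ℝ) + 2) ^ 4 * 256 ^ (4 * e) + (2 * (e : ℝ) + 1) ^ 6 * C ^ 2))

/-- The square function over all triples `(c, v, z)` at one scale, with `w` summed inside, followed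
by expansion of the square in `w`. -/
lemma scale_square {S : Finset (ι → ℕ)} (hS : Split E P Q)
    (hSE : ∀ c ∈ S, ∀ l ∉ E, c l = 0) (hf : Fam τ E n W h M c₀ N f)
    (hg : Fam τ E n W h M c₀ N' g) (hset : Setting E n W h M a k)
    {i j : ι} (hi : i ∈ Q) (hmi : ∀ l ∈ Q, μ l ≤ μ i) (hj : j ∈ P) (hmj : ∀ l ∈ P, μ l ≤ μ j) :
    ∃ S₁ : ℝ, 0 ≤ S₁ ∧ S₁ ^ 2 ≤ ((a : ℝ) * (E.card + 2) * (n : ℝ) ^ (E.card - 1)) ^ 2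
        * ((2 : ℝ) ^ μ i * 2 ^ μ j) * ((256 * (k : ℝ)) ^ (E.card - 2)
        * ((∏ l ∈ P.erase j, (2 : ℝ) ^ μ l) * ∏ l ∈ Q.erase i, (2 : ℝ) ^ μ l)) ^ 2 ∧
      mnorm (2 * k) (fun x => ∑ w ∈ W, ∑ c ∈ S,
        ∑ r ∈ cell n E μ (halfIndex P c), ∑ s ∈ cell n E μ (halfIndex Q c),
          f w r x * g w s x) ^ 2
      ≤ (128 * (k : ℝ)) ^ E.card * (S₁ + ∑ c ∈ S, ∑ p ∈ W.offDiag, mnorm k (fun x =>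
      (∑ v ∈ cell n P μ (halfIndex P c), fiber n Q μ (halfIndex P c) f p.1 v x
        * fiber n Q μ (halfIndex P c) f p.2 v x)
      * ∑ z ∈ cell n Q μ (halfIndex Q c), fiber n P μ (halfIndex Q c) g p.1 z x
        * fiber n P μ (halfIndex Q c) g p.2 z x)) := by
  classical
  have hk := hset.two_le
  set J : Finset (Σ _ : ι → ℕ, (ι → ℕ) × (ι → ℕ)) :=
    S.sigma fun c => cell n P μ (halfIndex P c) ×ˢ cell n Q μ (halfIndex Q c) with hJ
  set A : (ι → ℕ) → (Σ _ : ι → ℕ, (ι → ℕ) × (ι → ℕ)) → Ω → ℝ :=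
    fun w m => fiber n Q μ (halfIndex P m.1) f w m.2.1 with hA
  set B : (ι → ℕ) → (Σ _ : ι → ℕ, (ι → ℕ) × (ι → ℕ)) → Ω → ℝ :=
    fun w m => fiber n P μ (halfIndex Q m.1) g w m.2.2 with hB
  have hmem : ∀ m ∈ J, m.1 ∈ S ∧ m.2.1 ∈ cell n P μ (halfIndex P m.1) ∧
      m.2.2 ∈ cell n Q μ (halfIndex Q m.1) := fun m hm => by
    have h1 := Finset.mem_sigma.1 hm
    have h2 := Finset.mem_product.1 h1.2
    exact ⟨h1.1, h2.1, h2.2⟩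
  have hinj : ∀ m ∈ J, ∀ m' ∈ J,
      (∀ l ∈ E, (m.2.1 + m.2.2) l = (m'.2.1 + m'.2.2) l) → m = m' := by
    intro m hm m' hm' e
    obtain ⟨hc, hv, hz⟩ := hmem m hm
    obtain ⟨hc', hv', hz'⟩ := hmem m' hm'
    have hvc := cell_subset_cube _ _ _ _ hv
    have hzc := cell_subset_cube _ _ _ _ hz
    have hvc' := cell_subset_cube _ _ _ _ hv'
    have hzc' := cell_subset_cube _ _ _ _ hz'
    have e1 : m.2.1 = m'.2.1 := boxOn_ext hvc hvc' fun l hl => by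
      have := e l (hS.left_subset hl)
      rwa [hS.add_left _ hzc hl, hS.add_left _ hzc' hl] at this
    have e2 : m.2.2 = m'.2.2 := boxOn_ext hzc hzc' fun l hl => by
      have := e l (hS.right_subset hl)
      rwa [hS.add_right _ hvc hl, hS.add_right _ hvc' hl] at this
    -- The block index is recovered from the maximum vector, since `v` and `z` lie in upper halves.
    have e3 : m.1 = m'.1 := by
      funext l
      by_cases hl : l ∈ E
      · rw [← hS.union, Finset.mem_union] at hl
        rcases hl with hl | hl
        · have h1 := (mem_cell.1 hv).2 l hl
          have h2 := (mem_cell.1 hv').2 l hl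
          rw [e1, h2] at h1
          simp only [halfIndex, hl, if_true] at h1
          omega
        · have h1 := (mem_cell.1 hz).2 l hl
          have h2 := (mem_cell.1 hz').2 l hl
          rw [e2, h2] at h1
          simp only [halfIndex, hl, if_true] at h1
          omega
      · rw [hSE _ hc l hl, hSE _ hc' l hl]
    exact Sigma.ext e3 (heq_of_eq (Prod.ext e1 e2))
  have hsum : ∀ x, ∑ w ∈ W, ∑ c ∈ S, ∑ r ∈ cell n E μ (halfIndex P c),
      ∑ s ∈ cell n E μ (halfIndex Q c), f w r x * g w s x
      = ∑ m ∈ J, ∑ w ∈ W, A w m x * B w m x := by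
    intro x
    rw [Finset.sum_comm, hJ, Finset.sum_sigma]
    refine Finset.sum_congr rfl fun c _ => ?_
    refine Eq.trans (Finset.sum_congr rfl fun w _ => ?_) Finset.sum_comm
    rw [← Finset.sum_mul_sum, hS.sum_cell, hS.symm.sum_cell, Finset.sum_mul_sum,
      Finset.sum_product]
    rfl
  simp only [hsum]
  refine ⟨_, Finset.sum_nonneg fun w _ => Finset.sum_nonneg fun m _ => mnorm_nonneg _ _,
    diag_bound hS hf hg hset J (fun m => m.1) (fun m => m.2.1) (fun m => m.2.2) hinj
      (fun m hm => (hmem m hm).2.1) (fun m hm => (hmem m hm).2.2) hi hmi hj hmj, ?_⟩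
  refine (square_function τ E J (fun m => m.2.1 + m.2.2) _ hk (fun m hm => Lvl.sum _ fun w hw =>
    fiber_mul_lvl hS hf hg hw (hmem m hm).2.1 (hmem m hm).2.2) hinj).trans ?_
  refine mul_le_mul_of_nonneg_left ?_ (by positivity)
  -- For fixed `c` the pairs `(v, z)` form a full product, so each off-diagonal term separates into
  -- a sum over `v` times a sum over `z`.
  have hdec : ∀ x, ∑ m ∈ J, (∑ w ∈ W, A w m x * B w m x) ^ 2
      = (∑ w ∈ W, ∑ m ∈ J, (A w m x * B w m x) ^ 2) + ∑ c ∈ S, ∑ p ∈ W.offDiag,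
      (∑ v ∈ cell n P μ (halfIndex P c), fiber n Q μ (halfIndex P c) f p.1 v x
        * fiber n Q μ (halfIndex P c) f p.2 v x)
      * ∑ z ∈ cell n Q μ (halfIndex Q c), fiber n P μ (halfIndex Q c) g p.1 z x
        * fiber n P μ (halfIndex Q c) g p.2 z x := by
    intro x
    simp only [sq_sum_eq_diag_add_offDiag, Finset.sum_add_distrib]
    congr 1
    · exact Finset.sum_comm
    · rw [hJ, Finset.sum_sigma]
      refine Finset.sum_congr rfl fun c _ => ?_
      rw [Finset.sum_comm]
      refine Finset.sum_congr rfl fun p _ => ?_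
      rw [Finset.sum_mul_sum, Finset.sum_product]
      exact Finset.sum_congr rfl fun v _ => Finset.sum_congr rfl fun z _ => by
        simp only [hA, hB]; ring
  refine (congrArg (mnorm k) (funext hdec)).trans_le ?_
  have hk0 : k ≠ 0 := by omega
  refine (mnorm_add_le hk0 _ _).trans (add_le_add ?_ ?_)
  · refine (mnorm_sum_le hk0 _ _).trans (Finset.sum_le_sum fun w _ => ?_)
    exact mnorm_sum_le hk0 J fun m x => (A w m x * B w m x) ^ 2
  · refine (mnorm_sum_le hk0 _ _).trans (Finset.sum_le_sum fun c _ => ?_)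
    exact mnorm_sum_le hk0 _ _

/-- Eighth powers appear because the off-diagonal part is controlled in fourth power and enters the
square of the norm. The last product is the decay that makes the scales summable. -/
lemma scale_bound {e : ℕ} {C : ℝ} (hFull : FullBound ι e C) (hC : 0 ≤ C) (hS : Split E P Q)
    (hP : P.Nonempty) (hQ : Q.Nonempty) (hPe : P.card ≤ e) (hQe : Q.card ≤ e)
    (hf : Fam τ E n W h M c₀ N f) (hg : Fam τ E n W h M c₀ N' g) (hset : Setting E n W h M a k)
    (hμ : ∀ l ∈ E, μ l < M l) :
    mnorm (2 * k) (fun x => ∑ w ∈ W, ∑ c ∈ subBlocks n E M c₀ μ,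
      ∑ r ∈ cell n E μ (halfIndex P c), ∑ s ∈ cell n E μ (halfIndex Q c), f w r x * g w s x) ^ 8
      ≤ scaleConst E.card C * bnd k n a E M ^ 2 * ∏ l ∈ E, ((2 : ℝ) ^ μ l / 2 ^ M l) := by
  have hk := hset.two_le
  have hμM : ∀ l ∈ E, 2 ^ μ l ≤ 2 ^ M l := fun l hl =>
    Nat.pow_le_pow_right (by norm_num) (hμ l hl).le
  have hμn : ∀ l ∈ E, 2 ^ μ l ≤ n := fun l hl => (hμM l hl).trans (hset.pow_le l hl)
  obtain ⟨i, hi, hmi⟩ := Q.exists_max_image μ hQ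
  obtain ⟨j, hj, hmj⟩ := P.exists_max_image μ hP
  obtain ⟨S₁, hS₁, h1, hsq⟩ := scale_square (μ := μ) (S := subBlocks n E M c₀ μ) hS
    (fun c hc => (mem_boxOn.1 hc).2) hf hg hset hi hmi hj hmj
  have h2 := off_bound hFull hC hS hPe hQe hf hg hset hμn hi hmi hj hmj (subBlocks n E M c₀ μ)
  set S₂ := ∑ c ∈ subBlocks n E M c₀ μ, ∑ p ∈ W.offDiag, mnorm k (fun x =>
      (∑ v ∈ cell n P μ (halfIndex P c), fiber n Q μ (halfIndex P c) f p.1 v x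
        * fiber n Q μ (halfIndex P c) f p.2 v x)
      * ∑ z ∈ cell n Q μ (halfIndex Q c), fiber n P μ (halfIndex Q c) g p.1 z x
        * fiber n P μ (halfIndex Q c) g p.2 z x) with hS₂
  have hS₂0 : 0 ≤ S₂ := Finset.sum_nonneg fun _ _ => Finset.sum_nonneg fun _ _ => mnorm_nonneg _ _
  obtain ⟨p, hp⟩ : ∃ p, P.card = p + 1 := ⟨P.card - 1, by
    have := Finset.card_pos.2 hP; omega⟩
  obtain ⟨q, hq⟩ : ∃ q, Q.card = q + 1 := ⟨Q.card - 1, by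
    have := Finset.card_pos.2 hQ; omega⟩
  have hE : E.card = p + q + 2 := by rw [hS.card, hp, hq]; ring
  have hPprod := Finset.mul_prod_erase P (fun l => (2 : ℝ) ^ μ l) hj
  have hQprod := Finset.mul_prod_erase Q (fun l => (2 : ℝ) ^ μ l) hi
  have hEprod : ∏ l ∈ E, (2 : ℝ) ^ μ l = (∏ l ∈ P, (2 : ℝ) ^ μ l) * ∏ l ∈ Q, (2 : ℝ) ^ μ l := by
    rw [← hS.union, Finset.prod_union hS.disj]
  rw [Finset.prod_div_distrib]
  set X := ∏ l ∈ E, (2 : ℝ) ^ M l with hX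
  have hX0 : 0 < X := by positivity
  have hYX : ∏ l ∈ E, (2 : ℝ) ^ μ l ≤ X :=
    Finset.prod_le_prod (fun _ _ => by positivity) fun l hl => by exact_mod_cast hμM l hl
  have hXn : X ≤ (n : ℝ) ^ (p + q + 2) := by
    rw [← hE, ← Finset.prod_const]
    exact Finset.prod_le_prod (fun _ _ => by positivity) fun l hl => by
      exact_mod_cast hset.pow_le l hl
  have hcX : ((subBlocks n E M c₀ μ).card : ℝ) * ∏ l ∈ E, (2 : ℝ) ^ μ l ≤ X := by
    have h3 : ((subBlocks n E M c₀ μ).card : ℝ) ≤ ∏ l ∈ E, (2 : ℝ) ^ (M l - μ l - 1) := by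
      exact_mod_cast card_subBlocks_le n E M c₀ μ
    calc _ ≤ (∏ l ∈ E, (2 : ℝ) ^ (M l - μ l - 1)) * ∏ l ∈ E, (2 : ℝ) ^ μ l := by gcongr
      _ = ∏ l ∈ E, ((2 : ℝ) ^ (M l - μ l - 1) * 2 ^ μ l) := Finset.prod_mul_distrib.symm
      _ ≤ X := Finset.prod_le_prod (fun _ _ => by positivity) fun l hl => by
        rw [← pow_add]
        exact pow_le_pow_right₀ (by norm_num) (by have := hμ l hl; omega)
  have hRP : ∏ l ∈ P.erase j, (2 : ℝ) ^ μ l ≤ (n : ℝ) ^ p := by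
    rw [show p = (P.erase j).card by rw [Finset.card_erase_of_mem hj, hp]; rfl,
      ← Finset.prod_const]
    exact Finset.prod_le_prod (fun _ _ => by positivity) fun l hl => by
      exact_mod_cast hμn l (hS.left_subset (Finset.mem_of_mem_erase hl))
  have hRQ : ∏ l ∈ Q.erase i, (2 : ℝ) ^ μ l ≤ (n : ℝ) ^ q := by
    rw [show q = (Q.erase i).card by rw [Finset.card_erase_of_mem hi, hq]; rfl,
      ← Finset.prod_const]
    exact Finset.prod_le_prod (fun _ _ => by positivity) fun l hl => by
      exact_mod_cast hμn l (hS.right_subset (Finset.mem_of_mem_erase hl))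
  set R₁ := ∏ l ∈ P.erase j, (2 : ℝ) ^ μ l with hR₁
  set R₂ := ∏ l ∈ Q.erase i, (2 : ℝ) ^ μ l with hR₂
  have hR₁0 : 0 ≤ R₁ := by positivity
  have hR₂0 : 0 ≤ R₂ := by positivity
  have hEY : ∏ l ∈ E, (2 : ℝ) ^ μ l = 2 ^ μ i * 2 ^ μ j * R₁ * R₂ := by
    rw [hEprod, ← hPprod, ← hQprod]; ring
  rw [hEY] at hYX hcX
  rw [hEY]
  simp only [bnd] at h2 ⊢
  rw [← hPprod, ← hQprod, hp, hq, show 4 * (p + 1) - 2 = 4 * p + 2 by omega,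
    show 4 * (q + 1) - 2 = 4 * q + 2 by omega, show 3 * (p + 1) - 3 = 3 * p by omega,
    show 3 * (q + 1) - 3 = 3 * q by omega] at h2
  push_cast at h2
  rw [hE] at h1 hsq h2
  have hfin := scale_arith p q (k := (k : ℝ)) (n := n) (a := a) (by exact_mod_cast (by omega : 1 ≤ k))
    (Nat.cast_nonneg n) (Nat.cast_nonneg a) (by exact_mod_cast hset.a_le)
    (e := ((p + q + 2 : ℕ) : ℝ)) (Nat.cast_nonneg _)
    (κ := 2 * ((p + q + 2 : ℕ) : ℝ) + 1) (Nat.cast_nonneg _)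
    (yi := 2 ^ μ i) (yj := 2 ^ μ j) (by positivity)
    (by positivity) hR₁0 hR₂0 hS₁ hS₂0 (sq_nonneg _) h1 h2 hcX hYX hXn
    (by rw [pow_add]; gcongr) hsq
  rw [← pow_mul] at hfin
  refine hfin.trans ?_
  rw [hE, show 4 * (p + q + 2) - 2 = 4 * (p + q) + 6 by omega,
    show 3 * (p + q + 2) - 3 = 3 * (p + q) + 3 by omega, ← hX]
  have hconst : (128 : ℝ) ^ (4 * (p + q + 2)) * (8 * ((((p + q + 2 : ℕ) : ℝ) + 2) ^ 4
      * 256 ^ (4 * (p + q)) + (2 * ((p + q + 2 : ℕ) : ℝ) + 1) ^ 6 * C ^ 2))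
      ≤ scaleConst (p + q + 2) C := by
    have : (256 : ℝ) ^ (4 * (p + q)) ≤ 256 ^ (4 * (p + q + 2)) :=
      pow_le_pow_right₀ (by norm_num) (by omega)
    unfold scaleConst
    gcongr
  calc _ ≤ scaleConst (p + q + 2) C * ((k : ℝ) ^ (8 * (p + q) + 12) * (n : ℝ) ^ (6 * (p + q) + 6)
        * (a : ℝ) ^ 2 * X * (2 ^ μ i * 2 ^ μ j * R₁ * R₂)) := by gcongr
    _ = _ := by
      field_simp
      ring

end Scale

end BeckGain

namespace BeckGain

variable {ι : Type} [Fintype ι] [DecidableEq ι]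

/-! ### Summation over the scales -/

lemma sum_boxOn_prod (S : Finset ι) (t : ι → Finset ℕ) (F : ι → ℕ → ℝ) :
    ∑ x ∈ boxOn S t, ∏ l ∈ S, F l (x l) = ∏ l ∈ S, ∑ m ∈ t l, F l m := by
  have h := Finset.prod_univ_sum (fun l => if l ∈ S then t l else {0})
    (fun l m => if l ∈ S then F l m else 1)
  have h1 : ∀ l, ∑ m ∈ (if l ∈ S then t l else {0}), (if l ∈ S then F l m else 1)
      = if l ∈ S then ∑ m ∈ t l, F l m else 1 := by
    intro l
    by_cases hl : l ∈ S <;> simp [hl]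
  simp only [h1, Finset.prod_ite_mem, Finset.univ_inter] at h
  exact h.symm

lemma sum_pow_sub_le {θ : ℝ} (h0 : 0 ≤ θ) (h1 : θ < 1) (M : ℕ) :
    ∑ m ∈ Finset.range M, θ ^ (M - m) ≤ 1 / (1 - θ) := by
  have key : ∀ M : ℕ, (∑ m ∈ Finset.range M, θ ^ (M - m)) * (1 - θ) ≤ 1 - θ ^ M := by
    intro M
    induction M with
    | zero => simp
    | succ M ih =>
      rw [Finset.sum_range_succ']
      simp only [Nat.add_sub_add_right, Nat.sub_zero]
      have := mul_nonneg (pow_nonneg h0 M) (sq_nonneg (1 - θ))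
      rw [add_mul]
      nlinarith [pow_succ θ M]
  rw [le_div_iff₀ (by linarith)]
  exact (key M).trans (by linarith [pow_nonneg h0 M])

/-- The eighth root of `1 / 2`. -/
noncomputable def rootHalf : ℝ := (1 / 2 : ℝ) ^ (1 / 8 : ℝ)

lemma rootHalf_pow : rootHalf ^ 8 = 1 / 2 := by
  rw [rootHalf, ← Real.rpow_natCast, ← Real.rpow_mul (by norm_num)]
  norm_num

lemma rootHalf_nonneg : 0 ≤ rootHalf := Real.rpow_nonneg (by norm_num) _

lemma rootHalf_lt_one : rootHalf < 1 := by
  by_contra h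
  have := one_le_pow₀ (not_lt.1 h) (n := 8)
  rw [rootHalf_pow] at this
  norm_num at this

/-- The constant of `mixed_bound`. -/
noncomputable def mixedConst (e : ℕ) (C : ℝ) : ℝ :=
  √(scaleConst e C) * ((1 / (1 - rootHalf)) ^ e) ^ 4

lemma scaleConst_nonneg (e : ℕ) (C : ℝ) : 0 ≤ scaleConst e C := by
  unfold scaleConst; positivity

lemma mixedConst_nonneg (e : ℕ) (C : ℝ) : 0 ≤ mixedConst e C := by
  have := rootHalf_lt_one
  have : 0 < 1 - rootHalf := by linarith
  unfold mixedConst; positivity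

lemma mixedConst_mono {e e' : ℕ} (he : e ≤ e') (C : ℝ) : mixedConst e C ≤ mixedConst e' C := by
  have h1 := rootHalf_lt_one
  have h0 := rootHalf_nonneg
  have h2 : 0 < 1 - rootHalf := by linarith
  have h3 : 1 ≤ 1 / (1 - rootHalf) := by rw [le_div_iff₀ h2]; linarith
  have h4 : (128 : ℝ) ^ (4 * e) ≤ 128 ^ (4 * e') := pow_le_pow_right₀ (by norm_num) (by omega)
  have h5 : (256 : ℝ) ^ (4 * e) ≤ 256 ^ (4 * e') := pow_le_pow_right₀ (by norm_num) (by omega)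
  have h6 : (e : ℝ) ≤ e' := by exact_mod_cast he
  have h7 : scaleConst e C ≤ scaleConst e' C := by
    unfold scaleConst
    gcongr
  have h8 := pow_le_pow_right₀ h3 he
  have h9 := Real.sqrt_le_sqrt h7
  unfold mixedConst
  gcongr

/-- Taking eighth roots turns the decay into a product of geometric terms of ratio `rootHalf`, whose
sum is bounded independently of `M`. -/
lemma sum_scales_le {E : Finset ι} (M : ι → ℕ) {x : (ι → ℕ) → ℝ} {S : ℝ} (hS : 0 ≤ S)
    (hx0 : ∀ μ, 0 ≤ x μ)
    (hx : ∀ μ ∈ boxOn E fun l => Finset.range (M l),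
      x μ ^ 8 ≤ S * ∏ l ∈ E, ((2 : ℝ) ^ μ l / 2 ^ M l)) :
    (∑ μ ∈ boxOn E fun l => Finset.range (M l), x μ) ^ 8
      ≤ S * ((1 / (1 - rootHalf)) ^ E.card) ^ 8 := by
  set σ : ℝ := S ^ (1 / 8 : ℝ) with hσ
  have hσ8 : σ ^ 8 = S := by
    rw [hσ, ← Real.rpow_natCast, ← Real.rpow_mul hS]
    norm_num
  have hσ0 : 0 ≤ σ := Real.rpow_nonneg hS _
  have h0 := rootHalf_nonneg
  have h1 : ∀ μ ∈ boxOn E fun l => Finset.range (M l),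
      x μ ≤ σ * ∏ l ∈ E, rootHalf ^ (M l - μ l) := by
    intro μ hμ
    refine le_of_pow_le_pow_left₀ (n := 8) (by norm_num)
      (mul_nonneg hσ0 (Finset.prod_nonneg fun _ _ => pow_nonneg h0 _)) ?_
    refine (hx μ hμ).trans_eq ?_
    rw [mul_pow, hσ8, ← Finset.prod_pow]
    congr 1
    refine Finset.prod_congr rfl fun l hl => ?_
    have hlt : μ l < M l := Finset.mem_range.1 ((mem_boxOn.1 hμ).1 l hl)
    rw [← pow_mul, mul_comm, pow_mul, rootHalf_pow, one_div, inv_pow, div_eq_iff (by positivity),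
      ← div_eq_inv_mul, eq_div_iff (by positivity), ← pow_add]
    congr 1; omega
  have h2 : ∑ μ ∈ boxOn E fun l => Finset.range (M l), x μ
      ≤ σ * (1 / (1 - rootHalf)) ^ E.card := by
    refine (Finset.sum_le_sum h1).trans ?_
    rw [← Finset.mul_sum, sum_boxOn_prod E _ fun l m => rootHalf ^ (M l - m), ← Finset.prod_const]
    refine mul_le_mul_of_nonneg_left ?_ hσ0
    exact Finset.prod_le_prod (fun _ _ => Finset.sum_nonneg fun _ _ => pow_nonneg h0 _)
      fun l _ => sum_pow_sub_le h0 rootHalf_lt_one _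
  calc _ ≤ (σ * (1 / (1 - rootHalf)) ^ E.card) ^ 8 :=
        pow_le_pow_left₀ (Finset.sum_nonneg fun _ _ => hx0 _) h2 8
    _ = _ := by rw [mul_pow, hσ8]

section

variable {Ω : Type} [Fintype Ω] {τ : ι → ℕ → Equiv.Perm Ω} {E P Q : Finset ι} {n : ℕ}
  {W : Finset (ι → ℕ)} {h : (ι → ℕ) → ℕ} {M c₀ : ι → ℕ} {N N' a k : ℕ}
  {f g : (ι → ℕ) → (ι → ℕ) → Ω → ℝ}

/-- Both `P` and its complement are nonempty, hence smaller than `E`; this is why bounds for sets of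
size at most `e` suffice. -/
lemma mixed_bound {e : ℕ} {C : ℝ} (hFull : FullBound ι e C) (hC : 0 ≤ C) (hPE : P ⊆ E)
    (hP : P.Nonempty) (hQ : (E \ P).Nonempty) (hPe : P.card ≤ e) (hQe : (E \ P).card ≤ e)
    (hf : Fam τ E n W h M c₀ N f) (hg : Fam τ E n W h M c₀ N' g) (hset : Setting E n W h M a k) :
    mnorm (2 * k) (fun x => ∑ w ∈ W, ∑ r ∈ cube n E, ∑ s ∈ cube n E,
      if (∀ l ∈ P, s l < r l) ∧ ∀ l ∈ E \ P, r l < s l then f w r x * g w s x else 0) ^ 4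
      ≤ mixedConst E.card C * bnd k n a E M := by
  have hS : Split E P (E \ P) := ⟨Finset.disjoint_sdiff, Finset.union_sdiff_of_subset hPE⟩
  have hk := hset.two_le
  have hb := bnd_nonneg k n a E M
  have hsum : ∀ x, ∑ w ∈ W, ∑ r ∈ cube n E, ∑ s ∈ cube n E,
      (if (∀ l ∈ P, s l < r l) ∧ ∀ l ∈ E \ P, r l < s l then f w r x * g w s x else 0)
      = ∑ μ ∈ boxOn E fun l => Finset.range (M l), ∑ w ∈ W, ∑ c ∈ subBlocks n E M c₀ μ,
        ∑ r ∈ cell n E μ (halfIndex P c), ∑ s ∈ cell n E μ (halfIndex (E \ P) c),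
          f w r x * g w s x := by
    intro x
    refine Eq.trans (Finset.sum_congr rfl fun w hw => ?_) Finset.sum_comm
    refine whitney_sum hPE M c₀ (fun r s => f w r x * g w s x) fun r hr s hs h0 l hl => ?_
    have h1 : f w r ≠ 0 := fun e => h0 (by rw [e]; simp)
    have h2 : g w s ≠ 0 := fun e => h0 (by rw [e]; simp)
    exact ⟨(hf.supp w hw r hr h1).2 l hl, (hg.supp w hw s hs h2).2 l hl⟩
  simp only [hsum]
  have h8 := sum_scales_le (E := E) M (S := scaleConst E.card C * bnd k n a E M ^ 2)
    (x := fun μ => mnorm (2 * k) fun x => ∑ w ∈ W, ∑ c ∈ subBlocks n E M c₀ μ,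
        ∑ r ∈ cell n E μ (halfIndex P c), ∑ s ∈ cell n E μ (halfIndex (E \ P) c),
          f w r x * g w s x)
    (mul_nonneg (scaleConst_nonneg _ _) (sq_nonneg _)) (fun _ => mnorm_nonneg _ _)
    fun μ hμ => scale_bound hFull hC hS hP hQ hPe hQe hf hg hset
      fun l hl => Finset.mem_range.1 ((mem_boxOn.1 hμ).1 l hl)
  refine le_of_pow_le_pow_left₀ (n := 2) (by norm_num)
    (mul_nonneg (mixedConst_nonneg _ _) hb) ?_
  rw [← pow_mul]
  refine (pow_le_pow_left₀ (mnorm_nonneg _ _) (mnorm_sum_le (by omega) _ _) _).trans (h8.trans_eq ?_)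
  rw [mixedConst, mul_pow, mul_pow, Real.sq_sqrt (scaleConst_nonneg _ _)]
  ring

/-! ### Sign patterns and the induction on the number of coordinates -/

lemma sign_sum {E : Finset ι} (r s : ι → ℕ) (F : ℝ) :
    (if ∀ l ∈ E, r l ≠ s l then F else 0) = ∑ P ∈ E.powerset,
      if (∀ l ∈ P, s l < r l) ∧ ∀ l ∈ E \ P, r l < s l then F else 0 := by
  have huniq : ∀ P ⊆ E, ((∀ l ∈ P, s l < r l) ∧ ∀ l ∈ E \ P, r l < s l) →
      P = E.filter fun l => s l < r l := by
    intro P hP h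
    ext l
    rw [Finset.mem_filter]
    refine ⟨fun hl => ⟨hP hl, h.1 l hl⟩, fun hl => ?_⟩
    by_contra hlP
    exact absurd (h.2 l (Finset.mem_sdiff.2 ⟨hl.1, hlP⟩)) hl.2.not_gt
  by_cases hne : ∀ l ∈ E, r l ≠ s l
  · rw [if_pos hne, Finset.sum_eq_single_of_mem (E.filter fun l => s l < r l)
      (Finset.mem_powerset.2 (Finset.filter_subset _ _)), if_pos]
    · refine ⟨fun l hl => (Finset.mem_filter.1 hl).2, fun l hl => ?_⟩
      rw [Finset.mem_sdiff, Finset.mem_filter, not_and] at hl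
      exact lt_of_le_of_ne (not_lt.1 (hl.2 hl.1)) (hne l hl.1)
    · exact fun P hP hP' => if_neg fun h => hP' (huniq P (Finset.mem_powerset.1 hP) h)
  · rw [if_neg hne]
    symm
    refine Finset.sum_eq_zero fun P hP => if_neg fun h => hne fun l hl => ?_
    by_cases hlP : l ∈ P
    · exact (h.1 l hlP).ne'
    · exact (h.2 l (Finset.mem_sdiff.2 ⟨hl, hlP⟩)).ne

end

/-- There are at most `2 ^ (e + 1)` sign patterns. The two pure ones need no induction; the empty
one is the full one with `f` and `g` exchanged. -/
lemma FullBound.strict {e : ℕ} {C : ℝ} (hC : 0 ≤ C) (hFull : FullBound ι e C) :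
    StrictBound ι (e + 1)
      (((2 : ℝ) ^ (e + 1)) ^ 4 * (128 ^ (4 * (e + 1)) + mixedConst (e + 1) C)) := by
  intro Ω _ τ E n W h M c₀ N N' a k f g hE hEe hset hf hg
  have hk := hset.two_le
  have hb := bnd_nonneg k n a E M
  have hm0 := mixedConst_nonneg (e + 1) C
  simp only [sign_sum]
  have hsum : ∀ x, ∑ w ∈ W, ∑ r ∈ cube n E, ∑ s ∈ cube n E, ∑ P ∈ E.powerset,
      (if (∀ l ∈ P, s l < r l) ∧ ∀ l ∈ E \ P, r l < s l then f w r x * g w s x else 0)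
      = ∑ P ∈ E.powerset, ∑ w ∈ W, ∑ r ∈ cube n E, ∑ s ∈ cube n E,
      if (∀ l ∈ P, s l < r l) ∧ ∀ l ∈ E \ P, r l < s l then f w r x * g w s x else 0 := by
    intro x
    refine Eq.trans (Finset.sum_congr rfl fun w _ => ?_) Finset.sum_comm
    exact Eq.trans (Finset.sum_congr rfl fun r _ => Finset.sum_comm) Finset.sum_comm
  simp only [hsum]
  have h128 : (128 : ℝ) ^ (4 * E.card - 2) ≤ 128 ^ (4 * (e + 1)) :=
    pow_le_pow_right₀ (by norm_num) (by omega)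
  refine (mnorm_sum_pow_le (by omega) _ _
    (T := (128 ^ (4 * (e + 1)) + mixedConst (e + 1) C) * bnd k n a E M) fun P hP => ?_).trans ?_
  · have hPE := Finset.mem_powerset.1 hP
    rcases P.eq_empty_or_nonempty with rfl | hP0
    · have h1 := ordered_bound hE hset hg hf
      refine le_trans (le_of_eq ?_) (h1.trans (mul_le_mul_of_nonneg_right (by linarith) hb))
      congr 2
      funext x
      refine Finset.sum_congr rfl fun w _ => ?_
      rw [Finset.sum_comm]
      refine Finset.sum_congr rfl fun r _ => Finset.sum_congr rfl fun s _ => ?_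
      simp [mul_comm]
    · rcases (E \ P).eq_empty_or_nonempty with hQ | hQ
      · have h1 := ordered_bound hE hset hf hg
        have : P = E := Finset.Subset.antisymm hPE (Finset.sdiff_eq_empty_iff_subset.1 hQ)
        subst this
        refine le_trans (le_of_eq ?_) (h1.trans (mul_le_mul_of_nonneg_right (by linarith) hb))
        simp
      · have hcard := Finset.card_sdiff_add_card_eq_card hPE
        have h1 := Finset.card_pos.2 hP0
        have h2 := Finset.card_pos.2 hQ
        refine (mixed_bound hFull hC hPE hP0 hQ (by omega) (by omega) hf hg hset).trans ?_
        refine mul_le_mul_of_nonneg_right ?_ hb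
        have := mixedConst_mono hEe C
        have : (0 : ℝ) ≤ 128 ^ (4 * (e + 1)) := by positivity
        linarith
  · rw [Finset.card_powerset, ← mul_assoc]
    push_cast
    have : (2 : ℝ) ^ E.card ≤ 2 ^ (e + 1) := pow_le_pow_right₀ (by norm_num) hEe
    gcongr

theorem exists_fullBound (ι : Type) [Fintype ι] [DecidableEq ι] (e : ℕ) :
    ∃ C : ℝ, 0 ≤ C ∧ FullBound ι e C := by
  induction e with
  | zero =>
    refine ⟨0, le_rfl, fun Ω _ τ E n W h M c₀ N N' a k f g hE hEe => ?_⟩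
    exact absurd hEe (by have := Finset.card_pos.2 hE; omega)
  | succ e ih =>
    obtain ⟨C, hC, hFull⟩ := ih
    have hm := mixedConst_nonneg (e + 1) C
    exact ⟨_, by positivity, (hFull.strict hC).full (by positivity)⟩

end BeckGain

namespace BeckGain

/-! ### Binary digits -/

/-- Flip the binary digit of order `2 ^ (K - 1 - t)`. -/
def flipDigit (K t a : ℕ) : ℕ := if t < K then a ^^^ 2 ^ (K - 1 - t) else a

lemma flipDigit_lt {K t a : ℕ} (ha : a < 2 ^ K) : flipDigit K t a < 2 ^ K := by
  unfold flipDigit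
  split_ifs with h
  · exact Nat.xor_lt_two_pow ha (Nat.pow_lt_pow_right (by norm_num) (by omega))
  · exact ha

lemma flipDigit_flipDigit (K t a : ℕ) : flipDigit K t (flipDigit K t a) = a := by
  unfold flipDigit
  split_ifs with h
  · rw [Nat.xor_assoc, Nat.xor_self, Nat.xor_zero]
  · rfl

lemma flipDigit_div {K t a j : ℕ} (h : K - 1 - t < j) : flipDigit K t a / 2 ^ j = a / 2 ^ j := by
  unfold flipDigit
  split_ifs with ht
  · rw [Nat.xor_div_two_pow, Nat.div_eq_of_lt (Nat.pow_lt_pow_right (by norm_num) h),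
      Nat.xor_zero]
  · rfl

/-- The sign of the Haar function of side exponent `r` on the cell with index `a` of side
`2 ^ (-K)`. -/
noncomputable def digitSign (K r a : ℕ) : ℝ := if a / 2 ^ (K - r - 1) % 2 = 0 then -1 else 1

lemma abs_digitSign (K r a : ℕ) : |digitSign K r a| = 1 := by
  unfold digitSign
  split_ifs <;> simp

lemma digitSign_flip_of_lt {K r t : ℕ} (hr : r < K) (ht : r < t) (a : ℕ) :
    digitSign K r (flipDigit K t a) = digitSign K r a := by
  by_cases htK : t < K
  · rw [digitSign, flipDigit_div (by omega), digitSign]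
  · rw [flipDigit, if_neg htK]

lemma digitSign_flip_self {K r : ℕ} (hr : r < K) (a : ℕ) :
    digitSign K r (flipDigit K r a) = -digitSign K r a := by
  have h : flipDigit K r a / 2 ^ (K - r - 1) % 2 = (a / 2 ^ (K - r - 1) + 1) % 2 := by
    rw [flipDigit, if_pos hr, Nat.xor_div_two_pow, show K - 1 - r = K - r - 1 by omega,
      Nat.div_self (by positivity), Nat.xor_mod_two_eq]
  rw [digitSign, digitSign, h]
  split_ifs <;> first | omega | norm_num

/-- The symmetry of the discrete cube that flips the digit `t` of the coordinate `l`. -/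
def flipPerm (d K : ℕ) (l : Fin d) (t : ℕ) : Equiv.Perm (Fin d → Fin (2 ^ K)) :=
  Function.Involutive.toPerm
    (fun ω => Function.update ω l ⟨flipDigit K t (ω l), flipDigit_lt (ω l).2⟩) fun ω => by
      simp [flipDigit_flipDigit]

lemma flipPerm_same {d K : ℕ} (l : Fin d) (t : ℕ) (ω : Fin d → Fin (2 ^ K)) :
    ((flipPerm d K l t ω l : Fin (2 ^ K)) : ℕ) = flipDigit K t (ω l) := by
  change ((Function.update ω l _ l : Fin (2 ^ K)) : ℕ) = _
  rw [Function.update_self]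

lemma flipPerm_ne {d K : ℕ} {l k : Fin d} (h : k ≠ l) (t : ℕ) (ω : Fin d → Fin (2 ^ K)) :
    flipPerm d K l t ω k = ω k := by
  change Function.update ω l _ k = _
  rw [Function.update_of_ne h]

/-- The value of `rFun α r` on the cell with index `ω` of side `2 ^ (-K)`. -/
noncomputable def cellFun {d : ℕ} (K : ℕ) (α : (Fin d → ℕ) → (Fin d → ℕ) → ℝ) (r : Fin d → ℕ)
    (ω : Fin d → Fin (2 ^ K)) : ℝ :=
  Real.sign (α r fun k => (ω k : ℕ) / 2 ^ (K - r k)) * ∏ k, digitSign K (r k) (ω k)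

lemma abs_sign_le (x : ℝ) : |Real.sign x| ≤ 1 := by
  rcases Real.sign_apply_eq x with h | h | h <;> rw [h] <;> norm_num

lemma abs_cellFun_le {d : ℕ} (K : ℕ) (α : (Fin d → ℕ) → (Fin d → ℕ) → ℝ) (r : Fin d → ℕ)
    (ω : Fin d → Fin (2 ^ K)) : |cellFun K α r ω| ≤ 1 := by
  rw [cellFun, abs_mul, Finset.abs_prod]
  simp only [abs_digitSign, Finset.prod_const_one, mul_one]
  exact abs_sign_le _

/-- The coefficient depends, in each coordinate, only on digits of order before `r l`, and the Haar
sign only on the digit of order `r l`. Flipping that digit changes the sign, and flipping a later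
one changes nothing. -/
lemma cellFun_lvl {d K : ℕ} (α : (Fin d → ℕ) → (Fin d → ℕ) → ℝ) {r : Fin d → ℕ}
    (hr : ∀ l, r l < K) : Lvl (flipPerm d K) Finset.univ r (cellFun K α r) := by
  intro l _
  have hpos : ∀ t, r l ≤ t → ∀ ω : Fin d → Fin (2 ^ K),
      (fun k => (flipPerm d K l t ω k : ℕ) / 2 ^ (K - r k))
        = fun k => (ω k : ℕ) / 2 ^ (K - r k) := by
    intro t ht ω
    funext k
    by_cases hk : k = l
    · subst hk
      have := hr k
      rw [flipPerm_same, flipDigit_div (by omega)]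
    · rw [flipPerm_ne hk]
  have hprod : ∀ t (ω : Fin d → Fin (2 ^ K)), ∏ k, digitSign K (r k) (flipPerm d K l t ω k)
      = digitSign K (r l) (flipDigit K t (ω l))
        * ∏ k ∈ Finset.univ.erase l, digitSign K (r k) (ω k) := by
    intro t ω
    rw [← Finset.mul_prod_erase _ _ (Finset.mem_univ l), flipPerm_same]
    congr 1
    exact Finset.prod_congr rfl fun k hk => by rw [flipPerm_ne (Finset.ne_of_mem_erase hk)]
  constructor
  · intro ω
    rw [cellFun, hpos _ le_rfl, hprod, digitSign_flip_self (hr l), cellFun,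
      ← Finset.mul_prod_erase _ _ (Finset.mem_univ l)]
    ring
  · intro t ht ω
    rw [cellFun, hpos _ ht.le, hprod, digitSign_flip_of_lt (hr l) ht, cellFun,
      ← Finset.mul_prod_erase _ _ (Finset.mem_univ l)]

/-! ### The bound on the discrete cube -/

lemma split_singleton {d : ℕ} (k : Fin d) :
    Split (Finset.univ : Finset (Fin d)) {k} (Finset.univ.erase k) :=
  ⟨by simp, by rw [← Finset.insert_eq, Finset.insert_erase (Finset.mem_univ k)]⟩

lemma Split.sum_cube {ι : Type} [Fintype ι] [DecidableEq ι] {E P Q : Finset ι} (hS : Split E P Q)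
    (n : ℕ) (F : (ι → ℕ) → ℝ) :
    ∑ r ∈ cube n E, F r = ∑ v ∈ cube n P, ∑ z ∈ cube n Q, F (v + z) := by
  rw [cube, ← hS.union, sum_boxOn_union hS.disj]
  rfl

lemma sum_coincidence_eq {d n : ℕ} (k : Fin d) (A B : Finset (Fin d → ℕ))
    (hA : A ⊆ cube n Finset.univ) (hB : B ⊆ cube n Finset.univ) (F G : (Fin d → ℕ) → ℝ) :
    ∑ rs ∈ (A ×ˢ B).filter (fun rs => rs.1 ≠ rs.2 ∧ rs.1 k = rs.2 k), F rs.1 * G rs.2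
      = ∑ w ∈ cube n {k}, ∑ r ∈ cube n (Finset.univ.erase k), ∑ s ∈ cube n (Finset.univ.erase k),
        if r ≠ s then (if w + r ∈ A then F (w + r) else 0) * (if w + s ∈ B then G (w + s) else 0)
        else 0 := by
  have hS := split_singleton k
  have hsplit : ∀ H : (Fin d → ℕ) → ℝ, ∑ r ∈ cube n Finset.univ, H r
      = ∑ w ∈ cube n {k}, ∑ r ∈ cube n (Finset.univ.erase k), H (w + r) := fun H => hS.sum_cube n H
  have hext : ∀ (A : Finset (Fin d → ℕ)), A ⊆ cube n Finset.univ → ∀ H : (Fin d → ℕ) → ℝ,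
      ∑ r ∈ A, H r = ∑ r ∈ cube n Finset.univ, if r ∈ A then H r else 0 := fun A hA H => by
    rw [← Finset.sum_filter, Finset.filter_mem_eq_inter, Finset.inter_eq_right.2 hA]
  rw [Finset.sum_filter, Finset.sum_product, hext A hA, hsplit]
  refine Finset.sum_congr rfl fun w hw => Finset.sum_congr rfl fun r hr => ?_
  rw [hext B hB, hsplit, Finset.sum_eq_single_of_mem w hw]
  · by_cases hwA : w + r ∈ A
    · simp only [hwA, if_true]
      refine Finset.sum_congr rfl fun s hs => ?_
      have h1 : (w + r) k = (w + s) k := by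
        rw [hS.add_left w hr (Finset.mem_singleton_self k),
          hS.add_left w hs (Finset.mem_singleton_self k)]
      by_cases hrs : r = s
      · simp [hrs]
      · have : w + r ≠ w + s := fun e => hrs (add_left_cancel e)
        simp [hrs, h1]
    · simp [hwA]
  · intro w' hw' hne
    have h1 : ∀ s ∈ cube n (Finset.univ.erase k), (w + r) k ≠ (w' + s) k := fun s hs e => by
      rw [hS.add_left w hr (Finset.mem_singleton_self k),
        hS.add_left w' hs (Finset.mem_singleton_self k)] at e
      exact hne (boxOn_ext hw' hw fun l hl => by rw [Finset.mem_singleton.1 hl]; exact e.symm)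
    refine Finset.sum_eq_zero fun s hs => ?_
    simp only [h1 s hs, and_false, if_false, ite_self]

lemma mem_slab {d : ℕ} {hd : 0 < d} {n : ℕ} {J : Finset ℕ} {r : Fin d → ℕ}
    (hr : r ∈ slab hd n J) : ∑ k, r k = n ∧ ∀ k, r k ≤ n := by
  have h := (Finset.mem_piAntidiag.1 (Finset.mem_filter.1 hr).1).1
  exact ⟨h, fun k => h ▸ Finset.single_le_sum (fun _ _ => Nat.zero_le _) (Finset.mem_univ k)⟩

/-- The top-level instance: the coincident coordinate is the index and its own height, and `[0, 2 ^
ν)` is the only block. Membership in the slab is built in by setting the other functions to zero. -/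
lemma slab_fam {d : ℕ} (hd : 0 < d) {n ν K : ℕ} (hK : n < K)
    (α : (Fin d → ℕ) → (Fin d → ℕ) → ℝ) (J : Finset ℕ) (k : Fin d) :
    Fam (flipPerm d K) (Finset.univ.erase k) (2 ^ ν) (cube (2 ^ ν) {k}) (fun w => w k)
      (fun _ => ν) (fun _ => 0) n
      (fun w r ω => if w + r ∈ slab hd n J then cellFun K α (w + r) ω else 0) := by
  have hS := split_singleton k
  refine ⟨fun w hw r hr => ?_, fun w hw r hr ω => ?_, fun w hw r hr h0 => ?_⟩
  · by_cases h : w + r ∈ slab hd n J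
    · simp only [h, if_true]
      exact ((cellFun_lvl α fun l => ((mem_slab h).2 l).trans_lt hK).mono
        (Finset.subset_univ _)).congr fun l hl => hS.add_right r hw hl
    · simp only [h, if_false]
      exact fun l _ => ⟨fun x => by simp, fun t _ x => rfl⟩
  · by_cases h : w + r ∈ slab hd n J
    · simpa only [h, if_true] using abs_cellFun_le K α _ ω
    · simp [h]
  · by_cases h : w + r ∈ slab hd n J
    · have h1 := (mem_slab h).1
      rw [hS.sum_add hw hr, Finset.sum_singleton] at h1
      refine ⟨h1, fun l hl => Nat.div_eq_of_lt ?_⟩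
      exact Finset.mem_range.1 ((mem_boxOn.1 hr).1 l hl)
    · simp only [h, if_false] at h0
      exact absurd rfl h0

/-- With `d - 1` coordinates and `a` and all block lengths equal to `2 ^ ν`, the exponent of `2 ^ ν`
in `bnd` is 3(d-2) + 1 + (d-1) = 4d - 6, the same as that of `q`. -/
lemma discrete_bound {d : ℕ} (hd : 0 < d) (hd2 : 3 ≤ d) {C : ℝ} (hC : FullBound (Fin d) (d - 1) C)
    {n ν K q : ℕ} (hn : n < 2 ^ ν) (hK : n < K) (hq : 2 ≤ q)
    (α : (Fin d → ℕ) → (Fin d → ℕ) → ℝ) (J₁ J₂ : Finset ℕ) (k : Fin d) :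
    mnorm (2 * q) (fun ω => ∑ rs ∈ coincidencePairs hd n J₁ J₂ k,
      cellFun K α rs.1 ω * cellFun K α rs.2 ω) ^ 4
      ≤ C * ((q : ℝ) * 2 ^ ν) ^ (4 * d - 6) := by
  have hsub : ∀ J, slab hd n J ⊆ cube (2 ^ ν) Finset.univ := fun J r hr =>
    mem_boxOn.2 ⟨fun l _ => Finset.mem_range.2 (((mem_slab hr).2 l).trans_lt hn),
      fun l hl => absurd (Finset.mem_univ l) hl⟩
  have hcard : (Finset.univ.erase k).card = d - 1 := by
    rw [Finset.card_erase_of_mem (Finset.mem_univ k), Finset.card_fin]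
  have hset : Setting (Finset.univ.erase k) (2 ^ ν) (cube (2 ^ ν) {k}) (fun w => w k)
      (fun _ => ν) (2 ^ ν) q := by
    refine ⟨hq, fun w hw w' hw' e => ?_, ?_, le_rfl, fun _ _ => le_rfl⟩
    · exact boxOn_ext hw hw' fun l hl => by rw [Finset.mem_singleton.1 hl]; exact e
    · rw [cube, card_boxOn]; simp
  have h := hC (Fin d → Fin (2 ^ K)) (flipPerm d K) (Finset.univ.erase k) (2 ^ ν) _ _ _ _ _ _
    (2 ^ ν) q _ _ (Finset.card_pos.1 (by omega)) hcard.le hset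
    (slab_fam hd hK α J₁ k) (slab_fam hd hK α J₂ k)
  have hsum : (fun ω => ∑ rs ∈ coincidencePairs hd n J₁ J₂ k,
      cellFun K α rs.1 ω * cellFun K α rs.2 ω) = _ := funext fun ω =>
    sum_coincidence_eq k _ _ (hsub J₁) (hsub J₂) (fun r => cellFun K α r ω)
      fun r => cellFun K α r ω
  rw [hsum]
  refine h.trans_eq ?_
  rw [bnd, hcard, Finset.prod_const, hcard, mul_pow, ← pow_mul]
  push_cast
  rw [show 4 * (d - 1) - 2 = 4 * d - 6 by omega, mul_assoc, mul_assoc, ← pow_mul, ← pow_mul,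
    ← pow_add, ← pow_add]
  congr 3
  obtain ⟨e, rfl⟩ : ∃ e, d = e + 3 := ⟨d - 3, by omega⟩
  rw [show 3 * (e + 3 - 1) - 3 = 3 * e + 3 by omega, show e + 3 - 1 = e + 2 by omega,
    show 4 * (e + 3) - 6 = 4 * e + 6 by omega]
  ring

end BeckGain

namespace BeckGain

/-! ### Dyadic cells -/

/-- A cell of the finer generation lies in exactly one interval of the coarser one, found by
dropping the last `K - s` digits. -/
lemma mem_dyadicInterval_iff {K a s j : ℕ} {x : ℝ} (hx : x ∈ dyadicInterval K a) (hs : s ≤ K) :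
    x ∈ dyadicInterval s j ↔ a / 2 ^ (K - s) = j := by
  have hD : (0 : ℝ) < 2 ^ (K - s) := by positivity
  have hs0 : (0 : ℝ) < 2 ^ s := by positivity
  have hK : (2 : ℝ) ^ K = 2 ^ (K - s) * 2 ^ s := by rw [← pow_add]; congr 1; omega
  obtain ⟨h1, h2⟩ := hx
  rw [div_le_iff₀ (by positivity), hK] at h1
  rw [lt_div_iff₀ (by positivity), hK] at h2
  set y := x * 2 ^ s with hy
  have hxy : x * (2 ^ (K - s) * 2 ^ s) = 2 ^ (K - s) * y := by rw [hy]; ring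
  rw [hxy] at h1 h2
  have hiff : x ∈ dyadicInterval s j ↔ (j : ℝ) ≤ y ∧ y < j + 1 := by
    rw [dyadicInterval, Set.mem_Ico, div_le_iff₀ hs0, lt_div_iff₀ hs0]
  rw [hiff]
  constructor
  · rintro ⟨h3, h4⟩
    have h5 : (j * 2 ^ (K - s) : ℕ) < a + 1 := by
      have : (j : ℝ) * 2 ^ (K - s) < a + 1 := by nlinarith
      exact_mod_cast this
    have h6 : a < (j + 1) * 2 ^ (K - s) := by
      have : (a : ℝ) < (j + 1) * 2 ^ (K - s) := by nlinarith
      exact_mod_cast this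
    exact Nat.div_eq_of_lt_le (by omega) h6
  · rintro rfl
    have h3 : ((a / 2 ^ (K - s) * 2 ^ (K - s) : ℕ) : ℝ) ≤ a := by
      exact_mod_cast Nat.div_mul_le_self a _
    have h4 : ((a + 1 : ℕ) : ℝ) ≤ ((a / 2 ^ (K - s) + 1) * 2 ^ (K - s) : ℕ) := by
      exact_mod_cast Nat.lt_mul_of_div_lt (Nat.lt_succ_self (a / 2 ^ (K - s))) (by positivity)
    push_cast at h3 h4
    constructor <;> nlinarith

lemma haar_eq {K a r m : ℕ} {x : ℝ} (hx : x ∈ dyadicInterval K a) (hr : r < K) :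
    haar r m x = if a / 2 ^ (K - r) = m then digitSign K r a else 0 := by
  have h1 : a / 2 ^ (K - r) = a / 2 ^ (K - (r + 1)) / 2 := by
    rw [Nat.div_div_eq_div_mul, ← pow_succ]; congr 2; omega
  classical
  simp only [haar, Set.indicator_apply, mem_dyadicInterval_iff hx (show r + 1 ≤ K from hr),
    digitSign, h1, Nat.sub_sub, Pi.one_apply]
  generalize a / 2 ^ (K - (r + 1)) = b
  split_ifs <;> first | omega | norm_num

lemma rFun_eq {d K : ℕ} {ω : Fin d → Fin (2 ^ K)} {x : Fin d → ℝ}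
    (hx : ∀ k, x k ∈ dyadicInterval K (ω k)) (α : (Fin d → ℕ) → (Fin d → ℕ) → ℝ) {r : Fin d → ℕ}
    (hr : ∀ k, r k < K) : rFun α r x = cellFun K α r ω := by
  set m₀ : Fin d → ℕ := fun k => (ω k : ℕ) / 2 ^ (K - r k) with hm₀
  have h1 : ∀ m, haarRect r m x = if m = m₀ then ∏ k, digitSign K (r k) (ω k) else 0 := by
    intro m
    simp only [haarRect, haar_eq (hx _) (hr _)]
    by_cases h : m = m₀
    · simp [h, hm₀]
    · obtain ⟨k, hk⟩ := Function.ne_iff.1 h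
      rw [if_neg h]
      exact Finset.prod_eq_zero (Finset.mem_univ k) (if_neg fun e => hk e.symm)
  have hmem : m₀ ∈ positions r := by
    refine Fintype.mem_piFinset.2 fun k => Finset.mem_range.2 ?_
    rw [hm₀, Nat.div_lt_iff_lt_mul (by positivity), ← pow_add,
      show r k + (K - r k) = K by have := hr k; omega]
    exact (ω k).2
  rw [rFun, cellFun, Finset.sum_eq_single_of_mem m₀ hmem]
  · rw [h1, if_pos rfl]
  · intro m _ hm
    rw [h1, if_neg hm, mul_zero]

lemma exists_mem_dyadicInterval {x : ℝ} (hx : x ∈ Set.Ico (0 : ℝ) 1) (K : ℕ) :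
    ∃ a : Fin (2 ^ K), x ∈ dyadicInterval K a := by
  have hK : (0 : ℝ) < 2 ^ K := by positivity
  have h0 : 0 ≤ x * 2 ^ K := mul_nonneg hx.1 hK.le
  have hlt : ⌊x * 2 ^ K⌋₊ < 2 ^ K := by
    rw [Nat.floor_lt h0]
    push_cast
    nlinarith [hx.2]
  refine ⟨⟨_, hlt⟩, ?_, ?_⟩
  · rw [div_le_iff₀ hK]; exact Nat.floor_le h0
  · rw [lt_div_iff₀ hK]; exact Nat.lt_floor_add_one _

/-! ### Transfer to the unit cube -/

open MeasureTheory

lemma volume_cell {d K : ℕ} (ω : Fin d → Fin (2 ^ K)) :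
    volume (Set.pi Set.univ fun k => dyadicInterval K (ω k))
      = ENNReal.ofReal (1 / (Fintype.card (Fin d → Fin (2 ^ K)))) := by
  have h : ∀ k, volume (dyadicInterval K (ω k)) = ENNReal.ofReal (1 / 2 ^ K) := fun k => by
    rw [dyadicInterval, Real.volume_Ico]
    congr 1
    ring
  rw [volume_pi_pi]
  simp only [h, Finset.prod_const, Finset.card_fin]
  rw [← ENNReal.ofReal_pow (by positivity)]
  simp

/-- Only an upper bound is needed, so countable subadditivity over the covering cells suffices and
their disjointness plays no role. -/
lemma eLpNorm_le_mnorm {d K m : ℕ} (hm : m ≠ 0) (F : (Fin d → ℝ) → ℝ)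
    (G : (Fin d → Fin (2 ^ K)) → ℝ)
    (h : ∀ ω x, (∀ k, x k ∈ dyadicInterval K (ω k)) → F x = G ω) :
    eLpNorm F (m : ENNReal) (volume.restrict (Set.Icc (0 : Fin d → ℝ) 1))
      ≤ ENNReal.ofReal (mnorm m G) := by
  have hcov : (Set.pi Set.univ fun _ : Fin d => Set.Ico (0 : ℝ) 1)
      ⊆ ⋃ ω : Fin d → Fin (2 ^ K), Set.pi Set.univ fun k => dyadicInterval K (ω k) := by
    intro x hx
    choose ω hω using fun k => exists_mem_dyadicInterval (hx k (Set.mem_univ k)) K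
    exact Set.mem_iUnion.2 ⟨ω, fun k _ => hω k⟩
  rw [eLpNorm_eq_lintegral_rpow_enorm_toReal (by simpa using hm) (by simp), mnorm,
    ← ENNReal.ofReal_rpow_of_nonneg (avg_nonneg m G) (by positivity)]
  simp only [ENNReal.toReal_natCast, ENNReal.rpow_natCast]
  refine ENNReal.rpow_le_rpow ?_ (by positivity)
  calc ∫⁻ x in Set.Icc (0 : Fin d → ℝ) 1, ‖F x‖ₑ ^ m
      = ∫⁻ x in Set.pi Set.univ fun _ : Fin d => Set.Ico (0 : ℝ) 1, ‖F x‖ₑ ^ m := by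
        exact setLIntegral_congr
          (Measure.univ_pi_Ico_ae_eq_Icc (f := fun _ => (0 : ℝ)) (g := fun _ => 1)).symm
    _ ≤ ∫⁻ x in ⋃ ω : Fin d → Fin (2 ^ K), Set.pi Set.univ fun k => dyadicInterval K (ω k),
          ‖F x‖ₑ ^ m := lintegral_mono_set hcov
    _ ≤ ∑' ω : Fin d → Fin (2 ^ K), ∫⁻ x in Set.pi Set.univ fun k => dyadicInterval K (ω k),
          ‖F x‖ₑ ^ m := lintegral_iUnion_le _ _
    _ = ∑ ω : Fin d → Fin (2 ^ K), ENNReal.ofReal (|G ω| ^ m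
          * (1 / (Fintype.card (Fin d → Fin (2 ^ K))))) := by
        rw [tsum_fintype]
        refine Finset.sum_congr rfl fun ω _ => ?_
        have hmeas : MeasurableSet (Set.pi Set.univ fun k => dyadicInterval K (ω k)) :=
          MeasurableSet.univ_pi fun k => measurableSet_Ico
        rw [setLIntegral_congr_fun (g := fun _ => ‖G ω‖ₑ ^ m) hmeas
          fun x hx => by simp only [h ω x fun k => hx k (Set.mem_univ k)],
          setLIntegral_const, volume_cell, ENNReal.ofReal_mul (by positivity),
          ENNReal.ofReal_pow (abs_nonneg _), Real.enorm_eq_ofReal_abs]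
    _ = _ := by
        rw [← ENNReal.ofReal_sum_of_nonneg fun _ _ => by positivity, ← Finset.sum_mul,
          mul_one_div]

lemma measurable_haar (r m : ℕ) : Measurable (haar r m) := by
  unfold haar
  exact ((measurable_one.indicator measurableSet_Ico).neg).add
    (measurable_one.indicator measurableSet_Ico)

lemma measurable_Phi {d : ℕ} (hd : 0 < d) (α : (Fin d → ℕ) → (Fin d → ℕ) → ℝ) (n : ℕ)
    (J₁ J₂ : Finset ℕ) (k : Fin d) : Measurable (Phi hd α n J₁ J₂ k) := by
  have h : ∀ r, Measurable (rFun α r) := fun r => by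
    unfold rFun haarRect
    exact Finset.measurable_fun_sum _ fun m _ => measurable_const.mul
      (Finset.measurable_fun_prod _ fun k _ => (measurable_haar _ _).comp (measurable_pi_apply k))
  unfold Phi
  exact Finset.measurable_fun_sum _ fun rs _ => (h _).mul (h _)

lemma eLpNorm_Phi_le {d : ℕ} (hd : 0 < d) (hd3 : 3 ≤ d) {C : ℝ}
    (hC : FullBound (Fin d) (d - 1) C) {n ν q : ℕ} (hn : n < 2 ^ ν) (hq : 2 ≤ q)
    (α : (Fin d → ℕ) → (Fin d → ℕ) → ℝ) (J₁ J₂ : Finset ℕ) (k : Fin d) {p B : ℝ}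
    (hpq : p ≤ 2 * q) (hB : 0 ≤ B) (hCB : C * ((q : ℝ) * 2 ^ ν) ^ (4 * d - 6) ≤ B ^ 4) :
    eLpNorm (Phi hd α n J₁ J₂ k) (ENNReal.ofReal p)
      (volume.restrict (Set.Icc (0 : Fin d → ℝ) 1)) ≤ ENNReal.ofReal B := by
  have hprob : IsProbabilityMeasure (volume.restrict (Set.Icc (0 : Fin d → ℝ) 1)) :=
    ⟨by simp [Real.volume_Icc_pi]⟩
  have hexp : ENNReal.ofReal p ≤ ((2 * q : ℕ) : ENNReal) := by
    rw [← ENNReal.ofReal_natCast]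
    exact ENNReal.ofReal_le_ofReal (by push_cast; exact hpq)
  refine (eLpNorm_le_eLpNorm_of_exponent_le hexp
    (measurable_Phi hd α n J₁ J₂ k).aestronglyMeasurable).trans ?_
  -- All exponents are at most `n`, and a Haar function of exponent `r` is constant on cells of
  -- generation `r + 1`.
  refine (eLpNorm_le_mnorm (K := n + 1) (by omega) _ (fun ω => ∑ rs ∈ coincidencePairs hd n J₁ J₂ k,
    cellFun (n + 1) α rs.1 ω * cellFun (n + 1) α rs.2 ω) fun ω x hx => ?_).trans ?_
  · refine Finset.sum_congr rfl fun rs hrs => ?_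
    have h := Finset.mem_product.1 (Finset.mem_filter.1 hrs).1
    rw [rFun_eq hx α fun l => Nat.lt_succ_of_le ((mem_slab h.1).2 l),
      rFun_eq hx α fun l => Nat.lt_succ_of_le ((mem_slab h.2).2 l)]
  · refine ENNReal.ofReal_le_ofReal (le_of_pow_le_pow_left₀ (n := 4) (by norm_num) hB ?_)
    exact (discrete_bound hd hd3 hC hn (Nat.lt_succ_self n) hq α J₁ J₂ k).trans hCB

lemma rpow_four_mul {x : ℝ} (hx : 0 ≤ x) {d : ℕ} (hd : 3 ≤ d) :
    (x ^ ((d : ℝ) - 3 / 2)) ^ 4 = x ^ (4 * d - 6) := by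
  rw [← Real.rpow_natCast, ← Real.rpow_mul hx, ← Real.rpow_natCast]
  congr 1
  rw [Nat.cast_sub (by omega)]
  push_cast
  ring

end BeckGain

/-! ### Choice of parameters -/

theorem mainTheorem6 (d : ℕ) (hd : 3 ≤ d) :
    ∃ C : ℝ, 0 < C ∧
      ∀ (n q : ℕ) (I : Fin q → Finset ℕ), BeckGain.IsDivision n q I →
      ∀ (α : (Fin d → ℕ) → (Fin d → ℕ) → ℝ) (t₁ t₂ : Fin q) (k : Fin d) (p : ℝ), 2 ≤ p →
        MeasureTheory.eLpNorm
            (BeckGain.Phi (lt_of_lt_of_le (by norm_num) hd) α n (I t₁) (I t₂) k)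
            (ENNReal.ofReal p)
            (MeasureTheory.volume.restrict (Set.Icc (0 : Fin d → ℝ) 1))
          ≤ ENNReal.ofReal
              (C * p ^ ((d : ℝ) - 1 / 2) * (n : ℝ) ^ ((d : ℝ) - 3 / 2)) := by
  obtain ⟨C, hC0, hC⟩ := BeckGain.exists_fullBound (Fin d) (d - 1)
  have hd' : (3 : ℝ) ≤ d := by exact_mod_cast hd
  refine ⟨(C + 1) * 4 ^ ((d : ℝ) - 3 / 2), by positivity, ?_⟩
  intro n q I hI α t₁ t₂ k p hp
  -- For `n = 0` the right-hand side vanishes, and so does the sum, since the intervals are empty.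
  rcases Nat.eq_zero_or_pos n with rfl | hn
  · have hslab : ∀ t, I t = ∅ := fun t => by
      have h : I t ⊆ Finset.univ.biUnion I := Finset.subset_biUnion_of_mem I (Finset.mem_univ t)
      rw [hI.union_eq] at h
      exact Finset.subset_empty.1 h
    have h0 : BeckGain.Phi (lt_of_lt_of_le (by norm_num) hd) α 0 (I t₁) (I t₂) k = 0 := by
      funext x
      simp [BeckGain.Phi, BeckGain.coincidencePairs, BeckGain.slab, hslab]
    rw [h0, MeasureTheory.eLpNorm_zero]
    exact zero_le
  have hp0 : 0 ≤ p := by linarith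
  have hceil : (⌈p⌉₊ : ℝ) ≤ 2 * p := by
    have := Nat.ceil_lt_add_one hp0
    linarith
  have hν1 : n < 2 ^ (Nat.log 2 n + 1) := Nat.lt_pow_succ_log_self (by norm_num) n
  have hν2 : ((2 : ℝ) ^ (Nat.log 2 n + 1)) ≤ 2 * n := by
    have := Nat.pow_log_le_self 2 hn.ne'
    rw [pow_succ, mul_comm]
    gcongr
    exact_mod_cast this
  -- The integer `q = ⌈p⌉₊` satisfies `2 ≤ q ≤ 2p` and `p ≤ 2q`, and `2 ^ ν` is the first power of
  -- two exceeding `n`, at most `2n`. The two factors 2 make the 4 in the constant.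
  refine BeckGain.eLpNorm_Phi_le _ hd hC hν1 (q := ⌈p⌉₊) ?_ α (I t₁) (I t₂) k ?_ (by positivity) ?_
  · have : (2 : ℝ) ≤ ⌈p⌉₊ := hp.trans (Nat.le_ceil p)
    exact_mod_cast this
  · linarith [Nat.le_ceil p]
  -- The only loss from the exponent `d - 3/2` of `p` to the stated `d - 1/2`.
  have hpow : p ^ ((d : ℝ) - 3 / 2) ≤ p ^ ((d : ℝ) - 1 / 2) :=
    Real.rpow_le_rpow_of_exponent_le (by linarith) (by linarith)
  have hC4 : C ≤ (C + 1) ^ 4 := by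
    have := one_le_pow₀ (by linarith : 1 ≤ C + 1) (n := 3)
    nlinarith
  calc C * ((⌈p⌉₊ : ℝ) * 2 ^ (Nat.log 2 n + 1)) ^ (4 * d - 6)
      ≤ (C + 1) ^ 4 * (4 * p * n) ^ (4 * d - 6) := by
        have h4 : (⌈p⌉₊ : ℝ) * 2 ^ (Nat.log 2 n + 1) ≤ 4 * p * n :=
          (mul_le_mul hceil hν2 (by positivity) (by positivity)).trans_eq (by ring)
        exact mul_le_mul hC4 (pow_le_pow_left₀ (by positivity) h4 _) (by positivity) (by positivity)
    _ = ((C + 1) * 4 ^ ((d : ℝ) - 3 / 2) * p ^ ((d : ℝ) - 3 / 2) * (n : ℝ) ^ ((d : ℝ) - 3 / 2)) ^ 4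
        := by
        rw [← BeckGain.rpow_four_mul (by positivity) hd, ← mul_pow,
          Real.mul_rpow (by positivity) (by positivity), Real.mul_rpow (by positivity) hp0]
        ring
    _ ≤ _ := by gcongr
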